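/- For $m\ge 2$ let $P_m$ denote the path on $m$ vertices. An edge-coloring of the complete graph $K_n$ is an arbitrary assignment of colors to its edges (adjacent edges may have the same color), and a subgraph is rainbow if its edges have pairwise distinct colors. The anti-Ramsey number $AR(n,F)$ is the maximum number of colors used by an edge-coloring of $K_n$ that contains no rainbow copy of $F$; an edge-coloring of $K_n$ that contains no rainbow copy of $F$ and uses exactly $AR(n,F)$ colors is called extremal. Let $k\ge 2$, let $t_1,\dots,t_k\ge 2$ be integers of which at least one is even, let $F=P_{t_1}\cup\dots\cup P_{t_k}$ be the vertex-disjoint union of the paths $P_{t_i}$, and put $s=\sum_{i=1}^k\lfloor t_i/2\rfloor$. Let $\varepsilon=1$ if exactly one $t_i$ is even, and $\varepsilon=0$ if at least two $t_i$ are even. Then there is a number $f(t_1,\dots,t_k)$, depending only on $t_1,\dots,t_k$, such that for every $n\ge f(t_1,\dots,t_k)$ $$AR(n,F)=\binom{s-2}{2}+(s-2)(n-s+2)+1+\varepsilon .$$ Moreover, for every such $n$, every extremal edge-coloring of $K_n$ belongs to the family $\mathcal C_F(n)$ of the edge-colorings of $K_n$ with the following property: there is a set $U$ of $s-2$ vertices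 such that all edges incident with $U$ have pairwise distinct colors, and the edges with both endpoints outside $U$ are colored with exactly $1+\varepsilon$ further colors, none of which occurs on an edge incident with $U$. -/

import Mathlib

namespace AntiRamsey

open SimpleGraph

/-- The linear forest `P_{t 0} ∪ … ∪ P_{t (k-1)}`: the vertex-disjoint union of paths, the `i`-th of
which has `t i` vertices. -/
def linearForest {k : ℕ} (t : Fin k → ℕ) : SimpleGraph (Σ i, Fin (t i)) where
  Adj x y := ∃ (i : Fin k) (a b : Fin (t i)), (pathGraph (t i)).Adj a b ∧ x = ⟨i, a⟩ ∧ y = ⟨i, b⟩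
  symm := ⟨by
    rintro x y ⟨i, a, b, h, hx, hy⟩
    exact ⟨i, b, a, h.symm, hy, hx⟩⟩
  loopless := ⟨by
    rintro x ⟨i, a, b, h, hx, hy⟩
    rw [hx] at hy
    cases hy
    exact h.ne rfl⟩

theorem linearForest_adj {k : ℕ} {t : Fin k → ℕ} (i j : Fin k) (a : Fin (t i)) (b : Fin (t j)) :
    (linearForest t).Adj ⟨i, a⟩ ⟨j, b⟩ ↔ i = j ∧ (a.val + 1 = b.val ∨ b.val + 1 = a.val) := by
  constructor
  · rintro ⟨l, a', b', h, hx, hy⟩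
    cases hx
    cases hy
    exact ⟨rfl, pathGraph_adj.1 h⟩
  · rintro ⟨rfl, h⟩
    exact ⟨i, a, b, pathGraph_adj.2 h, rfl, rfl⟩

/-- An edge-coloring of the complete graph on the vertex set `V` with colors in `S`. Any assignment
of colors to edges is allowed: adjacent edges may have the same color. -/
abbrev Coloring (V S : Type*) := (⊤ : SimpleGraph V).edgeSet → S

/-- The number of colors that an edge-coloring actually uses. -/
noncomputable def numColors {V S : Type*} (c : Coloring V S) : ℕ :=
  (Set.range c).ncard

/-- The edge-colored complete graph contains a rainbow copy of `F`: a copy of `F`, not necessarily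
induced, whose edges have pairwise distinct colors. -/
def HasRainbowCopy {V S W : Type*} (c : Coloring V S) (F : SimpleGraph W) : Prop :=
  ∃ f : Copy F (⊤ : SimpleGraph V), Function.Injective fun e : F.edgeSet => c (f.mapEdgeSet e)

/-- The numbers of colors in the edge-colorings of `K_n` without a rainbow copy of `F`. As `K_n` is
finite, natural numbers suffice as colors. -/
def rainbowFreeColorCounts {W : Type*} (n : ℕ) (F : SimpleGraph W) : Set ℕ :=
  {m | ∃ c : Coloring (Fin n) ℕ, ¬ HasRainbowCopy c F ∧ numColors c = m}

/-- The anti-Ramsey number `AR(n, F)`: the maximum number of colors in an edge-coloring of `K_n`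
without a rainbow copy of `F`. -/
noncomputable def antiRamseyNumber {W : Type*} (n : ℕ) (F : SimpleGraph W) : ℕ :=
  sSup (rainbowFreeColorCounts n F)

/-- The supremum defining `AR(n, F)` is a maximum as soon as some coloring has no rainbow `F`. -/
theorem isGreatest_antiRamseyNumber {W : Type*} {n : ℕ} {F : SimpleGraph W}
    (h : (rainbowFreeColorCounts n F).Nonempty) :
    IsGreatest (rainbowFreeColorCounts n F) (antiRamseyNumber n F) := by
  have hb : BddAbove (rainbowFreeColorCounts n F) := by
    refine ⟨Nat.card (⊤ : SimpleGraph (Fin n)).edgeSet, ?_⟩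
    rintro m ⟨c, -, rfl⟩
    have := Set.ncard_image_le (f := c) (s := Set.univ) Set.finite_univ
    rwa [Set.image_univ, Set.ncard_univ] at this
  exact ⟨Nat.sSup_mem h hb, fun m hm => le_csSup hb hm⟩

/-- An extremal edge-coloring of `K_n` for `F`: it has no rainbow copy of `F` and uses exactly
`AR(n, F)` colors. -/
def IsExtremal {W S : Type*} {n : ℕ} (F : SimpleGraph W) (c : Coloring (Fin n) S) : Prop :=
  ¬ HasRainbowCopy c F ∧ numColors c = antiRamseyNumber n F

/-- The quantity `⌊t_1 / 2⌋ + … + ⌊t_k / 2⌋`. -/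
def halfSum {k : ℕ} (t : Fin k → ℕ) : ℕ := ∑ i, t i / 2

/-- `ε = 1` if exactly one `t i` is even, and `ε = 0` otherwise. -/
def epsilon {k : ℕ} (t : Fin k → ℕ) : ℕ :=
  if (Finset.univ.filter fun i => Even (t i)).card = 1 then 1 else 0

/-- The edges of the complete graph on `V` with at least one endpoint in `U`. -/
def incidentEdges {V : Type*} (U : Finset V) : Set (⊤ : SimpleGraph V).edgeSet :=
  {e | ∃ u ∈ U, u ∈ (e : Sym2 V)}

/-- The edge-coloring `c` of `K_n` belongs to the family `C_F(n)` of the linear forest `F` with path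
orders `t`: for some set `U` of `∑ ⌊t_i / 2⌋ - 2` vertices, the edges incident with `U` have
pairwise distinct colors, and the other edges (those with both endpoints outside `U`) are
colored with exactly `1 + ε` colors, none of which occurs on an edge incident with `U`. -/
def MemFamily {k : ℕ} (t : Fin k → ℕ) {n : ℕ} {S : Type*} (c : Coloring (Fin n) S) : Prop :=
  ∃ U : Finset (Fin n), U.card = halfSum t - 2 ∧
    Set.InjOn c (incidentEdges U) ∧
    (c '' (incidentEdges U)ᶜ).ncard = 1 + epsilon t ∧
    Disjoint (c '' incidentEdges U) (c '' (incidentEdges U)ᶜ)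

end AntiRamsey

/-! Write s for `halfSum t`, r = s - 2, and call the vertices of the special set U hubs.

Lower bound: in a coloring of the family, edges avoiding U show only 1 + ε colors. If exactly one t
i is even, F has 2s - 1 edges, and r hubs meet at most 2s - 4 of them, leaving at least 3 > 1 + ε.
Otherwise take a matching of s edges in F: hubs meet at most s - 2 of them, leaving 2 > 1 + ε.

Upper bound, finding hubs: choose one edge of each color. The resulting rainbow graph G has at least
about rn edges, but only O(n), since a long rainbow path could be cut into all components of F. A
weighted Erdős–Gallai bound (`degSum_add_card_le`) then yields a hub set U and many disjoint blocks,
i.e. paths whose first vertices see all of U (`exists_hubBlocks`). If g = r - |U| is positive, the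
blocks have g + 2 vertices. Either two of them can be joined by an edge of a new color, and hubs and
blocks are woven into F, or the colors of the edges between block ends define a tournament whose
Hamiltonian path is a long rainbow path (`hasRainbowPaths_of_few_hubs`). So r hubs exist, joined to
many vertices in distinct colors. A canonical Ramsey argument makes a large set S of these vertices
monochromatic, of color β: this is a core.

Using a core: a component of order t i started at a single vertex needs ⌊t i / 2⌋ hubs, so F is
exactly two hubs short. A short rainbow path outside U saves hubs: an edge saves one in an even
component, three vertices save one in any component, four vertices save two in an even component. An
edge of color β is always at hand, so a few edges of fresh colors (neither β nor used between U and
the core) complete F. Let B be the set of vertices outside U and the core. Fewer than ε + max 1 |B|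
fresh colors are possible (`IsCore.card_fresh_lt`), while in a maximal core every vertex of B makes
one edge to U superfluous (`IsCore.card_colors_le`). With the extremal number of colors this forces
B to be empty, and equality in the count gives the structure. -/

namespace AntiRamsey

open SimpleGraph

/-! ### Paths as lists, and cutting a long rainbow path. -/

section Lists

variable {V : Type*} {K : Type*}

/-- The edges joining consecutive entries of a list. -/
def pathEdges : List V → List (Sym2 V)
  | [] => []
  | [_] => []
  | a :: b :: l => s(a, b) :: pathEdges (b :: l)

@[simp] theorem pathEdges_nil : pathEdges ([] : List V) = [] := rfl

@[simp] theorem pathEdges_singleton (a : V) : pathEdges [a] = [] := rfl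

@[simp] theorem pathEdges_cons_cons (a b : V) (l : List V) :
    pathEdges (a :: b :: l) = s(a, b) :: pathEdges (b :: l) := rfl

theorem length_pathEdges (l : List V) : (pathEdges l).length = l.length - 1 := by
  induction l with
  | nil => rfl
  | cons a l ih =>
    cases l with
    | nil => rfl
    | cons b l => simp [ih]

theorem mem_of_mem_pathEdges {l : List V} {e : Sym2 V} (he : e ∈ pathEdges l) {v : V}
    (hv : v ∈ e) : v ∈ l := by
  induction l with
  | nil => simp at he
  | cons a l ih =>
    cases l with
    | nil => simp at he
    | cons b l =>
      rw [pathEdges_cons_cons, List.mem_cons] at he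
      rcases he with rfl | he
      · rcases Sym2.mem_iff.1 hv with rfl | rfl <;> simp
      · exact List.mem_cons_of_mem _ (ih he)

/-- A list of distinct vertices, consecutive ones adjacent: a path. -/
structure IsPathList (G : SimpleGraph V) (l : List V) : Prop where
  nodup : l.Nodup
  chain : l.IsChain G.Adj

theorem isChain_adj_iff {G : SimpleGraph V} {l : List V} :
    l.IsChain G.Adj ↔ ∀ e ∈ pathEdges l, e ∈ G.edgeSet := by
  induction l with
  | nil => simp
  | cons a l ih =>
    cases l with
    | nil => simp
    | cons b l => simp [List.isChain_cons_cons, ih]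

theorem not_isDiag_of_mem_pathEdges {l : List V} (hl : l.Nodup) {e : Sym2 V}
    (he : e ∈ pathEdges l) : ¬ e.IsDiag := by
  induction l with
  | nil => simp at he
  | cons a l ih =>
    cases l with
    | nil => simp at he
    | cons b l =>
      rw [pathEdges_cons_cons, List.mem_cons] at he
      rcases he with rfl | he
      · rw [Sym2.mk_isDiag_iff]
        rintro rfl
        simp at hl
      · exact ih hl.of_cons he

theorem IsPathList.reverse {G : SimpleGraph V} {l : List V} (h : IsPathList G l) :
    IsPathList G l.reverse :=
  ⟨List.nodup_reverse.2 h.nodup, by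
    rw [List.isChain_reverse]
    exact h.chain.imp fun a b hab => hab.symm⟩

theorem IsPathList.take {G : SimpleGraph V} {l : List V} (h : IsPathList G l) (n : ℕ) :
    IsPathList G (l.take n) :=
  ⟨h.nodup.sublist (List.take_sublist _ _), h.chain.take n⟩

theorem IsPathList.drop {G : SimpleGraph V} {l : List V} (h : IsPathList G l) (n : ℕ) :
    IsPathList G (l.drop n) :=
  ⟨h.nodup.sublist (List.drop_sublist _ _), h.chain.drop n⟩

theorem isPathList_singleton (G : SimpleGraph V) (a : V) : IsPathList G [a] :=
  ⟨by simp, by simp⟩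

theorem IsPathList.cons {G : SimpleGraph V} {l : List V} (h : IsPathList G l) {v : V}
    (hv : v ∉ l) (hadj : ∀ w ∈ l.head?, G.Adj v w) : IsPathList G (v :: l) :=
  ⟨List.nodup_cons.2 ⟨hv, h.nodup⟩, List.isChain_cons.2 ⟨hadj, h.chain⟩⟩

theorem IsPathList.append {G : SimpleGraph V} {l l' : List V} (h : IsPathList G l)
    (h' : IsPathList G l') (hd : l.Disjoint l')
    (hadj : ∀ x ∈ l.getLast?, ∀ y ∈ l'.head?, G.Adj x y) : IsPathList G (l ++ l') :=
  ⟨h.nodup.append h'.nodup hd, h.chain.append h'.chain hadj⟩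

/-- A rainbow graph containing vertex-disjoint paths of the prescribed orders. -/
def HasRainbowPaths (C : Sym2 V → K) {k : ℕ} (t : Fin k → ℕ) : Prop :=
  ∃ G : SimpleGraph V, Set.InjOn C G.edgeSet ∧ ∃ L : Fin k → List V,
    (∀ i, t i ≤ (L i).length) ∧ (∀ i, IsPathList G (L i)) ∧
      Pairwise fun i j => (L i).Disjoint (L j)

/-- Cut the path into k consecutive segments of T = ∑ t i vertices; each is long enough for any
component. This is why long rainbow paths may be excluded throughout. -/
theorem hasRainbowPaths_of_long {C : Sym2 V → K} {k : ℕ} {t : Fin k → ℕ} {G : SimpleGraph V}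
    (hG : Set.InjOn C G.edgeSet) {l : List V} (hl : IsPathList G l)
    (hlen : k * ∑ i, t i ≤ l.length) : HasRainbowPaths C t := by
  set T := ∑ i, t i with hT
  have hlt : ∀ i j : Fin k, i < j →
      ((l.drop (i * T)).take T).Disjoint ((l.drop (j * T)).take T) := by
    intro i j hij
    have h1 : (l.drop (i * T)).take T ⊆ l.take ((i + 1) * T) := by
      rw [List.take_drop]
      have : (i : ℕ) * T + T = (i + 1) * T := by ring
      rw [this]
      exact List.drop_subset _ _
    have h2 : (l.drop (j * T)).take T ⊆ l.drop (j * T) := List.take_subset _ _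
    have h3 : ((i : ℕ) + 1) * T ≤ j * T := Nat.mul_le_mul_right _ hij
    exact List.disjoint_of_subset_left h1
      (List.disjoint_of_subset_right h2 (List.disjoint_take_drop hl.nodup h3))
  refine ⟨G, hG, fun i => (l.drop (i * T)).take T, ?_, fun i => (hl.drop _).take _, ?_⟩
  · intro i
    have h1 : ((i : ℕ) + 1) * T ≤ k * T := Nat.mul_le_mul_right _ i.2
    have h2 : t i ≤ T := Finset.single_le_sum (f := t) (fun _ _ => Nat.zero_le _)
      (Finset.mem_univ i)
    have h3 : ((i : ℕ) + 1) * T = i * T + T := by ring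
    simp only [List.length_take, List.length_drop]
    omega
  · intro i j hij
    rcases lt_or_gt_of_ne hij with h | h
    · exact hlt i j h
    · exact (hlt j i h).symm

/-- The graph formed by the edges of a list, if it is rainbow, contains the list as a path. -/
theorem hasRainbowPaths_of_rainbow_list {C : Sym2 V → K} {k : ℕ} {t : Fin k → ℕ} {l : List V}
    (hl : l.Nodup) (hC : ((pathEdges l).map C).Nodup) (hlen : k * ∑ i, t i ≤ l.length) :
    HasRainbowPaths C t := by
  refine hasRainbowPaths_of_long (G := SimpleGraph.fromEdgeSet {e | e ∈ pathEdges l}) ?_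
    ⟨hl, isChain_adj_iff.2 ?_⟩ hlen
  · intro e he e' he' h
    rw [SimpleGraph.edgeSet_fromEdgeSet] at he he'
    exact List.inj_on_of_nodup_map hC he.1 he'.1 h
  · intro e he
    rw [SimpleGraph.edgeSet_fromEdgeSet]
    exact ⟨he, not_isDiag_of_mem_pathEdges hl he⟩

end Lists

/-! ### Weaving paths through hubs. -/

section Weave

variable {V : Type*}

/-- A path whose first vertex sees the hubs is prolonged through `b` hubs; the blocks between
consecutive hubs contribute their first vertex, the last one contributes itself entirely. -/
theorem exists_weave {G : SimpleGraph V} {T : List V} (hT : IsPathList G T) (q b : ℕ)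
    (h : Fin b → V) (B : Fin b → List V) (hinj : Function.Injective h)
    (hB : ∀ j, IsPathList G (B j)) (hq : ∀ j, (B j).length = q) (hq0 : 1 ≤ q)
    (hBB : Pairwise fun i j => (B i).Disjoint (B j))
    (hTh : ∀ j, h j ∉ T) (hTB : ∀ j, T.Disjoint (B j)) (hhB : ∀ i j, h i ∉ B j)
    (hadjT : ∀ j, ∀ v ∈ T.head?, G.Adj v (h j)) (hTne : T ≠ [])
    (hadjB : ∀ i j, ∀ v ∈ (B i).head?, G.Adj v (h j)) :
    ∃ L : List V, IsPathList G L ∧ L.length = T.length + (if b = 0 then 0 else 2 * b + q - 1) ∧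
      ∀ v ∈ L, v ∈ T ∨ (∃ j, v = h j) ∨ ∃ j, v ∈ B j := by
  induction b generalizing T with
  | zero => exact ⟨T, hT, by simp, fun v hv => Or.inl hv⟩
  | succ b ih =>
    have hh0 : IsPathList G (h 0 :: T) := hT.cons (hTh 0) fun w hw => (hadjT 0 w hw).symm
    rcases Nat.eq_zero_or_pos b with rfl | hb
    -- Paths grow at the head. The last block is entered at its first vertex and kept whole, hence
    -- the reversal; b hubs, b - 1 single vertices and this block add 2b + q - 1 vertices.
    · refine ⟨(B 0).reverse ++ h 0 :: T, (hB 0).reverse.append hh0 ?_ ?_, ?_, ?_⟩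
      · rw [List.disjoint_cons_right]
        refine ⟨by simpa using hhB 0 0, ?_⟩
        intro v hv hv'
        exact hTB 0 hv' (List.mem_reverse.1 hv)
      · intro x hx y hy
        rw [List.getLast?_reverse] at hx
        simp only [List.head?_cons, Option.mem_some_iff] at hy
        rw [← hy]
        exact hadjB 0 0 x hx
      · have := hq 0
        simp
        omega
      · intro v hv
        simp only [List.mem_append, List.mem_reverse, List.mem_cons] at hv
        rcases hv with hv | hv | hv
        · exact Or.inr (Or.inr ⟨0, hv⟩)
        · exact Or.inr (Or.inl ⟨0, hv⟩)
        · exact Or.inl hv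
    · obtain ⟨y, l, hyl⟩ : ∃ y l, B 0 = y :: l := by
        have := hq 0
        cases hB0 : B 0 with
        | nil => simp [hB0] at this; omega
        | cons y l => exact ⟨y, l, rfl⟩
      have hyB : y ∈ B 0 := by simp [hyl]
      have hy : y ∈ (B 0).head? := by simp [hyl]
      -- Only the first vertex of a non-final block is used. It sees all hubs, so the extended path
      -- is again a valid start.
      have hnew : IsPathList G (y :: h 0 :: T) := by
        refine hh0.cons ?_ ?_
        · rw [List.mem_cons]
          rintro (hy' | hy')
          · exact hhB 0 0 (hy' ▸ hyB)
          · exact hTB 0 hy' hyB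
        · intro w hw
          simp only [List.head?_cons, Option.mem_some_iff] at hw
          rw [← hw]
          exact hadjB 0 0 y hy
      obtain ⟨L, hL, hlen, hmem⟩ := ih hnew (fun j => h j.succ) (fun j => B j.succ)
        (fun i j hij => Fin.succ_injective _ (hinj hij)) (fun j => hB _) (fun j => hq _)
        (fun i j hij => hBB fun h' => hij (Fin.succ_injective _ h'))
        (by
          intro j hj
          simp only [List.mem_cons] at hj
          rcases hj with hj | hj | hj
          · exact hhB _ 0 (hj ▸ hyB)
          · exact Fin.succ_ne_zero j (hinj hj)
          · exact hTh _ hj)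
        (by
          intro j v hv hv'
          simp only [List.mem_cons] at hv
          rcases hv with rfl | rfl | hv
          · exact hBB (Fin.succ_ne_zero j).symm hyB hv'
          · exact hhB _ _ hv'
          · exact hTB _ hv hv')
        (fun i j => hhB _ _)
        (by
          intro j v hv
          simp only [List.head?_cons, Option.mem_some_iff] at hv
          rw [← hv]
          exact hadjB _ _ _ hy)
        (by simp) (fun i j => hadjB _ _)
      refine ⟨L, hL, ?_, ?_⟩
      · rw [hlen, if_neg (by omega), if_neg (by omega)]
        simp
        omega
      · intro v hv
        rcases hmem v hv with h1 | ⟨j, h1⟩ | ⟨j, h1⟩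
        · simp only [List.mem_cons] at h1
          rcases h1 with rfl | rfl | h1
          · exact Or.inr (Or.inr ⟨0, hyB⟩)
          · exact Or.inr (Or.inl ⟨0, rfl⟩)
          · exact Or.inl h1
        · exact Or.inr (Or.inl ⟨_, h1⟩)
        · exact Or.inr (Or.inr ⟨_, h1⟩)

/-- Simultaneous prolongation of several paths through disjoint sets of hubs. -/
theorem exists_weaves {G : SimpleGraph V} {k : ℕ} (T : Fin k → List V)
    (hT : ∀ i, IsPathList G (T i)) (hTne : ∀ i, T i ≠ [])
    (hTT : Pairwise fun i j => (T i).Disjoint (T j)) (q : ℕ) (hq0 : 1 ≤ q) (b : Fin k → ℕ)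
    (U : Finset V) {ι : Type*} (I : Finset ι) (B : ι → List V) (hU : ∑ i, b i ≤ U.card)
    (hI : ∑ i, b i ≤ I.card) (hB : ∀ j ∈ I, IsPathList G (B j)) (hq : ∀ j ∈ I, (B j).length = q)
    (hBB : ∀ i ∈ I, ∀ j ∈ I, i ≠ j → (B i).Disjoint (B j))
    (hTU : ∀ i, ∀ u ∈ U, u ∉ T i) (hTB : ∀ i, ∀ j ∈ I, (T i).Disjoint (B j))
    (hUB : ∀ u ∈ U, ∀ j ∈ I, u ∉ B j)
    (hadjT : ∀ i, b i ≠ 0 → ∀ u ∈ U, ∀ v ∈ (T i).head?, G.Adj v u)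
    (hadjB : ∀ j ∈ I, ∀ u ∈ U, ∀ v ∈ (B j).head?, G.Adj v u) :
    ∃ L : Fin k → List V, (∀ i, IsPathList G (L i)) ∧
      (∀ i, (L i).length = (T i).length + (if b i = 0 then 0 else 2 * b i + q - 1)) ∧
      Pairwise fun i j => (L i).Disjoint (L j) := by
  classical
  obtain ⟨eU⟩ : Nonempty ((Σ i, Fin (b i)) ↪ U) :=
    Function.Embedding.nonempty_of_card_le (by simpa using hU)
  obtain ⟨eI⟩ : Nonempty ((Σ i, Fin (b i)) ↪ I) :=
    Function.Embedding.nonempty_of_card_le (by simpa using hI)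
  have key : ∀ i, ∃ L : List V, IsPathList G L ∧
      L.length = (T i).length + (if b i = 0 then 0 else 2 * b i + q - 1) ∧
      ∀ v ∈ L, v ∈ T i ∨ (∃ j, v = eU ⟨i, j⟩) ∨ ∃ j, v ∈ B (eI ⟨i, j⟩) := by
    intro i
    refine exists_weave (hT i) q (b i) (fun j => eU ⟨i, j⟩) (fun j => B (eI ⟨i, j⟩)) ?_
      (fun j => hB _ (eI _).2) (fun j => hq _ (eI _).2) hq0 ?_ (fun j => hTU _ _ (eU _).2)
      (fun j => hTB _ _ (eI _).2) (fun j j' => hUB _ (eU _).2 _ (eI _).2)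
      (fun j => hadjT i (fun h => by have := j.2; omega) _ (eU _).2) (hTne i)
      (fun j j' => hadjB _ (eI _).2 _ (eU _).2)
    · intro j j' h
      have := eU.injective (Subtype.ext h)
      simpa using this
    · intro j j' hj
      refine hBB _ (eI _).2 _ (eI _).2 fun h => hj ?_
      have := eI.injective (Subtype.ext h)
      simpa using this
  choose L hL hlen hmem using key
  refine ⟨L, hL, hlen, ?_⟩
  intro i i' hi v hv hv'
  have hne : ∀ j j', (⟨i, j⟩ : Σ i, Fin (b i)) ≠ ⟨i', j'⟩ := fun j j' h =>
    hi (congrArg Sigma.fst h)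
  rcases hmem i v hv with h1 | ⟨j, h1⟩ | ⟨j, h1⟩ <;>
    rcases hmem i' v hv' with h2 | ⟨j', h2⟩ | ⟨j', h2⟩
  · exact hTT hi h1 h2
  · exact hTU i _ (eU ⟨i', j'⟩).2 (h2 ▸ h1)
  · exact hTB i _ (eI ⟨i', j'⟩).2 h1 h2
  · exact hTU i' _ (eU ⟨i, j⟩).2 (h1 ▸ h2)
  · exact hne j j' (eU.injective (Subtype.ext (h1.symm.trans h2)))
  · exact hUB _ (eU ⟨i, j⟩).2 _ (eI ⟨i', j'⟩).2 (h1 ▸ h2)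
  · exact hTB i' _ (eI ⟨i, j⟩).2 h2 h1
  · exact hUB _ (eU ⟨i', j'⟩).2 _ (eI ⟨i, j⟩).2 (h2 ▸ h1)
  · exact hBB _ (eI ⟨i, j⟩).2 _ (eI ⟨i', j'⟩).2
      (fun h => hne j j' (eI.injective (Subtype.ext h))) h1 h2

end Weave

/-! ### A weighted Erdős–Gallai bound. -/

section Peel

variable {V : Type*}

open Classical in
/-- The number of neighbours of `v` in the finite set `X`. -/
noncomputable def degIn (G : SimpleGraph V) (X : Finset V) (v : V) : ℕ :=
  (X.filter fun w => G.Adj v w).card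

/-- The sum of the degrees in the subgraph induced on the finite set `X`. -/
noncomputable def degSum (G : SimpleGraph V) (X : Finset V) : ℕ := ∑ v ∈ X, degIn G X v

theorem degIn_union [DecidableEq V] (G : SimpleGraph V) {A B : Finset V} (h : Disjoint A B)
    (v : V) :
    degIn G (A ∪ B) v = degIn G A v + degIn G B v := by
  classical
  unfold degIn
  rw [Finset.filter_union, Finset.card_union_of_disjoint]
  exact Finset.disjoint_filter_filter h

theorem sum_degIn_comm (G : SimpleGraph V) (A B : Finset V) :
    ∑ a ∈ A, degIn G B a = ∑ b ∈ B, degIn G A b := by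
  classical
  unfold degIn
  have := Finset.sum_card_bipartiteAbove_eq_sum_card_bipartiteBelow (s := A) (t := B)
    (r := fun a b => G.Adj a b)
  simp only [Finset.bipartiteAbove, Finset.bipartiteBelow] at this
  rw [this]
  exact Finset.sum_congr rfl fun b _ => by congr 1; ext a; simp [G.adj_comm]

theorem degSum_union [DecidableEq V] (G : SimpleGraph V) {A B : Finset V} (h : Disjoint A B) :
    degSum G (A ∪ B) = degSum G A + degSum G B + 2 * ∑ b ∈ B, degIn G A b := by
  unfold degSum
  rw [Finset.sum_union h]
  simp only [degIn_union G h, Finset.sum_add_distrib]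
  rw [sum_degIn_comm G A B]
  ring

theorem degIn_le_card (G : SimpleGraph V) (X : Finset V) (v : V) : degIn G X v ≤ X.card := by
  classical
  exact Finset.card_filter_le _ _

theorem degSum_le_card_mul_card (G : SimpleGraph V) (X : Finset V) :
    degSum G X ≤ X.card * X.card := by
  unfold degSum
  calc _ ≤ ∑ v ∈ X, X.card := Finset.sum_le_sum fun v _ => degIn_le_card G X v
    _ = _ := by simp

/-- In the absence of long paths a vertex of minimal demand lies in a clique component. -/
theorem exists_clique_component {G : SimpleGraph V} {X : Finset V} {f : V → ℕ}
    (hpath : ∀ v ∈ X, ¬ ∃ L : List V, IsPathList G L ∧ (∀ w ∈ L, w ∈ X) ∧ L.head? = some v ∧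
      L.length = f v + 2)
    (hdeg : ∀ v ∈ X, f v ≤ degIn G X v) {v₀ : V} (hv₀ : v₀ ∈ X) (hmin : ∀ v ∈ X, f v₀ ≤ f v)
    (hf : 1 ≤ f v₀) :
    ∃ A : Finset V, A ⊆ X ∧ A.card = f v₀ + 1 ∧
      ∀ w ∈ A, degIn G X w = f v₀ ∧ ∀ x ∈ X, G.Adj w x → x ∈ A := by
  classical
  set g := f v₀ with hg
  have hdeg' : ∀ v ∈ X, g ≤ degIn G X v := fun v hv => (hmin v hv).trans (hdeg v hv)
  -- Lists are kept with the free end e in front and v₀ last. On a path with g + 1 vertices, e has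
  -- no neighbour off the path, since that would give a forbidden path from v₀; having at least g
  -- neighbours, it sees all of l.
  have hclosed : ∀ e l, IsPathList G (e :: l) → (∀ w ∈ e :: l, w ∈ X) →
      (e :: l).getLast? = some v₀ → l.length = g →
      (X.filter fun w => G.Adj e w) = l.toFinset := by
    intro e l hl hX hlast hlen
    have hsub : (X.filter fun w => G.Adj e w) ⊆ l.toFinset := by
      intro x hx
      rw [Finset.mem_filter] at hx
      rw [List.mem_toFinset]
      by_contra hxl
      refine hpath v₀ hv₀ ⟨(x :: e :: l).reverse, (hl.cons ?_ ?_).reverse, ?_, ?_, ?_⟩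
      · rw [List.mem_cons]
        rintro (rfl | h)
        · exact G.loopless.irrefl _ hx.2
        · exact hxl h
      · intro w hw
        simp only [List.head?_cons, Option.mem_some_iff] at hw
        rw [← hw]
        exact hx.2.symm
      · intro w hw
        rw [List.mem_reverse, List.mem_cons] at hw
        rcases hw with rfl | hw
        · exact hx.1
        · exact hX w hw
      · rw [List.head?_reverse, List.getLast?_cons_cons]
        exact hlast
      · simp [hlen, ← hg]
    refine Finset.eq_of_subset_of_card_le hsub ?_
    calc l.toFinset.card ≤ l.length := List.toFinset_card_le l
      _ = g := hlen
      _ ≤ _ := hdeg' e (hX e (by simp))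
  have hex : ∀ j ≤ g, ∃ e l, IsPathList G (e :: l) ∧ (∀ w ∈ e :: l, w ∈ X) ∧
      (e :: l).getLast? = some v₀ ∧ l.length = j := by
    intro j
    induction j with
    | zero =>
      intro _
      exact ⟨v₀, [], isPathList_singleton G v₀, by simpa using hv₀, by simp, rfl⟩
    | succ j ih =>
      intro hj
      obtain ⟨e, l, hl, hX, hlast, hlen⟩ := ih (by omega)
      have hcard : l.toFinset.card < (X.filter fun w => G.Adj e w).card :=
        calc l.toFinset.card ≤ l.length := List.toFinset_card_le l
          _ < g := by omega
          _ ≤ _ := hdeg' e (hX e (by simp))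
      obtain ⟨x, hx, hxl⟩ := Finset.exists_mem_notMem_of_card_lt_card hcard
      rw [Finset.mem_filter] at hx
      rw [List.mem_toFinset] at hxl
      refine ⟨x, e :: l, hl.cons ?_ ?_, ?_, by rwa [List.getLast?_cons_cons], by simp [hlen]⟩
      · rw [List.mem_cons]
        rintro (rfl | h)
        · exact G.loopless.irrefl _ hx.2
        · exact hxl h
      · intro w hw
        simp only [List.head?_cons, Option.mem_some_iff] at hw
        rw [← hw]
        exact hx.2.symm
      · intro w hw
        rw [List.mem_cons] at hw
        rcases hw with rfl | hw
        · exact hx.1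
        · exact hX w hw
  obtain ⟨e, l, hl, hX, hlast, hlen⟩ := hex g le_rfl
  -- Pósa rotation: e sees every vertex of the path, so the segment in front of w can be reversed
  -- and hooked to the successor of w. This makes w the free end, and `hclosed` applies to it.
  have hrot : ∀ w ∈ e :: l, w ≠ v₀ → (X.filter fun x => G.Adj w x) = (e :: l).toFinset.erase w := by
    intro w hw hwv
    obtain ⟨M, N, hMN⟩ := List.append_of_mem hw
    have hN : N ≠ [] := by
      rintro rfl
      rw [hMN] at hlast
      simp at hlast
      exact hwv hlast
    have hgen : IsPathList G (w :: (M.reverse ++ N)) := by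
      have hnd : (w :: (M.reverse ++ N)).Nodup := by
        have h1 := hl.nodup
        rw [hMN, List.nodup_middle] at h1
        refine (List.Perm.nodup_iff ?_).1 h1
        exact List.Perm.cons _ (List.Perm.append_right _ (List.reverse_perm M).symm)
      refine ⟨hnd, ?_⟩
      rcases M with _ | ⟨e', M⟩
      · have := hl.chain
        rw [hMN] at this
        simpa using this
      · have he' : e' = e := by
          have := congrArg List.head? hMN
          simpa using this.symm
        subst he'
        have hch := hl.chain
        rw [hMN] at hch
        have h1 : (w :: (e' :: M).reverse).IsChain G.Adj := by
          have h2 : ((e' :: M) ++ [w]).IsChain G.Adj :=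
            hch.infix ⟨[], N, by simp⟩
          have h3 : ((e' :: M) ++ [w]).reverse.IsChain G.Adj := by
            rw [List.isChain_reverse]
            exact h2.imp fun a b hab => hab.symm
          simpa using h3
        have h4 : N.IsChain G.Adj := hch.suffix ⟨(e' :: M) ++ [w], by simp⟩
        rw [← List.cons_append]
        refine h1.append h4 ?_
        intro x hx y hy
        have hx' : x = e' := by
          rw [List.reverse_cons, ← List.cons_append, List.getLast?_concat] at hx
          exact (Option.mem_some_iff.1 hx).symm
        subst hx'
        have hyl : y ∈ l.toFinset := by
          have hyN : y ∈ N := List.mem_of_mem_head? hy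
          have h5 : l = M ++ w :: N := by simpa using hMN
          rw [h5]
          simp [hyN]
        rw [← hclosed _ _ hl hX hlast hlen, Finset.mem_filter] at hyl
        exact hyl.2
    have hperm : (w :: (M.reverse ++ N)).Perm (e :: l) := by
      rw [hMN]
      exact (List.Perm.cons _ (List.Perm.append_right _ (List.reverse_perm M))).trans
        List.perm_middle.symm
    rw [hclosed w (M.reverse ++ N) hgen (fun x hx => hX x (hperm.mem_iff.1 hx)) ?_ ?_]
    · rw [← List.toFinset_eq_of_perm _ _ hperm, List.toFinset_cons, Finset.erase_insert]
      rw [List.mem_toFinset]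
      exact (List.nodup_cons.1 hgen.nodup).1
    · rw [hMN] at hlast
      rw [← List.cons_append, List.getLast?_append_of_ne_nil _ hN]
      rw [List.getLast?_append_of_ne_nil _ (by simp)] at hlast
      obtain ⟨a, N', rfl⟩ := List.exists_cons_of_ne_nil hN
      rwa [List.getLast?_cons_cons] at hlast
    · have := hperm.length_eq
      simp only [List.length_cons] at this
      omega
  have hcardK : (e :: l).toFinset.card = g + 1 := by
    rw [List.toFinset_card_of_nodup hl.nodup, List.length_cons, hlen]
  have hv₀l : v₀ ∈ e :: l := List.mem_of_getLast? hlast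
  have hev : e ≠ v₀ := by
    rintro rfl
    have hl0 : l ≠ [] := by
      rintro rfl
      simp at hlen
      omega
    have h1 : e ∈ l := by
      obtain ⟨a, l', rfl⟩ := List.exists_cons_of_ne_nil hl0
      rw [List.getLast?_cons_cons] at hlast
      exact List.mem_of_getLast? hlast
    exact (List.nodup_cons.1 hl.nodup).1 h1
  -- The vertex v₀ cannot be rotated to the free end. But e has degree g, so its demand is also
  -- minimal, and the path read from e shows that v₀ has no neighbour off the path.
  have hfe : f e = g := by
    refine le_antisymm ?_ (hmin e (hX e (by simp)))
    refine (hdeg e (hX e (by simp))).trans ?_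
    unfold degIn
    rw [hclosed e l hl hX hlast hlen]
    exact (List.toFinset_card_le l).trans hlen.le
  have hv₀sub : (X.filter fun x => G.Adj v₀ x) ⊆ (e :: l).toFinset.erase v₀ := by
    intro x hx
    rw [Finset.mem_filter] at hx
    rw [Finset.mem_erase, List.mem_toFinset]
    refine ⟨fun h => G.loopless.irrefl v₀ (h ▸ hx.2), ?_⟩
    by_contra hxl
    refine hpath e (hX e (by simp)) ⟨(e :: l) ++ [x], hl.append (isPathList_singleton G x) ?_ ?_,
      ?_, by simp, by simp [hlen, hfe]⟩
    · simpa using hxl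
    · intro a ha b hb
      rw [hlast] at ha
      simp only [Option.mem_some_iff] at ha
      simp only [List.head?_cons, Option.mem_some_iff] at hb
      rw [← ha, ← hb]
      exact hx.2
    · intro w hw
      rw [List.mem_append, List.mem_singleton] at hw
      rcases hw with hw | rfl
      · exact hX w hw
      · exact hx.1
  refine ⟨(e :: l).toFinset, fun w hw => hX w (List.mem_toFinset.1 hw), hcardK, ?_⟩
  intro w hw
  rw [List.mem_toFinset] at hw
  have hsub : (X.filter fun x => G.Adj w x) ⊆ (e :: l).toFinset.erase w := by
    by_cases hwv : w = v₀
    · rw [hwv]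
      exact hv₀sub
    · exact (hrot w hw hwv).subset
  refine ⟨le_antisymm ?_ (hdeg' w (hX w hw)), fun x hx hwx => ?_⟩
  · refine (Finset.card_le_card hsub).trans ?_
    rw [Finset.card_erase_of_mem (List.mem_toFinset.2 hw), hcardK]
    simp
  · exact Finset.mem_of_mem_erase (hsub (Finset.mem_filter.2 ⟨hx, hwx⟩))

/-- A weighted form of the Erdős–Gallai bound: if no path inside `X` that starts at `v` has
`f v + 2` vertices, then `X` spans few edges. -/
theorem degSum_add_card_le {G : SimpleGraph V} {f : V → ℕ} (X : Finset V)
    (hf : ∀ v ∈ X, 1 ≤ f v)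
    (hpath : ∀ v ∈ X, ¬ ∃ L : List V, IsPathList G L ∧ (∀ w ∈ L, w ∈ X) ∧ L.head? = some v ∧
      L.length = f v + 2) :
    degSum G X + X.card ≤ 2 * ∑ v ∈ X, f v := by
  classical
  induction X using Finset.strongInduction with
  | H X ih =>
    -- Deleting A lowers the degree sum by twice the sum of the degrees on A minus `degSum G A`; the
    -- set A may be peeled off if its own demands pay for that.
    have key : ∀ A ⊆ X, A.Nonempty →
        2 * ∑ a ∈ A, degIn G X a + A.card ≤ 2 * ∑ a ∈ A, f a + degSum G A →
        degSum G X + X.card ≤ 2 * ∑ v ∈ X, f v := by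
      intro A hA hne h
      have h1 := ih (X \ A) (Finset.sdiff_ssubset hA hne)
        (fun v hv => hf v (Finset.sdiff_subset hv))
        (fun v hv ⟨L, hL, hLX, h3⟩ => hpath v (Finset.sdiff_subset hv)
          ⟨L, hL, fun w hw => Finset.sdiff_subset (hLX w hw), h3⟩)
      have h2 := degSum_union G (A := X \ A) (B := A) Finset.sdiff_disjoint
      rw [Finset.sdiff_union_of_subset hA] at h2
      have h3 : ∑ a ∈ A, degIn G X a = ∑ a ∈ A, degIn G (X \ A) a + degSum G A := by
        unfold degSum
        rw [← Finset.sum_add_distrib]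
        refine Finset.sum_congr rfl fun a _ => ?_
        rw [← degIn_union G Finset.sdiff_disjoint, Finset.sdiff_union_of_subset hA]
      have h4 := Finset.card_sdiff_add_card_eq_card hA
      have h5 := Finset.sum_sdiff (f := f) hA
      omega
    rcases X.eq_empty_or_nonempty with rfl | hX
    · simp [degSum]
    by_cases hlow : ∃ v ∈ X, degIn G X v < f v
    · obtain ⟨v, hv, hlt⟩ := hlow
      refine key {v} (by simpa using hv) (by simp) ?_
      simp
      omega
    · push Not at hlow
      obtain ⟨v₀, hv₀, hmin⟩ := Finset.exists_min_image X f hX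
      obtain ⟨A, hAX, hcard, hA⟩ := exists_clique_component hpath hlow hv₀ hmin (hf v₀ hv₀)
      refine key A hAX (Finset.card_pos.1 (by omega)) ?_
      have h1 : ∑ a ∈ A, degIn G X a = A.card * f v₀ := by
        rw [Finset.sum_congr rfl fun a ha => (hA a ha).1]
        simp
      have h2 : degSum G A = A.card * f v₀ := by
        unfold degSum
        rw [← h1]
        refine Finset.sum_congr rfl fun a ha => ?_
        unfold degIn
        congr 1
        ext x
        simp only [Finset.mem_filter]
        exact ⟨fun h => ⟨hAX h.1, h.2⟩, fun h => ⟨(hA a ha).2 x h.1 h.2, h.2⟩⟩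
      have h3 : A.card * f v₀ ≤ ∑ a ∈ A, f a := by
        rw [← smul_eq_mul]
        exact Finset.card_nsmul_le_sum _ _ _ fun a ha => hmin a (hAX ha)
      -- For a clique component with g + 1 vertices the requirement reduces to g + 1 ≤ (g + 1) g,
      -- which is where positive demand matters.
      have h4 := hf v₀ hv₀
      have h5 : A.card * 1 ≤ A.card * f v₀ := Nat.mul_le_mul_left _ h4
      omega

end Peel

/-! ### Extracting hubs and blocks from a graph with many edges. -/

section Hubs

universe u

/-- Either there are `M` pairwise disjoint lists with a given property, or a small set of vertices
meets all of them. -/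
theorem exists_disjoint_family_or_transversal {V : Type*} (P : List V → Prop) (q M : ℕ)
    (hP : ∀ L, P L → L.length ≤ q) :
    (∃ B : Fin M → List V, (∀ i, P (B i)) ∧ Pairwise fun i j => (B i).Disjoint (B j)) ∨
      ∃ W : Finset V, W.card ≤ M * q ∧ ∀ L, P L → ∃ w ∈ L, w ∈ W := by
  classical
  induction M with
  | zero => exact Or.inl ⟨Fin.elim0, fun i => i.elim0, fun i => i.elim0⟩
  | succ M ih =>
    rcases ih with ⟨B, hB, hd⟩ | ⟨W, hW, hW'⟩
    · by_cases h : ∀ L, P L → ∃ w ∈ L, w ∈ Finset.univ.biUnion fun i => (B i).toFinset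
      · refine Or.inr ⟨_, ?_, h⟩
        calc _ ≤ ∑ i : Fin M, (B i).toFinset.card := Finset.card_biUnion_le
          _ ≤ ∑ i : Fin M, q := Finset.sum_le_sum fun i _ =>
            (List.toFinset_card_le _).trans (hP _ (hB i))
          _ = M * q := by simp
          _ ≤ (M + 1) * q := Nat.mul_le_mul_right _ (by omega)
      · push Not at h
        obtain ⟨L, hL, hLW⟩ := h
        have hLB : ∀ i, L.Disjoint (B i) := fun i v hv hv' =>
          hLW v hv (Finset.mem_biUnion.2 ⟨i, Finset.mem_univ _, List.mem_toFinset.2 hv'⟩)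
        refine Or.inl ⟨Fin.cons L B, fun i => ?_, fun i j hij => ?_⟩
        · refine Fin.cases ?_ (fun i => ?_) i
          · simpa using hL
          · simpa using hB i
        · induction i using Fin.cases with
          | zero =>
            induction j using Fin.cases with
            | zero => exact absurd rfl hij
            | succ j => simpa using hLB j
          | succ i =>
            induction j using Fin.cases with
            | zero => simpa using (hLB i).symm
            | succ j => simpa using hd fun h => hij (congrArg Fin.succ h)
    · exact Or.inr ⟨W, hW.trans (Nat.mul_le_mul_right _ (by omega)), hW'⟩

/-- The number of vertices of the paths that complement `r - g` hubs. -/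
def blockLength (g : ℕ) : ℕ := if g = 0 then 1 else g + 2

theorem blockLength_le (g : ℕ) : blockLength g ≤ g + 2 := by
  unfold blockLength
  split <;> omega

theorem blockLength_of_pos {g : ℕ} (hg : 1 ≤ g) : blockLength g = g + 2 := by
  unfold blockLength
  rw [if_neg (by omega)]

/-- A set `U` of hubs together with disjoint paths `B i`, the first vertices of which are joined to
all hubs; the fewer hubs there are, the longer the paths. -/
structure HubBlocks {V : Type*} (G : SimpleGraph V) (r : ℕ) (U : Finset V) {m : ℕ}
    (B : Fin m → List V) : Prop where
  path : ∀ i, IsPathList G (B i)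
  length : ∀ i, (B i).length = blockLength (r - U.card)
  disjoint : Pairwise fun i j => (B i).Disjoint (B j)
  notMem : ∀ i, ∀ u ∈ U, u ∉ B i
  adj : ∀ i, ∀ u ∈ U, ∀ v ∈ (B i).head?, G.Adj v u

/-- Give each vertex v the demand r minus its number of neighbours in H. If many disjoint paths
avoid H and have the length dictated by the demand of their first vertex, many of them have the same
trace on H, and this trace is the hub set. Otherwise a bounded set W meets all of them, and the
weighted bound applies outside H ∪ W. Since the edges to H and the demands add up to r per vertex,
the lower bound on the edges of G shows that enlarging H by W removes about |V| from the remaining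
degree sum. -/
theorem hubBlocks_or_degSum_drop {V : Type*} [Fintype V] [DecidableEq V] (G : SimpleGraph V)
    (r C m h : ℕ) (H : Finset V) (hH : H.card ≤ h)
    (hE : 2 * r * Fintype.card V ≤ degSum G Finset.univ + C) :
    (∃ (U : Finset V) (B : Fin m → List V), HubBlocks G r U B) ∨
      ∃ H' : Finset V, H'.card ≤ h + 2 ^ h * m * (r + 2) ∧
        degSum G (Finset.univ \ H') + Fintype.card V ≤ degSum G (Finset.univ \ H) +
          (C + h * h + 2 * (2 ^ h * m * (r + 2) * h) + h + 2 ^ h * m * (r + 2)) := by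
  classical
  set w := 2 ^ h * m * (r + 2) with hw
  let tr : V → Finset V := fun v => H.filter fun x => G.Adj v x
  have htr : ∀ v, (tr v).card = degIn G H v := fun v => rfl
  let P : List V → Prop := fun L => IsPathList G L ∧ (∀ x ∈ L, x ∉ H) ∧
    ∃ v, L.head? = some v ∧ L.length = blockLength (r - (tr v).card)
  have hPlen : ∀ L, P L → L.length ≤ r + 2 := by
    rintro L ⟨-, -, v, -, hL⟩
    rw [hL]
    exact (blockLength_le _).trans (by omega)
  rcases exists_disjoint_family_or_transversal P (r + 2) (2 ^ h * m) hPlen with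
    ⟨B, hB, hd⟩ | ⟨W, hWcard, hW⟩
  · left
    choose hpath hnot v hv hlen using hB
    -- Pigeonhole over the at most 2 ^ h traces on H.
    have hmaps : ∀ i ∈ (Finset.univ : Finset (Fin (2 ^ h * m))), tr (v i) ∈ H.powerset :=
      fun i _ => Finset.mem_powerset.2 (Finset.filter_subset _ _)
    obtain ⟨U, -, hU⟩ := Finset.exists_le_card_fiber_of_mul_le_card_of_maps_to (n := m) hmaps
      ⟨∅, Finset.empty_mem_powerset H⟩ (by
        rw [Finset.card_powerset, Finset.card_univ, Fintype.card_fin]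
        exact Nat.mul_le_mul_right _ (Nat.pow_le_pow_right (by norm_num) hH))
    obtain ⟨e⟩ : Nonempty (Fin m ↪ (Finset.univ.filter fun i => tr (v i) = U)) :=
      Function.Embedding.nonempty_of_card_le (by rw [Fintype.card_fin, Fintype.card_coe]; exact hU)
    have he : ∀ i, tr (v (e i)) = U := fun i => (Finset.mem_filter.1 (e i).2).2
    refine ⟨U, fun i => B (e i), fun i => hpath _, fun i => ?_, fun i j hij => ?_, ?_, ?_⟩
    · rw [hlen, he]
    · exact hd fun h' => hij (e.injective (Subtype.ext h'))
    · intro i u hu hu'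
      rw [← he i] at hu
      exact hnot _ u hu' (Finset.mem_filter.1 hu).1
    · intro i u hu x hx
      rw [← he i] at hu
      rw [hv] at hx
      rw [← Option.mem_some_iff.1 hx]
      exact (Finset.mem_filter.1 hu).2
  · right
    refine ⟨H ∪ W, (Finset.card_union_le _ _).trans (add_le_add hH hWcard), ?_⟩
    set X := Finset.univ \ (H ∪ W) with hX
    have hXmem : ∀ x, x ∈ X ↔ x ∉ H ∧ x ∉ W := fun x => by simp [hX]
    -- A vertex with demand 0 is itself a block, because `blockLength 0` is 1, and so would lie in
    -- W.
    have hfpos : ∀ v ∈ X, 1 ≤ r - (tr v).card := by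
      intro v hv
      by_contra hlt
      obtain ⟨x, hx, hxW⟩ := hW [v] ⟨isPathList_singleton G v, by
        simpa using ((hXmem v).1 hv).1, v, rfl, by
          rw [Nat.lt_one_iff.1 (not_le.1 hlt)]
          rfl⟩
      rw [List.mem_singleton] at hx
      exact ((hXmem v).1 hv).2 (hx ▸ hxW)
    have hpeel := degSum_add_card_le (G := G) (f := fun v => r - (tr v).card) X hfpos (by
      rintro v hv ⟨L, hL, hLX, hhead, hlen⟩
      obtain ⟨x, hx, hxW⟩ := hW L ⟨hL, fun x hx => ((hXmem x).1 (hLX x hx)).1, v, hhead, by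
        rw [hlen, blockLength_of_pos (hfpos v hv)]⟩
      exact ((hXmem x).1 (hLX x hx)).2 hxW)
    have hY : (Finset.univ : Finset V) \ H = X ∪ (W \ H) := by
      ext x
      simp [hX]
      tauto
    have hdisj : Disjoint X (W \ H) := by
      rw [Finset.disjoint_left]
      intro x hx hx'
      exact ((hXmem x).1 hx).2 (Finset.mem_sdiff.1 hx').1
    have h1 : degSum G Finset.univ = degSum G H + degSum G (Finset.univ \ H) +
        2 * ∑ b ∈ Finset.univ \ H, degIn G H b := by
      rw [← degSum_union G Finset.disjoint_sdiff,
        Finset.union_sdiff_of_subset (Finset.subset_univ H)]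
    have h2 : ∑ b ∈ Finset.univ \ H, degIn G H b ≤ ∑ b ∈ X, degIn G H b + w * h := by
      rw [hY, Finset.sum_union hdisj]
      gcongr
      calc _ ≤ ∑ b ∈ W \ H, h := Finset.sum_le_sum fun b _ => (degIn_le_card _ _ _).trans hH
        _ = (W \ H).card * h := by simp
        _ ≤ w * h := Nat.mul_le_mul_right _
          ((Finset.card_le_card Finset.sdiff_subset).trans hWcard)
    have h3 : ∑ b ∈ X, degIn G H b + ∑ b ∈ X, (r - (tr b).card) = r * X.card := by
      rw [← Finset.sum_add_distrib, Finset.sum_congr rfl (g := fun _ => r)]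
      · simp [mul_comm]
      · intro b hb
        have := hfpos b hb
        rw [htr] at this ⊢
        omega
    have h4 : degSum G H ≤ h * h :=
      (degSum_le_card_mul_card G H).trans (Nat.mul_le_mul hH hH)
    have h5 : Fintype.card V ≤ X.card + h + w := by
      have := Finset.card_sdiff_add_card_eq_card (Finset.subset_univ (H ∪ W))
      have h6 := (Finset.card_union_le H W).trans (add_le_add hH hWcard)
      rw [Finset.card_univ, ← hX] at this
      omega
    have h6 : 2 * (r * X.card) ≤ 2 * r * Fintype.card V := by
      rw [mul_assoc]
      exact Nat.mul_le_mul_left _ (Nat.mul_le_mul_left _ (Finset.card_le_univ _))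
    omega

/-- The bound D does not depend on the graph: each round enlarges H by a bounded amount and gains
another |V|. -/
theorem hubBlocks_or_degSum_drop_iterate (r C m j : ℕ) : ∃ D : ℕ, ∀ (V : Type u) [Fintype V]
    [DecidableEq V] (G : SimpleGraph V), 2 * r * Fintype.card V ≤ degSum G Finset.univ + C →
    (∃ (U : Finset V) (B : Fin m → List V), HubBlocks G r U B) ∨
      ∃ H : Finset V, H.card ≤ D ∧
        degSum G (Finset.univ \ H) + j * Fintype.card V ≤ degSum G Finset.univ + D := by
  induction j with
  | zero =>
    refine ⟨0, fun V _ _ G _ => Or.inr ⟨∅, by simp⟩⟩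
  | succ j ih =>
    obtain ⟨h, ih⟩ := ih
    refine ⟨h + 2 ^ h * m * (r + 2) + h +
      (C + h * h + 2 * (2 ^ h * m * (r + 2) * h) + h + 2 ^ h * m * (r + 2)), ?_⟩
    intro V _ _ G hE
    rcases ih V G hE with hs | ⟨H, hH, hsum⟩
    · exact Or.inl hs
    rcases hubBlocks_or_degSum_drop G r C m h H hH hE with hs | ⟨H', hH', hsum'⟩
    · exact Or.inl hs
    refine Or.inr ⟨H', by omega, ?_⟩
    rw [add_mul, one_mul]
    omega

/-- A large graph with about `r n` edges, and not many more, contains a set of hubs and many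
disjoint paths attached to all of them. -/
theorem exists_hubBlocks (r C m J : ℕ) : ∃ N : ℕ, ∀ (V : Type u) [Fintype V] [DecidableEq V]
    (G : SimpleGraph V), N ≤ Fintype.card V →
    2 * r * Fintype.card V ≤ degSum G Finset.univ + C →
    degSum G Finset.univ ≤ J * Fintype.card V →
    ∃ (U : Finset V) (B : Fin m → List V), HubBlocks G r U B := by
  -- After J + 1 drops the degree sum, at most J |V|, would be exceeded as soon as |V| > D.
  obtain ⟨D, hD⟩ := hubBlocks_or_degSum_drop_iterate.{u} r C m (J + 1)
  refine ⟨D + 1, fun V _ _ G hN hE hJ => ?_⟩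
  rcases hD V G hE with hs | ⟨H, -, hsum⟩
  · exact hs
  · rw [add_mul, one_mul] at hsum
    omega

end Hubs

/-! ### Hamiltonian paths of tournaments and rainbow paths. -/

section Tournament

/-- Put a in front of the first entry that it beats, or at the end. The clause on the head is what
lets the induction reattach the preceding entry. -/
theorem exists_insert_isChain {α : Type*} {R : α → α → Prop} (a : α) (l : List α)
    (hl : l.IsChain R) (h : ∀ b ∈ l, R a b ∨ R b a) :
    ∃ l' : List α, l'.Perm (a :: l) ∧ l'.IsChain R ∧ (l'.head? = some a ∨ l'.head? = l.head?) := by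
  induction l with
  | nil => exact ⟨[a], List.Perm.refl _, by simp, by simp⟩
  | cons b l ih =>
    by_cases hab : R a b
    · exact ⟨a :: b :: l, List.Perm.refl _, List.isChain_cons_cons.2 ⟨hab, hl⟩, by simp⟩
    · have hba : R b a := (h b (by simp)).resolve_left hab
      obtain ⟨l', hp, hc, hh⟩ := ih hl.tail fun c hc => h c (by simp [hc])
      refine ⟨b :: l', (hp.cons b).trans (List.Perm.swap a b l), ?_, by simp⟩
      rw [List.isChain_cons]
      refine ⟨fun y hy => ?_, hc⟩
      rcases hh with hh | hh
      · rw [hh] at hy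
        rwa [← Option.mem_some_iff.1 hy]
      · rw [hh] at hy
        exact (List.isChain_cons.1 hl).1 y hy

/-- Every tournament has a Hamiltonian path. -/
theorem exists_perm_isChain {α : Type*} {R : α → α → Prop} (l : List α)
    (h : l.Pairwise fun a b => R a b ∨ R b a) : ∃ l' : List α, l'.Perm l ∧ l'.IsChain R := by
  induction l with
  | nil => exact ⟨[], List.Perm.refl _, by simp⟩
  | cons a l ih =>
    rw [List.pairwise_cons] at h
    obtain ⟨l', hp, hc⟩ := ih h.2
    obtain ⟨l'', hp', hc', -⟩ := exists_insert_isChain a l' hc fun b hb =>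
      h.1 b (hp.mem_iff.1 hb)
    exact ⟨l'', hp'.trans (hp.cons a), hc'⟩

/-- If consecutive edges take their colors from disjoint sets attached to their first ends, the
path is rainbow. -/
theorem nodup_map_pathEdges {V K ι : Type*} {C : Sym2 V → K} {D : ι → Set K} {w : ι → V}
    {l : List ι} (hl : l.Nodup) (hD : ∀ i ∈ l, ∀ j ∈ l, i ≠ j → Disjoint (D i) (D j))
    (hc : l.IsChain fun i j => C s(w i, w j) ∈ D i) :
    ((pathEdges (l.map w)).map C).Nodup ∧
      ∀ c ∈ (pathEdges (l.map w)).map C, ∃ i ∈ l, c ∈ D i := by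
  induction l with
  | nil => simp
  | cons a l ih =>
    cases l with
    | nil => simp
    | cons b l =>
      obtain ⟨h1, h2⟩ := ih hl.of_cons
        (fun i hi j hj => hD i (List.mem_cons_of_mem _ hi) j (List.mem_cons_of_mem _ hj)) hc.tail
      rw [List.isChain_cons_cons] at hc
      simp only [List.map_cons] at h1 h2
      simp only [List.map_cons, pathEdges_cons_cons]
      refine ⟨List.nodup_cons.2 ⟨fun hmem => ?_, h1⟩, fun c hcm => ?_⟩
      · obtain ⟨i, hi, hci⟩ := h2 _ hmem
        have hai : a ≠ i := by
          rintro rfl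
          exact (List.nodup_cons.1 hl).1 hi
        exact Set.disjoint_left.1 (hD a (by simp) i (List.mem_cons_of_mem _ hi) hai) hc.1 hci
      · rw [List.mem_cons] at hcm
        rcases hcm with rfl | hcm
        · exact ⟨a, by simp, hc.1⟩
        · obtain ⟨i, hi, hci⟩ := h2 c hcm
          exact ⟨i, List.mem_cons_of_mem _ hi, hci⟩

end Tournament

/-! ### Distributing too few hubs among the components. -/

section Allocation

/-- Arithmetic behind the case of a = r - g hubs. A component starts with a block of g + 2 vertices,
and its b > 0 hubs add 2b + g + 1 more; the component σ, if any, instead receives two joined blocks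
and no hub. -/
theorem exists_hub_allocation {k : ℕ} (hk : 2 ≤ k) (t : Fin k → ℕ) (ht : ∀ i, 2 ≤ t i)
    (heven : ∃ i, Even (t i)) {g a : ℕ} (hg : 1 ≤ g) (hs : halfSum t = g + a + 2) :
    ∃ (b : Fin k → ℕ) (σ : Option (Fin k)), ∑ i, b i ≤ a ∧
      (∀ i, σ = some i → b i = 0 ∧ t i ≤ (g + 2) + (g + 2)) ∧
      ∀ i, σ ≠ some i →
        t i ≤ (g + 2) + if b i = 0 then 0 else 2 * b i + (g + 2) - 1 := by
  classical
  unfold halfSum at hs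
  by_cases hbig : ∃ i, g + 2 ≤ t i / 2
  · obtain ⟨i₀, hi₀⟩ := hbig
    -- A component with ⌊t i₀ / 2⌋ ≥ g + 2 already saves g + 1 hubs and every other one saves at
    -- least one, so no join is needed.
    let b : Fin k → ℕ := fun i => if t i ≤ g + 2 then 0 else max 1 (t i / 2 - g - 1)
    refine ⟨b, none, ?_, by simp, fun i _ => ?_⟩
    · have h1 : ∀ i ∈ Finset.univ.erase i₀, b i + 1 ≤ t i / 2 := by
        intro i _
        have := ht i
        simp only [b]
        split <;> omega
      have h2 : b i₀ + (g + 1) ≤ t i₀ / 2 := by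
        simp only [b]
        split <;> omega
      have h3 := Finset.sum_le_sum h1
      rw [Finset.sum_add_distrib] at h3
      simp only [Finset.sum_const, Finset.card_erase_of_mem (Finset.mem_univ i₀),
        Finset.card_univ, Fintype.card_fin, smul_eq_mul, mul_one] at h3
      have h4 := Finset.add_sum_erase Finset.univ b (Finset.mem_univ i₀)
      have h5 := Finset.add_sum_erase Finset.univ (fun i => t i / 2) (Finset.mem_univ i₀)
      omega
    · simp only [b]
      split
      · omega
      · rw [if_neg (by omega)]
        omega
  · push Not at hbig
    by_cases hlarge : ∃ i, g + 3 ≤ t i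
    · obtain ⟨i₀, hi₀⟩ := hlarge
      -- Now t i ≤ 2g + 3 for all i, so one hub always suffices and the joined pair of blocks serves
      -- i₀ without a hub.
      let b : Fin k → ℕ := fun i => if i = i₀ ∨ t i ≤ g + 2 then 0 else 1
      have hb1 : ∀ i, b i + 1 ≤ t i / 2 := by
        intro i
        have := ht i
        simp only [b]
        split <;> omega
      refine ⟨b, some i₀, ?_, ?_, ?_⟩
      · by_cases h : ∃ i₁, i₁ ≠ i₀ ∧ g + 3 ≤ t i₁
        · obtain ⟨i₁, hne, hi₁⟩ := h
          have hmem : i₁ ∈ Finset.univ.erase i₀ := by simp [hne]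
          have h3 : ∑ i ∈ (Finset.univ.erase i₀).erase i₁, (b i + 1) ≤
              ∑ i ∈ (Finset.univ.erase i₀).erase i₁, t i / 2 :=
            Finset.sum_le_sum fun i _ => hb1 i
          rw [Finset.sum_add_distrib] at h3
          simp only [Finset.sum_const, Finset.card_erase_of_mem hmem,
            Finset.card_erase_of_mem (Finset.mem_univ i₀),
            Finset.card_univ, Fintype.card_fin, smul_eq_mul, mul_one] at h3
          have h4 := Finset.add_sum_erase Finset.univ b (Finset.mem_univ i₀)
          have h5 := Finset.add_sum_erase Finset.univ (fun i => t i / 2) (Finset.mem_univ i₀)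
          have h6 := Finset.add_sum_erase _ b hmem
          have h7 := Finset.add_sum_erase _ (fun i => t i / 2) hmem
          have h8 : b i₀ = 0 := by simp [b]
          have h9 : b i₁ ≤ 1 := by
            simp only [b]
            split <;> omega
          -- The evenness hypothesis is needed here: for k = 2 and both orders equal to an odd g +
          -- 3, the two halves would add up to g + 2 only, leaving no hub.
          have h10 : g + 3 ≤ t i₀ / 2 + t i₁ / 2 + (k - 2) := by
            rcases Nat.lt_or_ge 2 k with hk2 | hk2
            · omega
            · obtain ⟨e, he⟩ := heven
              have hcard : ({i₀, i₁} : Finset (Fin k)) = Finset.univ := by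
                apply Finset.eq_univ_of_card
                rw [Finset.card_pair hne.symm, Fintype.card_fin]
                omega
              have he' : e ∈ ({i₀, i₁} : Finset (Fin k)) := by simp [hcard]
              rw [Finset.mem_insert, Finset.mem_singleton] at he'
              obtain ⟨c, hc⟩ := he
              rcases he' with rfl | rfl <;> omega
          omega
        · push Not at h
          have : ∑ i, b i = 0 := by
            refine Finset.sum_eq_zero fun i _ => ?_
            simp only [b]
            rw [if_pos]
            by_cases hi : i = i₀
            · exact Or.inl hi
            · have := h i hi
              exact Or.inr (by omega)
          omega
      · intro i hi
        rw [Option.some_inj] at hi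
        subst hi
        have := hbig i₀
        exact ⟨by simp [b], by omega⟩
      · intro i hi
        have hi' : i ≠ i₀ := fun h => hi (by rw [h])
        have := hbig i
        by_cases h : t i ≤ g + 2
        · simp [b, h]
        · simp only [b, hi', h, or_self, if_false]
          rw [if_neg (by omega)]
          omega
    · push Not at hlarge
      refine ⟨fun _ => 0, none, by simp, by simp, fun i _ => ?_⟩
      have := hlarge i
      simp
      omega

end Allocation

/-! ### Fewer than r hubs already give rainbow paths. -/

section FewHubs

variable {V : Type*} {K : Type*}

/-- Joining two blocks by an edge of a new color, at the cost of a bounded number of blocks. -/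
theorem exists_rainbow_join {C : Sym2 V → K} {G : SimpleGraph V}
    (hG : Set.InjOn C G.edgeSet) {r m : ℕ} {U : Finset V} {B : Fin m → List V}
    (hB : HubBlocks G r U B) {i j : Fin m} (hij : i ≠ j) {x y : V} (hx : (B i).getLast? = some x)
    (hy : (B j).getLast? = some y) (hi : C s(x, y) ∉ (pathEdges (B i)).map C)
    (hj : C s(x, y) ∉ (pathEdges (B j)).map C) :
    ∃ (G' : SimpleGraph V) (I : Finset (Fin m)), Set.InjOn C G'.edgeSet ∧ m ≤ I.card + 4 ∧
      IsPathList G' (B i ++ (B j).reverse) ∧ i ∉ I ∧ j ∉ I ∧ (∀ l ∈ I, IsPathList G' (B l)) ∧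
      ∀ l ∈ I, ∀ u ∈ U, ∀ v ∈ (B l).head?, G'.Adj v u := by
  classical
  have hxy : x ≠ y := by
    rintro rfl
    exact hB.disjoint hij (List.mem_of_getLast? hx) (List.mem_of_getLast? hy)
  set β := C s(x, y) with hβ
  -- G is rainbow, so at most one of its edges has the color β of the new edge. That edge is
  -- replaced by the new one, and Z contains its ends.
  obtain ⟨Z, hZ, hZ'⟩ : ∃ Z : Finset V, Z.card ≤ 2 ∧
      ∀ e ∈ G.edgeSet, C e = β → ∀ v ∈ e, v ∈ Z := by
    by_cases h : ∃ e ∈ G.edgeSet, C e = β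
    · obtain ⟨e, he, hc⟩ := h
      induction e with
      | h a b =>
        refine ⟨{a, b}, Finset.card_le_two, ?_⟩
        intro e' he' hc' v hv
        rw [hG he' he (hc'.trans hc.symm)] at hv
        simpa using hv
    · push Not at h
      exact ⟨∅, by simp, fun e he hc => absurd hc (h e he)⟩
  let G' : SimpleGraph V := G.deleteEdges {e | C e = β} ⊔ SimpleGraph.fromEdgeSet {s(x, y)}
  have hG'e : ∀ e, e ∈ G'.edgeSet ↔ (e ∈ G.edgeSet ∧ C e ≠ β) ∨ e = s(x, y) := by
    intro e
    induction e with
    | h a b =>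
      simp only [G', SimpleGraph.mem_edgeSet, SimpleGraph.sup_adj, SimpleGraph.deleteEdges_adj,
        SimpleGraph.fromEdgeSet_adj, Set.mem_ofPred_eq, Set.mem_singleton_iff]
      constructor
      · rintro (h | h)
        · exact Or.inl h
        · exact Or.inr h.1
      · rintro (h | h)
        · exact Or.inl h
        · refine Or.inr ⟨h, ?_⟩
          rintro rfl
          have : (s(a, a) : Sym2 V).IsDiag := by simp
          rw [h, Sym2.mk_isDiag_iff] at this
          exact hxy this
  -- Four blocks are lost at most: the two joined ones and those meeting Z.
  let I : Finset (Fin m) := Finset.univ.filter fun l => l ≠ i ∧ l ≠ j ∧ ∀ v ∈ Z, v ∉ B l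
  have hI : ∀ l, l ∈ I ↔ l ≠ i ∧ l ≠ j ∧ ∀ v ∈ Z, v ∉ B l := fun l => by simp [I]
  have hedge : ∀ l ∈ I, ∀ e ∈ G.edgeSet, (∃ v ∈ e, v ∈ B l) → e ∈ G'.edgeSet := by
    rintro l hl e he ⟨v, hv, hvl⟩
    rw [hG'e]
    exact Or.inl ⟨he, fun hc => ((hI l).1 hl).2.2 v (hZ' e he hc v hv) hvl⟩
  have hedge' : ∀ l, β ∉ (pathEdges (B l)).map C → IsPathList G' (B l) := by
    intro l hl
    refine ⟨(hB.path l).nodup, isChain_adj_iff.2 fun e he => ?_⟩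
    rw [hG'e]
    exact Or.inl ⟨isChain_adj_iff.1 (hB.path l).chain e he,
      fun hc => hl (hc ▸ List.mem_map_of_mem he)⟩
  refine ⟨G', I, ?_, ?_, ?_, fun h => ((hI i).1 h).1 rfl, fun h => ((hI j).1 h).2.1 rfl, ?_, ?_⟩
  · intro e he e' he' h
    rw [hG'e] at he he'
    rcases he with he | rfl <;> rcases he' with he' | rfl
    · exact hG he.1 he'.1 h
    · exact absurd h he.2
    · exact absurd h.symm he'.2
    · rfl
  · have hcompl : Finset.univ \ I ⊆ {i, j} ∪
        Z.biUnion fun v => Finset.univ.filter fun l => v ∈ B l := by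
      intro l hl
      rw [Finset.mem_sdiff, hI] at hl
      rw [Finset.mem_union, Finset.mem_insert, Finset.mem_singleton, Finset.mem_biUnion]
      by_contra hcon
      push Not at hcon
      refine hl.2 ⟨hcon.1.1, hcon.1.2, fun v hv hvl => hcon.2 v hv ?_⟩
      simpa using hvl
    have h1 := Finset.card_le_card hcompl
    have h2 : (Z.biUnion fun v => Finset.univ.filter fun l => v ∈ B l).card ≤ Z.card * 1 := by
      refine Finset.card_biUnion_le_card_mul _ _ _ fun v _ => ?_
      rw [Finset.card_le_one]
      intro l hl l' hl'
      by_contra hne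
      exact hB.disjoint hne (Finset.mem_filter.1 hl).2 (Finset.mem_filter.1 hl').2
    have h3 := Finset.card_union_le {i, j} (Z.biUnion fun v => Finset.univ.filter fun l => v ∈ B l)
    have h4 : ({i, j} : Finset (Fin m)).card ≤ 2 := Finset.card_le_two
    have h5 := Finset.card_sdiff_add_card_eq_card (Finset.subset_univ I)
    rw [Finset.card_univ, Fintype.card_fin] at h5
    omega
  · refine (hedge' i hi).append (hedge' j hj).reverse ?_ ?_
    · intro v hv hv'
      exact hB.disjoint hij hv (List.mem_reverse.1 hv')
    · intro v hv v' hv'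
      rw [hx] at hv
      rw [List.head?_reverse, hy] at hv'
      rw [← Option.mem_some_iff.1 hv, ← Option.mem_some_iff.1 hv', ← SimpleGraph.mem_edgeSet,
        hG'e]
      exact Or.inr rfl
  · intro l hl
    refine ⟨(hB.path l).nodup, isChain_adj_iff.2 fun e he => ?_⟩
    refine hedge l hl e (isChain_adj_iff.1 (hB.path l).chain e he) ?_
    induction e with
    | h a b => exact ⟨a, by simp, mem_of_mem_pathEdges he (by simp)⟩
  · intro l hl u hu v hv
    rw [← SimpleGraph.mem_edgeSet]
    exact hedge l hl _ (hB.adj l u hu v hv) ⟨v, by simp, List.mem_of_mem_head? hv⟩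

/-- Look at the color of the edge between the last vertices of two blocks. If for some pair it
occurs in neither block, the two can be joined and `exists_hub_allocation` finishes. If not, orient
each pair from a block containing the color; the blocks have disjoint color sets, so a Hamiltonian
path of this tournament is rainbow. The size of m pays for that long path, or for the join, k starts
and the blocks used with hubs. -/
theorem hasRainbowPaths_of_few_hubs {C : Sym2 V → K} {G : SimpleGraph V}
    (hG : Set.InjOn C G.edgeSet) {k : ℕ} (hk : 2 ≤ k) (t : Fin k → ℕ) (ht : ∀ i, 2 ≤ t i)
    (heven : ∃ i, Even (t i)) {m : ℕ} (hm : k * ∑ i, t i + halfSum t + k + 4 ≤ m)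
    {U : Finset V} (hU : U.card < halfSum t - 2) {B : Fin m → List V}
    (hB : HubBlocks G (halfSum t - 2) U B) : HasRainbowPaths C t := by
  classical
  set g := halfSum t - 2 - U.card with hg
  have hg1 : 1 ≤ g := by omega
  have hlen : ∀ i, (B i).length = g + 2 := fun i => by
    rw [hB.length, ← hg, blockLength_of_pos hg1]
  have hw : ∀ i, ∃ x, (B i).getLast? = some x := fun i => by
    cases h : B i with
    | nil => have := hlen i; simp [h] at this
    | cons a l => exact ⟨_, List.getLast?_eq_some_getLast (by simp)⟩
  choose w hw using hw
  by_cases hnew : ∃ i j, i ≠ j ∧ C s(w i, w j) ∉ (pathEdges (B i)).map C ∧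
      C s(w i, w j) ∉ (pathEdges (B j)).map C
  · obtain ⟨i, j, hij, hi, hj⟩ := hnew
    obtain ⟨G', I, hG', hI, hsp, hiI, hjI, hIp, hIa⟩ :=
      exists_rainbow_join hG hB hij (hw i) (hw j) hi hj
    obtain ⟨b, σ, hb, hσ, hσ'⟩ := exists_hub_allocation hk t ht heven hg1
      (show halfSum t = g + U.card + 2 by omega)
    obtain ⟨e⟩ : Nonempty (Fin k ↪ I) :=
      Function.Embedding.nonempty_of_card_le (by
        rw [Fintype.card_fin, Fintype.card_coe]
        omega)
    let T : Fin k → List V := fun l => if σ = some l then B i ++ (B j).reverse else B (e l)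
    have hTs : ∀ l, σ = some l → T l = B i ++ (B j).reverse := fun l h => if_pos h
    have hTn : ∀ l, σ ≠ some l → T l = B (e l) := fun l h => if_neg h
    have hBne : ∀ l, B l ≠ [] := fun l h => by
      have := hlen l
      simp [h] at this
    have hspdisj : ∀ l ∈ I, (B i ++ (B j).reverse).Disjoint (B l) := by
      intro l hl
      rw [List.disjoint_append_left]
      refine ⟨hB.disjoint fun h => hiI (h ▸ hl), fun v hv hv' => ?_⟩
      exact hB.disjoint (i := j) (j := l) (fun h => hjI (h ▸ hl)) (List.mem_reverse.1 hv) hv'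
    let I' : Finset (Fin m) := I \ Finset.univ.image fun l => (e l : Fin m)
    have hI' : ∀ l ∈ I', l ∈ I := fun l hl => (Finset.mem_sdiff.1 hl).1
    have hI'e : ∀ l ∈ I', ∀ l', (e l' : Fin m) ≠ l := fun l hl l' h =>
      (Finset.mem_sdiff.1 hl).2 (Finset.mem_image.2 ⟨l', Finset.mem_univ _, h⟩)
    have hI'card : I.card ≤ I'.card + k := by
      have h1 := Finset.le_card_sdiff (Finset.univ.image fun l => (e l : Fin m)) I
      have h2 : (Finset.univ.image fun l => (e l : Fin m)).card ≤ k :=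
        Finset.card_image_le.trans (by simp)
      simp only [I']
      omega
    obtain ⟨L, hL, hLlen, hLd⟩ := exists_weaves (G := G') T
      (fun l => by
        by_cases h : σ = some l
        · rw [hTs l h]; exact hsp
        · rw [hTn l h]; exact hIp _ (e l).2)
      (fun l => by
        by_cases h : σ = some l
        · rw [hTs l h]; simp [hBne]
        · rw [hTn l h]; exact hBne _)
      (fun l l' hll => by
        by_cases h : σ = some l
        · by_cases h' : σ = some l'
          · rw [h, Option.some_inj] at h'
            exact absurd h' hll
          · simp only [hTs l h, hTn l' h']
            exact hspdisj _ (e l').2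
        · by_cases h' : σ = some l'
          · simp only [hTn l h, hTs l' h']
            exact (hspdisj _ (e l).2).symm
          · simp only [hTn l h, hTn l' h']
            exact hB.disjoint fun h'' => hll (e.injective (Subtype.ext h'')))
      (g + 2) (by omega) b U I' B hb (by omega) (fun l hl => hIp l (hI' l hl))
      (fun l _ => hlen l) (fun l _ l' _ hll => hB.disjoint hll)
      (fun l u hu => by
        by_cases h : σ = some l
        · rw [hTs l h, List.mem_append, List.mem_reverse]
          rintro (h' | h')
          · exact hB.notMem _ u hu h'
          · exact hB.notMem _ u hu h'
        · rw [hTn l h]; exact hB.notMem _ u hu)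
      (fun l l' hl' => by
        by_cases h : σ = some l
        · rw [hTs l h]; exact hspdisj l' (hI' l' hl')
        · rw [hTn l h]; exact hB.disjoint (hI'e l' hl' l))
      (fun u hu l _ => hB.notMem l u hu)
      (fun l hbl u hu v hv => by
        by_cases h : σ = some l
        · exact absurd (hσ l h).1 hbl
        · rw [hTn l h] at hv
          exact hIa _ (e l).2 u hu v hv)
      (fun l hl u hu v hv => hIa l (hI' l hl) u hu v hv)
    refine ⟨G', hG', L, fun l => ?_, hL, hLd⟩
    rw [hLlen]
    by_cases h : σ = some l
    · rw [hTs l h, List.length_append, List.length_reverse, hlen, hlen, (hσ l h).1]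
      simpa using (hσ l h).2
    · rw [hTn l h, hlen]
      exact hσ' l h
  · push Not at hnew
    let D : Fin m → Set K := fun i => {c | c ∈ (pathEdges (B i)).map C}
    have hD : ∀ i j, i ≠ j → Disjoint (D i) (D j) := by
      intro i j hij
      rw [Set.disjoint_left]
      intro c hc hc'
      obtain ⟨e, he, hec⟩ := List.mem_map.1 hc
      obtain ⟨e', he', hec'⟩ := List.mem_map.1 hc'
      have heq : e = e' := hG (isChain_adj_iff.1 (hB.path i).chain e he)
        (isChain_adj_iff.1 (hB.path j).chain e' he') (hec.trans hec'.symm)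
      subst heq
      induction e with
      | h a b =>
        exact hB.disjoint hij (mem_of_mem_pathEdges he (Sym2.mem_mk_left a b))
          (mem_of_mem_pathEdges he' (Sym2.mem_mk_left a b))
    obtain ⟨l, hp, hc⟩ := exists_perm_isChain (R := fun i j => C s(w i, w j) ∈ D i)
      (List.finRange m) (by
        refine (List.nodup_finRange m).imp fun {i j} hij => ?_
        by_cases h : C s(w i, w j) ∈ D i
        · exact Or.inl h
        · right
          rw [Sym2.eq_swap]
          exact hnew i j hij h)
    have hlnd : l.Nodup := hp.nodup_iff.2 (List.nodup_finRange m)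
    refine hasRainbowPaths_of_rainbow_list (l := l.map w) (hlnd.map ?_)
      (nodup_map_pathEdges hlnd (fun i _ j _ => hD i j) hc).1 ?_
    · intro i j hij
      by_contra hne
      exact hB.disjoint hne (List.mem_of_getLast? (hw i)) (hij ▸ List.mem_of_getLast? (hw j))
    · rw [List.length_map, hp.length_eq, List.length_finRange]
      omega

end FewHubs

/-! ### A canonical Ramsey theorem for rainbow paths. -/

section Ramsey

universe u v

/-- `l` is a path in the complete graph on `Y`, the edges of which have distinct colors. -/
structure IsRainbowList {V : Type u} {K : Type v} (C : Sym2 V → K) (Y : Finset V) (l : List V) :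
    Prop where
  nodup : l.Nodup
  mem : ∀ x ∈ l, x ∈ Y
  rainbow : ((pathEdges l).map C).Nodup

/-- Extend a rainbow path greedily. When it is stuck at p, all edges from p to unused vertices
repeat one of fewer than m colors, so some color is repeated q times; if it is never stuck, it
reaches m vertices. -/
theorem exists_monochromatic_star {V : Type u} {K : Type v} (C : Sym2 V → K) {Y : Finset V}
    {m q : ℕ} (hY : m + m * q < Y.card) (hm : ∀ l, IsRainbowList C Y l → l.length < m) :
    ∃ p ∈ Y, ∃ X ⊆ Y, p ∉ X ∧ q ≤ X.card ∧ ∃ δ, ∀ x ∈ X, C s(p, x) = δ := by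
  classical
  by_contra hcon
  push Not at hcon
  have hlong : ∀ j : ℕ, ∃ p l, IsRainbowList C Y (p :: l) ∧ l.length = j := by
    intro j
    induction j with
    | zero =>
      obtain ⟨p, hp⟩ := Finset.card_pos.1 (show 0 < Y.card by omega)
      exact ⟨p, [], ⟨by simp, by simpa using hp, by simp⟩, rfl⟩
    | succ j ih =>
      obtain ⟨p, l, hl, hj⟩ := ih
      have hlen := hm _ hl
      by_cases hex : ∃ x ∈ Y \ (p :: l).toFinset, C s(p, x) ∉ (pathEdges (p :: l)).map C
      · obtain ⟨x, hx, hc⟩ := hex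
        rw [Finset.mem_sdiff, List.mem_toFinset] at hx
        refine ⟨x, p :: l, ⟨List.nodup_cons.2 ⟨hx.2, hl.nodup⟩, ?_, ?_⟩, by simp [hj]⟩
        · intro y hy
          rcases List.mem_cons.1 hy with rfl | hy
          · exact hx.1
          · exact hl.mem y hy
        · rw [pathEdges_cons_cons, List.map_cons, List.nodup_cons, Sym2.eq_swap]
          exact ⟨hc, hl.rainbow⟩
      · push Not at hex
        exfalso
        have hcard : m * q < (Y \ (p :: l).toFinset).card := by
          have h1 := Finset.le_card_sdiff (p :: l).toFinset Y
          have h2 := List.toFinset_card_le (p :: l)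
          omega
        have hmaps : ∀ x ∈ Y \ (p :: l).toFinset,
            C s(p, x) ∈ ((pathEdges (p :: l)).map C).toFinset :=
          fun x hx => List.mem_toFinset.2 (hex x hx)
        obtain ⟨x, hx⟩ := Finset.card_pos.1 (show 0 < (Y \ (p :: l).toFinset).card by omega)
        obtain ⟨δ, -, hδ⟩ := Finset.exists_le_card_fiber_of_mul_le_card_of_maps_to (n := q) hmaps
          ⟨_, hmaps x hx⟩ (by
            refine le_trans (Nat.mul_le_mul_right q ?_) hcard.le
            refine (List.toFinset_card_le _).trans ?_
            rw [List.length_map, length_pathEdges]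
            omega)
        obtain ⟨y, hy, hy'⟩ := hcon p (hl.mem p (by simp)) _
          ((Finset.filter_subset _ _).trans Finset.sdiff_subset) (by simp) hδ δ
        exact hy' (Finset.mem_filter.1 hy).2
  obtain ⟨p, l, hl, hj⟩ := hlong m
  have := hm _ hl
  simp only [List.length_cons] at this
  omega

/-- Iterating the star inside its own leaves: each listed vertex carries the color of its edges to
all later ones. -/
theorem exists_end_homogeneous (m n : ℕ) : ∃ N : ℕ, ∀ {V : Type u} {K : Type v}
    (C : Sym2 V → K) (Y : Finset V), N ≤ Y.card →
    (∀ l, IsRainbowList C Y l → l.length < m) →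
    ∃ l : List (V × K), l.length = n ∧ (∀ a ∈ l, a.1 ∈ Y) ∧
      l.Pairwise fun a b => a.1 ≠ b.1 ∧ C s(a.1, b.1) = a.2 := by
  induction n with
  | zero => exact ⟨0, fun C Y _ _ => ⟨[], rfl, by simp, by simp⟩⟩
  | succ n ih =>
    obtain ⟨N, ih⟩ := ih
    refine ⟨m + m * N + 1, fun C Y hY hm => ?_⟩
    obtain ⟨p, hp, X, hXY, hpX, hX, δ, hδ⟩ := exists_monochromatic_star C (q := N) hY hm
    obtain ⟨l, hlen, hmem, hpw⟩ := ih C X hX fun l hl =>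
      hm l ⟨hl.nodup, fun x hx => hXY (hl.mem x hx), hl.rainbow⟩
    refine ⟨(p, δ) :: l, by simp [hlen], ?_, ?_⟩
    · intro a ha
      rcases List.mem_cons.1 ha with rfl | ha
      · exact hp
      · exact hXY (hmem a ha)
    · refine List.pairwise_cons.2 ⟨fun a ha => ⟨?_, hδ _ (hmem a ha)⟩, hpw⟩
      rintro rfl
      exact hpX (hmem a ha)

/-- A canonical Ramsey theorem: in a large complete graph there is a long rainbow path or a large
monochromatic clique. -/
theorem exists_rainbow_path_or_monochromatic_clique (m n : ℕ) : ∃ N : ℕ, ∀ {V : Type u}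
    {K : Type v} (C : Sym2 V → K) (Y : Finset V), N ≤ Y.card →
    (∃ l, IsRainbowList C Y l ∧ m ≤ l.length) ∨
      ∃ S ⊆ Y, n ≤ S.card ∧ ∃ β, ∀ x ∈ S, ∀ y ∈ S, x ≠ y → C s(x, y) = β := by
  classical
  obtain ⟨N, hN⟩ := exists_end_homogeneous.{u, v} m (m * n + 1)
  refine ⟨N, fun {V K} C Y hY => ?_⟩
  by_contra hcon
  push Not at hcon
  obtain ⟨hrain, hmono⟩ := hcon
  obtain ⟨l, hlen, hmem, hpw⟩ := hN C Y hY hrain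
  have hlnd : l.Nodup := hpw.imp fun {a b} h hab => h.1 (congrArg Prod.fst hab)
  -- One vertex for each attached color, in list order, spans a rainbow path.
  have hcol : (l.map Prod.snd).dedup.length < m := by
    obtain ⟨l', hl', heq⟩ := List.sublist_map_iff.1 (List.dedup_sublist (l.map Prod.snd))
    have hsnd : (l'.map Prod.snd).Nodup := heq ▸ List.nodup_dedup _
    have hpw' := hpw.sublist hl'
    have hnd' := hlnd.sublist hl'
    have hlt := hrain (l'.map Prod.fst) ⟨?_, ?_, ?_⟩
    · rw [heq]
      simpa using hlt
    · exact List.pairwise_map.2 (hpw'.imp fun h => h.1)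
    · intro x hx
      obtain ⟨a, ha, rfl⟩ := List.mem_map.1 hx
      exact hmem a (hl'.subset ha)
    · refine (nodup_map_pathEdges (D := fun a : V × K => {a.2}) hnd' ?_ ?_).1
      · intro a ha b hb hab
        rw [Set.disjoint_singleton]
        exact fun h => hab (List.inj_on_of_nodup_map hsnd ha hb h)
      · exact (hpw'.imp fun h => h.2).isChain
  have hmaps : ∀ a ∈ l.toFinset, a.2 ∈ (l.map Prod.snd).toFinset := fun a ha =>
    List.mem_toFinset.2 (List.mem_map_of_mem (List.mem_toFinset.1 ha))
  have hcard : l.toFinset.card = m * n + 1 := by rw [List.toFinset_card_of_nodup hlnd, hlen]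
  obtain ⟨a₀, ha₀⟩ := Finset.card_pos.1 (show 0 < l.toFinset.card by omega)
  obtain ⟨δ, -, hδ⟩ := Finset.exists_le_card_fiber_of_mul_le_card_of_maps_to (n := n) hmaps
    ⟨_, hmaps a₀ ha₀⟩ (by
      rw [hcard, List.card_toFinset]
      exact (Nat.mul_le_mul_right n hcol.le).trans (Nat.le_succ _))
  have hall : ∀ a ∈ l, ∀ b ∈ l, a ≠ b →
      a.1 ≠ b.1 ∧ (C s(a.1, b.1) = a.2 ∨ C s(a.1, b.1) = b.2) := by
    intro a ha b hb hab
    have : Std.Symm fun a b : V × K =>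
        a.1 ≠ b.1 ∧ (C s(a.1, b.1) = a.2 ∨ C s(a.1, b.1) = b.2) :=
      ⟨fun a b h => ⟨h.1.symm, by rw [Sym2.eq_swap]; exact h.2.symm⟩⟩
    have hpw' := hpw.imp (S := fun a b : V × K =>
      a.1 ≠ b.1 ∧ (C s(a.1, b.1) = a.2 ∨ C s(a.1, b.1) = b.2)) fun h => ⟨h.1, Or.inl h.2⟩
    exact hpw'.forall ha hb hab
  have hmemf : ∀ a, a ∈ l.toFinset.filter (fun a => a.2 = δ) ↔ a ∈ l ∧ a.2 = δ := fun a => by simp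
  obtain ⟨x, hx, y, hy, hxy, hc⟩ := hmono
    ((l.toFinset.filter fun a => a.2 = δ).image Prod.fst) (by
      intro x hx
      obtain ⟨a, ha, rfl⟩ := Finset.mem_image.1 hx
      exact hmem a ((hmemf a).1 ha).1) (by
      rw [Finset.card_image_of_injOn]
      · exact hδ
      · intro a ha b hb hab
        by_contra hne
        exact (hall a ((hmemf a).1 ha).1 b ((hmemf b).1 hb).1 hne).1 hab) δ
  obtain ⟨a, ha, rfl⟩ := Finset.mem_image.1 hx
  obtain ⟨b, hb, rfl⟩ := Finset.mem_image.1 hy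
  rw [hmemf] at ha hb
  rcases (hall a ha.1 b hb.1 fun h => hxy (h ▸ rfl)).2 with h | h
  · exact hc (h.trans ha.2)
  · exact hc (h.trans hb.2)

end Ramsey

/-! ### Embedding F with two prescribed starts. -/

section Embed

variable {V : Type*} {K : Type*}

/-- All edges between `U` and `Y` have pairwise distinct colors. -/
structure RainbowBetween (C : Sym2 V → K) (U Y : Finset V) : Prop where
  disjoint : Disjoint U Y
  inj : ∀ u ∈ U, ∀ y ∈ Y, ∀ u' ∈ U, ∀ y' ∈ Y, C s(u, y) = C s(u', y') → u = u' ∧ y = y'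

/-- A color occurs on at most one edge between U and Y, so each entry of E spoils at most one vertex
of Y. -/
theorem RainbowBetween.card_meeting_le {C : Sym2 V → K} {U Y : Finset V}
    (h : RainbowBetween C U Y) (E : List K) [DecidablePred fun y => ∃ u ∈ U, C s(u, y) ∈ E] :
    (Y.filter fun y => ∃ u ∈ U, C s(u, y) ∈ E).card ≤ E.length := by
  classical
  have hex : ∀ y : V, ∃ u, y ∈ Y.filter (fun y => ∃ u ∈ U, C s(u, y) ∈ E) →
      y ∈ Y ∧ u ∈ U ∧ C s(u, y) ∈ E := by
    intro y
    by_cases hy : y ∈ Y.filter fun y => ∃ u ∈ U, C s(u, y) ∈ E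
    · obtain ⟨hyY, u, hu, hc⟩ := Finset.mem_filter.1 hy
      exact ⟨u, fun _ => ⟨hyY, hu, hc⟩⟩
    · exact ⟨y, fun h => absurd h hy⟩
  choose f hf using hex
  refine (Finset.card_le_card_of_injOn (t := E.toFinset) (fun y => C s(f y, y)) ?_ ?_).trans
    (List.toFinset_card_le E)
  · intro y hy
    exact List.mem_toFinset.2 (hf y hy).2.2
  · intro y hy y' hy' heq
    exact (h.inj _ (hf y hy).2.1 _ (hf y hy).1 _ (hf y' hy').2.1 _ (hf y' hy').1 heq).2

/-- Two prescribed starting paths and a complete bipartite rainbow graph with `∑ ⌊t i / 2⌋ - 2`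
hubs together yield all the required paths. -/
theorem hasRainbowPaths_of_two_starts {C : Sym2 V → K} {U Y : Finset V}
    (h : RainbowBetween C U Y) {k : ℕ} {t : Fin k → ℕ} (hU : halfSum t ≤ U.card + 2)
    {i₀ i₁ : Fin k} (hi : i₀ ≠ i₁) (T₀ T₁ : List V) (b₀ b₁ : ℕ)
    (hlen₀ : t i₀ ≤ T₀.length + 2 * b₀) (hlen₁ : t i₁ ≤ T₁.length + 2 * b₁)
    (hb : b₀ + b₁ + 2 ≤ t i₀ / 2 + t i₁ / 2) (hne₀ : T₀ ≠ []) (hne₁ : T₁ ≠ [])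
    (hnd : (T₀ ++ T₁).Nodup) (hTU : ∀ v ∈ T₀ ++ T₁, v ∉ U)
    (hC : ((pathEdges T₀ ++ pathEdges T₁).map C).Nodup)
    (hh₀ : b₀ = 0 ∨ ∀ v ∈ T₀.head?, v ∈ Y ∧
      ∀ u ∈ U, C s(u, v) ∉ (pathEdges T₀ ++ pathEdges T₁).map C)
    (hh₁ : b₁ = 0 ∨ ∀ v ∈ T₁.head?, v ∈ Y ∧
      ∀ u ∈ U, C s(u, v) ∉ (pathEdges T₀ ++ pathEdges T₁).map C)
    (hY : k + halfSum t + 2 * (T₀.length + T₁.length) ≤ Y.card) : HasRainbowPaths C t := by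
  classical
  set E := (pathEdges T₀ ++ pathEdges T₁).map C with hE
  have hElen : E.length ≤ T₀.length + T₁.length := by
    rw [hE, List.length_map, List.length_append, length_pathEdges, length_pathEdges]
    omega
  -- Vertices whose edges to U repeat no color of the two starts.
  let Y' : Finset V := Y.filter fun y => ¬ ∃ u ∈ U, C s(u, y) ∈ E
  have hY' : ∀ y, y ∈ Y' ↔ y ∈ Y ∧ ∀ u ∈ U, C s(u, y) ∉ E := fun y => by
    simp [Y', Finset.mem_filter]
  let P : Finset V := Y' \ (T₀ ++ T₁).toFinset
  have hP : ∀ y ∈ P, y ∈ Y' ∧ y ∉ T₀ ∧ y ∉ T₁ := by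
    intro y hy
    rw [Finset.mem_sdiff, List.mem_toFinset, List.mem_append, not_or] at hy
    exact hy
  have hPcard : k + halfSum t ≤ P.card := by
    have h1 := Finset.card_filter_add_card_filter_not (s := Y) fun y => ∃ u ∈ U, C s(u, y) ∈ E
    have h2 := h.card_meeting_le E
    have h3 := Finset.le_card_sdiff (T₀ ++ T₁).toFinset Y'
    have h4 := List.toFinset_card_le (T₀ ++ T₁)
    rw [List.length_append] at h4
    simp only [P, Y'] at h3 ⊢
    omega
  let G : SimpleGraph V := SimpleGraph.fromEdgeSet
    {e | e ∈ pathEdges T₀ ++ pathEdges T₁ ∨ ∃ u ∈ U, ∃ y ∈ Y', e = s(u, y)}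
  have hGle : ∀ e ∈ G.edgeSet,
      e ∈ pathEdges T₀ ++ pathEdges T₁ ∨ ∃ u ∈ U, ∃ y ∈ Y', e = s(u, y) := by
    intro e he
    rw [SimpleGraph.edgeSet_fromEdgeSet] at he
    exact he.1
  have hG : Set.InjOn C G.edgeSet := by
    intro e he e' he' heq
    rcases hGle e he with h1 | ⟨u, hu, y, hy, rfl⟩ <;>
      rcases hGle e' he' with h2 | ⟨u', hu', y', hy', rfl⟩
    · exact List.inj_on_of_nodup_map hC h1 h2 heq
    · exact absurd (heq ▸ List.mem_map_of_mem h1) (((hY' y').1 hy').2 u' hu')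
    · exact absurd (heq ▸ List.mem_map_of_mem h2) (((hY' y).1 hy).2 u hu)
    · obtain ⟨rfl, rfl⟩ := h.inj u hu y ((hY' y).1 hy).1 u' hu' y' ((hY' y').1 hy').1 heq
      rfl
  have hYU : ∀ y ∈ Y', ∀ u ∈ U, y ≠ u := by
    rintro y hy u hu rfl
    exact Finset.disjoint_left.1 h.disjoint hu ((hY' y).1 hy).1
  have hGadj : ∀ y ∈ Y', ∀ u ∈ U, G.Adj y u := by
    intro y hy u hu
    rw [SimpleGraph.fromEdgeSet_adj]
    exact ⟨Or.inr ⟨u, hu, y, hy, Sym2.eq_swap⟩, hYU y hy u hu⟩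
  have hpath₀ : IsPathList G T₀ := by
    refine ⟨(List.nodup_append.1 hnd).1, isChain_adj_iff.2 fun e he => ?_⟩
    rw [SimpleGraph.edgeSet_fromEdgeSet]
    exact ⟨Or.inl (by simp [he]), not_isDiag_of_mem_pathEdges (List.nodup_append.1 hnd).1 he⟩
  have hpath₁ : IsPathList G T₁ := by
    refine ⟨(List.nodup_append.1 hnd).2.1, isChain_adj_iff.2 fun e he => ?_⟩
    rw [SimpleGraph.edgeSet_fromEdgeSet]
    exact ⟨Or.inl (by simp [he]), not_isDiag_of_mem_pathEdges (List.nodup_append.1 hnd).2.1 he⟩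
  have hT01 : T₀.Disjoint T₁ := (List.disjoint_of_nodup_append hnd)
  obtain ⟨e⟩ : Nonempty (Fin k ↪ P) := Function.Embedding.nonempty_of_card_le (by
    rw [Fintype.card_fin, Fintype.card_coe]
    omega)
  let T : Fin k → List V := fun i => if i = i₀ then T₀ else if i = i₁ then T₁ else [(e i : V)]
  -- An ordinary component reaches 1 + 2⌊t i / 2⌋ ≥ t i vertices; the two prescribed starts save the
  -- two missing hubs.
  let b : Fin k → ℕ := fun i => if i = i₀ then b₀ else if i = i₁ then b₁ else t i / 2
  have hTcases : ∀ i, (i = i₀ ∧ T i = T₀ ∧ b i = b₀) ∨ (i = i₁ ∧ T i = T₁ ∧ b i = b₁) ∨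
      (T i = [(e i : V)] ∧ b i = t i / 2) := by
    intro i
    by_cases h0 : i = i₀
    · exact Or.inl ⟨h0, by simp [T, h0], by simp [b, h0]⟩
    · by_cases h1 : i = i₁
      · exact Or.inr (Or.inl ⟨h1, by simp [T, h1, hi.symm], by simp [b, h1, hi.symm]⟩)
      · exact Or.inr (Or.inr ⟨by simp [T, h0, h1], by simp [b, h0, h1]⟩)
  have hbsum : ∑ i, b i + 2 ≤ halfSum t := by
    have hmem : i₁ ∈ Finset.univ.erase i₀ := by simp [hi.symm]
    have h1 := Finset.add_sum_erase Finset.univ b (Finset.mem_univ i₀)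
    have h2 := Finset.add_sum_erase Finset.univ (fun i => t i / 2) (Finset.mem_univ i₀)
    have h3 := Finset.add_sum_erase _ b hmem
    have h4 := Finset.add_sum_erase _ (fun i => t i / 2) hmem
    have h5 : ∑ i ∈ (Finset.univ.erase i₀).erase i₁, b i =
        ∑ i ∈ (Finset.univ.erase i₀).erase i₁, t i / 2 := by
      refine Finset.sum_congr rfl fun i hi' => ?_
      rw [Finset.mem_erase, Finset.mem_erase] at hi'
      simp [b, hi'.1, hi'.2.1]
    have h6 : b i₀ = b₀ := by simp [b]
    have h7 : b i₁ = b₁ := by simp [b, hi.symm]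
    unfold halfSum
    omega
  let I : Finset V := P \ Finset.univ.image fun i => (e i : V)
  have hIP : ∀ y ∈ I, y ∈ P := fun y hy => (Finset.mem_sdiff.1 hy).1
  have hIe : ∀ y ∈ I, ∀ i, (e i : V) ≠ y := fun y hy i hiy =>
    (Finset.mem_sdiff.1 hy).2 (Finset.mem_image.2 ⟨i, Finset.mem_univ _, hiy⟩)
  have hIcard : P.card ≤ I.card + k := by
    have h1 := Finset.le_card_sdiff (Finset.univ.image fun i => (e i : V)) P
    have h2 : (Finset.univ.image fun i => (e i : V)).card ≤ k :=
      Finset.card_image_le.trans (by simp)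
    simp only [I]
    omega
  obtain ⟨L, hL, hLlen, hLd⟩ := exists_weaves (G := G) T
    (fun i => by
      rcases hTcases i with ⟨-, hT, -⟩ | ⟨-, hT, -⟩ | ⟨hT, -⟩ <;> rw [hT]
      · exact hpath₀
      · exact hpath₁
      · exact isPathList_singleton G _)
    (fun i => by
      rcases hTcases i with ⟨-, hT, -⟩ | ⟨-, hT, -⟩ | ⟨hT, -⟩ <;> rw [hT]
      · exact hne₀
      · exact hne₁
      · simp)
    (fun i j hij => by
      have hei := hP _ (e i).2
      have hej := hP _ (e j).2
      have heij : (e i : V) ≠ e j := fun h' => hij (e.injective (Subtype.ext h'))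
      rcases hTcases i with ⟨hi', hT, -⟩ | ⟨hi', hT, -⟩ | ⟨hT, -⟩ <;>
        rcases hTcases j with ⟨hj', hT', -⟩ | ⟨hj', hT', -⟩ | ⟨hT', -⟩ <;>
        simp only [hT, hT']
      · exact absurd (hi'.trans hj'.symm) hij
      · exact hT01
      · simpa using hej.2.1
      · exact hT01.symm
      · exact absurd (hi'.trans hj'.symm) hij
      · simpa using hej.2.2
      · simpa using hei.2.1
      · simpa using hei.2.2
      · simpa using heij.symm)
    1 le_rfl b U I (fun y => [y]) (by omega) (by omega) (fun y _ => isPathList_singleton G y)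
    (fun _ _ => rfl) (fun y _ y' _ hyy => by simpa using hyy.symm)
    (fun i u hu => by
      rcases hTcases i with ⟨-, hT, -⟩ | ⟨-, hT, -⟩ | ⟨hT, -⟩ <;> rw [hT]
      · exact fun hu' => hTU u (by simp [hu']) hu
      · exact fun hu' => hTU u (by simp [hu']) hu
      · simpa using (hYU _ (hP _ (e i).2).1 u hu).symm)
    (fun i y hy => by
      have hyP := hP y (hIP y hy)
      rcases hTcases i with ⟨-, hT, -⟩ | ⟨-, hT, -⟩ | ⟨hT, -⟩ <;> rw [hT]
      · simpa using hyP.2.1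
      · simpa using hyP.2.2
      · simpa using (hIe y hy i).symm)
    (fun u hu y hy => by simpa using (hYU y (hP y (hIP y hy)).1 u hu).symm)
    (fun i hbi u hu v hv => by
      rcases hTcases i with ⟨-, hT, hb'⟩ | ⟨-, hT, hb'⟩ | ⟨hT, -⟩
      · rw [hT] at hv
        exact hGadj v ((hY' v).2 ((hh₀.resolve_left (hb' ▸ hbi)) v hv)) u hu
      · rw [hT] at hv
        exact hGadj v ((hY' v).2 ((hh₁.resolve_left (hb' ▸ hbi)) v hv)) u hu
      · rw [hT] at hv
        simp only [List.head?_cons, Option.mem_some_iff] at hv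
        rw [← hv]
        exact hGadj _ (hP _ (e i).2).1 u hu)
    (fun y hy u hu v hv => by
      simp only [List.head?_cons, Option.mem_some_iff] at hv
      rw [← hv]
      exact hGadj y (hP y (hIP y hy)).1 u hu)
  refine ⟨G, hG, L, fun i => ?_, hL, hLd⟩
  have h1 : (if b i = 0 then 0 else 2 * b i + 1 - 1) = 2 * b i := by
    split <;> omega
  rw [hLlen, h1]
  rcases hTcases i with ⟨hi', hT, hb'⟩ | ⟨hi', hT, hb'⟩ | ⟨hT, hb'⟩
  · rw [hT, hb', hi']
    exact hlen₀
  · rw [hT, hb', hi']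
    exact hlen₁
  · rw [hT, hb', List.length_singleton]
    omega

end Embed

/-! ### Cores, and configurations of fresh edges that complete F. -/

section Core

variable {V : Type*} {K : Type*}

/-- A set `U` of hubs, rainbow-joined to `Y`, and a large set `S ⊆ Y` all inner edges of which have
one color `β`, which does not occur between `U` and `Y`. -/
structure IsCore (C : Sym2 V → K) (U Y S : Finset V) (β : K) : Prop
    extends RainbowBetween C U Y where
  sub : S ⊆ Y
  mono : ∀ x ∈ S, ∀ y ∈ S, x ≠ y → C s(x, y) = β
  notHub : ∀ u ∈ U, ∀ y ∈ Y, C s(u, y) ≠ β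

/-- A color that occurs neither between `U` and `Y` nor as the color `β`. -/
def IsFresh (C : Sym2 V → K) (U Y : Finset V) (β : K) (c : K) : Prop :=
  c ≠ β ∧ ∀ u ∈ U, ∀ y ∈ Y, C s(u, y) ≠ c

theorem RainbowBetween.exists_mem_avoiding {C : Sym2 V → K} {U Y : Finset V}
    (h : RainbowBetween C U Y) {S : Finset V} (hS : S ⊆ Y) (A : List V) (E : List K)
    (hcard : A.length + E.length < S.card) :
    ∃ y ∈ S, y ∉ A ∧ ∀ u ∈ U, C s(u, y) ∉ E := by
  classical
  have h1 : (A.toFinset ∪ Y.filter fun y => ∃ u ∈ U, C s(u, y) ∈ E).card < S.card :=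
    calc _ ≤ A.toFinset.card + (Y.filter fun y => ∃ u ∈ U, C s(u, y) ∈ E).card :=
          Finset.card_union_le _ _
      _ ≤ A.length + E.length := add_le_add (List.toFinset_card_le A) (h.card_meeting_le E)
      _ < S.card := hcard
  obtain ⟨y, hy, hy'⟩ := Finset.exists_mem_notMem_of_card_lt_card h1
  rw [Finset.mem_union, not_or, List.mem_toFinset, Finset.mem_filter, not_and] at hy'
  refine ⟨y, hy, hy'.1, fun u hu hc => hy'.2 (hS hy) ⟨u, hu, hc⟩⟩

variable {C : Sym2 V → K} {U Y S : Finset V} {β : K} {k : ℕ} {t : Fin k → ℕ} {i₀ i₁ : Fin k}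

theorem IsCore.notMem_hubs (h : IsCore C U Y S β) {y : V} (hy : y ∈ Y) : y ∉ U :=
  fun hu => Finset.disjoint_left.1 h.disjoint hu hy

/-- A fresh edge that meets `Y` and an edge of color `β` serve for two paths of even order. -/
theorem IsCore.of_even_even_touching (h : IsCore C U Y S β) (hU : halfSum t ≤ U.card + 2)
    (hS : k + halfSum t + 40 ≤ S.card) (hi : i₀ ≠ i₁) (ht₀ : 2 ≤ t i₀) (ht₁ : 2 ≤ t i₁)
    (he₀ : Even (t i₀)) (he₁ : Even (t i₁)) {y z : V} (hy : y ∈ Y) (hz : z ∉ U) (hyz : y ≠ z)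
    (hf : IsFresh C U Y β (C s(y, z))) : HasRainbowPaths C t := by
  -- Throughout, 40 is just ample room: the two starts never have more than six vertices, and few
  -- vertices and colors must be avoided.
  have hSY := Finset.card_le_card h.sub
  obtain ⟨a, ha, haA, -⟩ := h.exists_mem_avoiding h.sub [y, z] [] (by simp; omega)
  obtain ⟨b, hb, hbA, -⟩ := h.exists_mem_avoiding h.sub [y, z, a] [] (by simp; omega)
  have hab : a ≠ b := by rintro rfl; simp at hbA
  have hcab := h.mono a ha b hb hab
  have hyU := h.notMem_hubs hy
  have haU := h.notMem_hubs (h.sub ha)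
  have hbU := h.notMem_hubs (h.sub hb)
  obtain ⟨c₀, hc₀⟩ := he₀
  obtain ⟨c₁, hc₁⟩ := he₁
  refine hasRainbowPaths_of_two_starts h.toRainbowBetween hU hi [y, z] [a, b] (t i₀ / 2 - 1)
    (t i₁ / 2 - 1) (by simp; omega) (by simp; omega) (by omega) (by simp) (by simp) ?_ ?_ ?_
    (Or.inr ?_) (Or.inr ?_) (by simp; omega)
  · simp at haA hbA ⊢
    grind
  · simp [hyU, hz, haU, hbU]
  · simpa [hcab] using hf.1
  · simp [hcab, hy]
    exact fun u hu => ⟨hf.2 u hu y hy, h.notHub u hu y hy⟩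
  · simp [hcab, h.sub ha]
    exact fun u hu => ⟨hf.2 u hu a (h.sub ha), h.notHub u hu a (h.sub ha)⟩

/-- A path and a disjoint edge, attached to the hubs, serve for two components. -/
theorem IsCore.of_path_pair (h : IsCore C U Y S β) (hU : halfSum t ≤ U.card + 2)
    (hS : k + halfSum t + 40 ≤ S.card) (hi : i₀ ≠ i₁) (ht₀ : 2 ≤ t i₀) (ht₁ : 2 ≤ t i₁)
    (he₀ : Even (t i₀)) {T : List V} (hT : 3 ≤ T.length) (hT' : T.length ≤ 4) {a b : V}
    (hnd : (a :: b :: T).Nodup) (hTU : ∀ v ∈ a :: b :: T, v ∉ U)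
    (hC : (C s(a, b) :: (pathEdges T).map C).Nodup)
    (ha : t i₀ = 2 ∨ a ∈ Y ∧ ∀ u ∈ U, C s(u, a) ∉ C s(a, b) :: (pathEdges T).map C)
    (hTh : ∀ p ∈ T.head?, p ∈ Y ∧ ∀ u ∈ U, C s(u, p) ∉ C s(a, b) :: (pathEdges T).map C) :
    HasRainbowPaths C t := by
  have hSY := Finset.card_le_card h.sub
  obtain ⟨c₀, hc₀⟩ := he₀
  refine hasRainbowPaths_of_two_starts h.toRainbowBetween hU hi [a, b] T (t i₀ / 2 - 1)
    (t i₁ / 2 - 1) (by simp; omega) (by omega) (by omega) (by simp)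
    (by rintro rfl; simp at hT) hnd hTU hC ?_ (Or.inr hTh) (by simp; omega)
  rcases ha with ha | ha
  · left
    omega
  · right
    intro v hv
    simp only [List.head?_cons, Option.mem_some_iff] at hv
    rw [← hv]
    exact ha

/-- A path attached to the hubs and without the color `β` serves together with an edge of color
`β`. -/
theorem IsCore.of_path (h : IsCore C U Y S β) (hU : halfSum t ≤ U.card + 2)
    (hS : k + halfSum t + 40 ≤ S.card) (hi : i₀ ≠ i₁) (ht₀ : 2 ≤ t i₀) (ht₁ : 2 ≤ t i₁)
    (he₀ : Even (t i₀)) {T : List V} (hT : 3 ≤ T.length) (hT' : T.length ≤ 4)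
    (hnd : T.Nodup) (hTU : ∀ v ∈ T, v ∉ U) (hC : ((pathEdges T).map C).Nodup)
    (hβ : β ∉ (pathEdges T).map C)
    (hTh : ∀ p ∈ T.head?, p ∈ Y ∧ ∀ u ∈ U, C s(u, p) ∉ (pathEdges T).map C) :
    HasRainbowPaths C t := by
  have hlen : ((pathEdges T).map C).length ≤ 3 := by
    rw [List.length_map, length_pathEdges]
    omega
  obtain ⟨a, ha, haA, haE⟩ := h.exists_mem_avoiding h.sub T ((pathEdges T).map C) (by omega)
  obtain ⟨b, hb, hbA, -⟩ := h.exists_mem_avoiding h.sub (a :: T) []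
    (by simp only [List.length_cons, List.length_nil]; omega)
  rw [List.mem_cons, not_or] at hbA
  have hcab := h.mono a ha b hb (Ne.symm hbA.1)
  refine h.of_path_pair hU hS hi ht₀ ht₁ he₀ hT hT' (a := a) (b := b) ?_ ?_ ?_ (Or.inr ?_) ?_
  · rw [List.nodup_cons, List.nodup_cons, List.mem_cons, not_or]
    exact ⟨⟨Ne.symm hbA.1, haA⟩, hbA.2, hnd⟩
  · intro v hv
    rw [List.mem_cons, List.mem_cons] at hv
    rcases hv with rfl | rfl | hv
    · exact h.notMem_hubs (h.sub ha)
    · exact h.notMem_hubs (h.sub hb)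
    · exact hTU v hv
  · rw [hcab]
    exact List.nodup_cons.2 ⟨hβ, hC⟩
  · refine ⟨h.sub ha, fun u hu => ?_⟩
    rw [hcab, List.mem_cons, not_or]
    exact ⟨h.notHub u hu a (h.sub ha), haE u hu⟩
  · intro p hp
    refine ⟨(hTh p hp).1, fun u hu => ?_⟩
    rw [hcab, List.mem_cons, not_or]
    exact ⟨h.notHub u hu p (hTh p hp).1, (hTh p hp).2 u hu⟩

/-- A path on four vertices attached to the hubs serves for an even component. -/
theorem IsCore.of_path_four (h : IsCore C U Y S β) (hU : halfSum t ≤ U.card + 2)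
    (hS : k + halfSum t + 40 ≤ S.card) (hi : i₀ ≠ i₁) (ht₀ : 4 ≤ t i₀)
    (he₀ : Even (t i₀)) {p q v w : V} (hnd : [p, q, v, w].Nodup) (hTU : ∀ x ∈ [p, q, v, w], x ∉ U)
    (hC : [C s(p, q), C s(q, v), C s(v, w)].Nodup) (hp : p ∈ Y)
    (hpC : ∀ u ∈ U, C s(u, p) ∉ [C s(p, q), C s(q, v), C s(v, w)]) :
    HasRainbowPaths C t := by
  have hSY := Finset.card_le_card h.sub
  obtain ⟨a, ha, haA, haE⟩ := h.exists_mem_avoiding h.sub [p, q, v, w]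
    [C s(p, q), C s(q, v), C s(v, w)] (by simp; omega)
  obtain ⟨c₀, hc₀⟩ := he₀
  refine hasRainbowPaths_of_two_starts h.toRainbowBetween hU hi [p, q, v, w] [a] (t i₀ / 2 - 2)
    (t i₁ / 2) (by simp; omega) (by simp; omega) (by omega) (by simp) (by simp) ?_ ?_ ?_
    (Or.inr ?_) (Or.inr ?_) (by simp; omega)
  · simp at hnd haA ⊢
    grind
  · intro x hx
    rw [List.mem_append, List.mem_singleton] at hx
    rcases hx with hx | rfl
    · exact hTU x hx
    · exact h.notMem_hubs (h.sub ha)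
  · simpa using hC
  · simpa [hp] using hpC
  · simpa [h.sub ha] using haE

/-- A fresh path `w`, `z`, `x` that ends in `Y` suffices. -/
theorem IsCore.of_fresh_path (h : IsCore C U Y S β) (hU : halfSum t ≤ U.card + 2)
    (hS : k + halfSum t + 40 ≤ S.card) (hi : i₀ ≠ i₁) (ht₀ : 2 ≤ t i₀) (ht₁ : 2 ≤ t i₁)
    (he₀ : Even (t i₀)) {x z w : V} (hx : x ∈ Y) (hz : z ∉ U) (hw : w ∉ U)
    (hnd : [x, z, w].Nodup) (hf : IsFresh C U Y β (C s(x, z))) (hf' : IsFresh C U Y β (C s(z, w)))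
    (hne : C s(x, z) ≠ C s(z, w)) : HasRainbowPaths C t := by
  have hxU := h.notMem_hubs hx
  refine h.of_path hU hS hi ht₀ ht₁ he₀ (T := [x, z, w]) (by simp) (by simp) hnd
    (by simp [hxU, hz, hw]) (by simpa using hne) ?_ ?_
  · simp
    exact ⟨hf.1.symm, hf'.1.symm⟩
  · simp [hx]
    exact fun u hu => ⟨hf.2 u hu x hx, hf'.2 u hu x hx⟩

/-- A fresh path on three vertices with an end joined to `S` by an edge that is not fresh. -/
theorem IsCore.of_end_not_fresh (h : IsCore C U Y S β) (hU : halfSum t ≤ U.card + 2)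
    (hS : k + halfSum t + 40 ≤ S.card) (hi : i₀ ≠ i₁) (ht₀ : 4 ≤ t i₀)
    (he₀ : Even (t i₀)) {y x z x' : V} (hy : y ∈ S) (hnd : [y, x, z, x'].Nodup)
    (hxU : x ∉ U) (hzU : z ∉ U) (hxU' : x' ∉ U)
    (hf : IsFresh C U Y β (C s(x, z))) (hf' : IsFresh C U Y β (C s(z, x')))
    (hne : C s(x, z) ≠ C s(z, x')) (hγ : ¬ IsFresh C U Y β (C s(y, x))) :
    HasRainbowPaths C t := by
  have hyY := h.sub hy
  have hyU := h.notMem_hubs hyY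
  -- If yx has color β, the path y, x, z, x' is rainbow. Otherwise the color of yx occurs on an edge
  -- to a hub, hence is neither β nor fresh, and y₂, y, x, z works with a further vertex y₂ of S
  -- whose edges to U avoid that color.
  by_cases hβ : C s(y, x) = β
  · refine h.of_path_four hU hS hi ht₀ he₀ hnd (by simp [hyU, hxU, hzU, hxU']) ?_ hyY ?_
    · simp [hβ]
      exact ⟨⟨hf.1.symm, hf'.1.symm⟩, hne⟩
    · simp [hβ]
      exact fun u hu => ⟨h.notHub u hu y hyY, hf.2 u hu y hyY, hf'.2 u hu y hyY⟩
  · unfold IsFresh at hγ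
    push Not at hγ
    obtain ⟨u', hu', y', hy', hc⟩ := hγ hβ
    obtain ⟨y₂, hy₂, hA, hE⟩ := h.exists_mem_avoiding h.sub [y, x, z, x'] [C s(y, x)]
      (by simp; omega)
    have hyy : y₂ ≠ y := by rintro rfl; simp at hA
    have hcy := h.mono y₂ hy₂ y hy hyy
    have hne' : C s(y, x) ≠ C s(x, z) := fun heq => hf.2 u' hu' y' hy' (hc.trans heq)
    refine h.of_path_four hU hS hi ht₀ he₀ (p := y₂) (q := y) (v := x) (w := z) ?_
      (by simp [hyU, hxU, hzU, h.notMem_hubs (h.sub hy₂)]) ?_ (h.sub hy₂) ?_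
    · simp at hnd hA ⊢
      grind
    · simp [hcy]
      exact ⟨⟨Ne.symm hβ, hf.1.symm⟩, hne'⟩
    · simp at hE
      simp [hcy]
      exact fun u hu => ⟨h.notHub u hu _ (h.sub hy₂), hE u hu, hf.2 u hu _ (h.sub hy₂)⟩

/-- Two disjoint fresh edges, the second of which is attached to the hubs or need not be. -/
theorem IsCore.of_disjoint_fresh (h : IsCore C U Y S β) (hU : halfSum t ≤ U.card + 2)
    (hS : k + halfSum t + 40 ≤ S.card) (hi : i₀ ≠ i₁) (ht₁ : 2 ≤ t i₁)
    (he₀ : Even (t i₀)) {x x' w w' : V} (hnd : [x, x', w, w'].Nodup)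
    (ht₀ : t i₀ = 2 ∨ 4 ≤ t i₀ ∧ w ∈ Y) (hxU : x ∉ U) (hxU' : x' ∉ U) (hwU : w ∉ U)
    (hwU' : w' ∉ U) (hf : IsFresh C U Y β (C s(x, x'))) (hf' : IsFresh C U Y β (C s(w, w')))
    (hne : C s(x, x') ≠ C s(w, w')) : HasRainbowPaths C t := by
  have ht₀' : 2 ≤ t i₀ := by omega
  obtain ⟨y, hy, hA, -⟩ := h.exists_mem_avoiding h.sub [x, x', w, w'] [] (by simp; omega)
  have hyY := h.sub hy
  have hyU := h.notMem_hubs hyY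
  obtain ⟨y₂, hy₂, hA₂, hE₂⟩ := h.exists_mem_avoiding h.sub [y, x, x', w, w'] [C s(y, x)]
    (by simp; omega)
  have hyY₂ := h.sub hy₂
  have hyU₂ := h.notMem_hubs hyY₂
  have hyy : y₂ ≠ y := by rintro rfl; simp at hA₂
  have hcy := h.mono y₂ hy₂ y hy hyy
  simp only [List.mem_singleton] at hE₂
  have hfw : w ∈ Y → ∀ u ∈ U, C s(u, w) ≠ C s(w, w') ∧ C s(u, w) ≠ C s(x, x') ∧ C s(u, w) ≠ β :=
    fun hw u hu => ⟨hf'.2 u hu w hw, hf.2 u hu w hw, h.notHub u hu w hw⟩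
  -- The color of yx decides which start works: β gives y, x, x'; the color of xx' gives y₂, y, x;
  -- another fresh color gives a fresh path ending in Y; a color between U and Y gives y₂, y, x, x'.
  -- In the last case ww' is kept only if t i₀ = 2, as an edge from w to U might repeat the color of
  -- yx.
  by_cases hβ : C s(y, x) = β
  · refine h.of_path_pair hU hS hi ht₀' ht₁ he₀ (T := [y, x, x']) (a := w) (b := w') (by simp)
      (by simp) ?_ (by simp [hyU, hxU, hxU', hwU, hwU']) ?_ ?_ ?_
    · simp at hnd hA ⊢
      grind
    · simp [hβ]
      exact ⟨⟨hf'.1, hne.symm⟩, hf.1.symm⟩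
    · refine ht₀.imp id fun hw => ⟨hw.2, fun u hu => ?_⟩
      have := hfw hw.2 u hu
      simp [hβ]
      tauto
    · simp [hβ, hyY]
      exact fun u hu => ⟨hf'.2 u hu y hyY, h.notHub u hu y hyY, hf.2 u hu y hyY⟩
  by_cases hγ : IsFresh C U Y β (C s(y, x))
  · by_cases heq : C s(y, x) = C s(x, x')
    · refine h.of_path_pair hU hS hi ht₀' ht₁ he₀ (T := [y₂, y, x]) (a := w) (b := w') (by simp)
        (by simp) ?_ (by simp [hyU, hyU₂, hxU, hwU, hwU']) ?_ ?_ ?_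
      · simp at hnd hA hA₂ ⊢
        grind
      · simp [hcy, heq]
        exact ⟨⟨hf'.1, hne.symm⟩, hf.1.symm⟩
      · refine ht₀.imp id fun hw => ⟨hw.2, fun u hu => ?_⟩
        have := hfw hw.2 u hu
        simp [hcy, heq]
        tauto
      · simp [hcy, heq, hyY₂]
        exact fun u hu => ⟨hf'.2 u hu _ hyY₂, h.notHub u hu _ hyY₂, hf.2 u hu _ hyY₂⟩
    · refine h.of_fresh_path hU hS hi ht₀' ht₁ he₀ hyY hxU hxU' ?_ hγ hf heq
      simp at hnd hA ⊢
      grind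
  · have hγ' := hγ
    unfold IsFresh at hγ'
    push Not at hγ'
    obtain ⟨u', hu', y', hy', hc⟩ := hγ' hβ
    have hne₁ : C s(y, x) ≠ C s(x, x') := fun heq => hf.2 u' hu' y' hy' (hc.trans heq)
    have hne₂ : C s(y, x) ≠ C s(w, w') := fun heq => hf'.2 u' hu' y' hy' (hc.trans heq)
    rcases ht₀ with ht₀ | ⟨ht₀, -⟩
    · refine h.of_path_pair hU hS hi ht₀' ht₁ he₀ (T := [y₂, y, x, x']) (a := w) (b := w')
        (by simp) (by simp) ?_ (by simp [hyU, hyU₂, hxU, hxU', hwU, hwU']) ?_ (Or.inl ht₀) ?_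
      · simp at hnd hA hA₂ ⊢
        grind
      · simp [hcy]
        exact ⟨⟨hf'.1, hne₂.symm, hne.symm⟩, ⟨Ne.symm hβ, hf.1.symm⟩, hne₁⟩
      · simp [hcy, hyY₂]
        exact fun u hu =>
          ⟨hf'.2 u hu _ hyY₂, h.notHub u hu _ hyY₂, hE₂ u hu, hf.2 u hu _ hyY₂⟩
    · refine h.of_path_four hU hS hi ht₀ he₀ (p := y₂) (q := y) (v := x) (w := x') ?_
        (by simp [hyU, hyU₂, hxU, hxU']) ?_ hyY₂ ?_
      · simp at hnd hA hA₂ ⊢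
        grind
      · simp [hcy]
        exact ⟨⟨Ne.symm hβ, hf.1.symm⟩, hne₁⟩
      · simp [hcy]
        exact fun u hu => ⟨h.notHub u hu _ hyY₂, hE₂ u hu, hf.2 u hu _ hyY₂⟩

/-- A fresh path on three vertices suffices if some even component has at least four vertices. -/
theorem IsCore.of_adjacent_fresh (h : IsCore C U Y S β) (hU : halfSum t ≤ U.card + 2)
    (hS : k + halfSum t + 40 ≤ S.card) (hi : i₀ ≠ i₁) (ht₀ : 4 ≤ t i₀) (ht₁ : 2 ≤ t i₁)
    (he₀ : Even (t i₀)) {x z x' : V} (hnd : [x, z, x'].Nodup)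
    (hxU : x ∉ U) (hzU : z ∉ U) (hxU' : x' ∉ U)
    (hf : IsFresh C U Y β (C s(x, z))) (hf' : IsFresh C U Y β (C s(z, x')))
    (hne : C s(x, z) ≠ C s(z, x')) : HasRainbowPaths C t := by
  by_contra hno
  -- Without the required paths, every other vertex y of S sees x in the color of xz. Applied at
  -- both ends, this moves the two fresh colors to disjoint edges with ends in S.
  have key : ∀ x x' : V, [x, z, x'].Nodup → x ∉ U → x' ∉ U → IsFresh C U Y β (C s(x, z)) →
      IsFresh C U Y β (C s(z, x')) → C s(x, z) ≠ C s(z, x') → ∀ y ∈ S, y ∉ [x, z, x'] →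
      C s(y, x) = C s(x, z) := by
    intro x x' hnd hxU hxU' hf hf' hne y hy hyA
    by_contra heq
    by_cases hγ : IsFresh C U Y β (C s(y, x))
    · refine hno (h.of_fresh_path hU hS hi (by omega) ht₁ he₀ (h.sub hy) hxU hzU ?_ hγ hf heq)
      simp at hnd hyA ⊢
      grind
    · refine hno (h.of_end_not_fresh hU hS hi ht₀ he₀ hy ?_ hxU hzU hxU' hf hf' hne hγ)
      exact List.nodup_cons.2 ⟨hyA, hnd⟩
  obtain ⟨y, hy, hA, -⟩ := h.exists_mem_avoiding h.sub [x, z, x'] [] (by simp; omega)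
  obtain ⟨y', hy', hA', -⟩ := h.exists_mem_avoiding h.sub [y, x, z, x'] [] (by simp; omega)
  have h1 := key x x' hnd hxU hxU' hf hf' hne y hy hA
  have hzx : C s(x', z) = C s(z, x') := by rw [Sym2.eq_swap]
  have hxz : C s(z, x) = C s(x, z) := by rw [Sym2.eq_swap]
  have h2 := key x' x (by simp at hnd ⊢; grind) hxU' hxU (hzx ▸ hf') (hxz ▸ hf)
    (by rw [hzx, hxz]; exact hne.symm) y' hy' (by simp at hA' ⊢; grind)
  rw [hzx] at h2
  refine hno (h.of_disjoint_fresh hU hS hi ht₁ he₀ (x := y) (x' := x) (w := y') (w' := x') ?_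
    (Or.inr ⟨ht₀, h.sub hy'⟩) (h.notMem_hubs (h.sub hy)) hxU (h.notMem_hubs (h.sub hy')) hxU'
    (h1 ▸ hf) (h2 ▸ hf') (by rw [h1, h2]; exact hne))
  simp at hnd hA hA' ⊢
  grind

end Core

/-! ### How many fresh colors are possible. -/

section Fresh

variable {V : Type*}

/-- At least as many edges as there are vertices cannot form a matching. -/
theorem exists_adjacent_edges [DecidableEq V] {R : Finset (Sym2 V)} {B : Finset V}
    (hd : ∀ e ∈ R, ¬ e.IsDiag) (hB : ∀ e ∈ R, ∀ v ∈ e, v ∈ B) (hpos : 0 < R.card)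
    (hle : B.card ≤ R.card) :
    ∃ x z x', s(x, z) ∈ R ∧ s(z, x') ∈ R ∧ [x, z, x'].Nodup := by
  by_contra hno
  push Not at hno
  have hdisj : (R : Set (Sym2 V)).PairwiseDisjoint Sym2.toFinset := by
    intro e he e' he' hne
    rw [Function.onFun, Finset.disjoint_left]
    intro z hz hz'
    rw [Sym2.mem_toFinset] at hz hz'
    obtain ⟨x, rfl⟩ := hz
    obtain ⟨x', rfl⟩ := hz'
    refine hno x z x' (by rw [Sym2.eq_swap]; exact he) he' ?_
    have h1 := hd _ he
    have h2 := hd _ he'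
    simp only [Sym2.mk_isDiag_iff] at h1 h2
    simp only [List.nodup_cons, List.mem_cons, List.not_mem_nil, or_false, not_or,
      not_false_eq_true, List.nodup_nil, and_true]
    exact ⟨⟨Ne.symm h1, fun h => hne (by rw [h])⟩, h2⟩
  -- A matching would cover 2|R| vertices of B, more than |B|.
  have h1 := Finset.card_biUnion hdisj
  have h2 : ∑ e ∈ R, e.toFinset.card = R.card * 2 :=
    Finset.sum_const_nat fun e he => Sym2.card_toFinset_of_not_isDiag e (hd e he)
  have h3 : (R.biUnion Sym2.toFinset).card ≤ B.card := by
    refine Finset.card_le_card fun v hv => ?_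
    obtain ⟨e, he, hv⟩ := Finset.mem_biUnion.1 hv
    exact hB e he v (Sym2.mem_toFinset.1 hv)
  omega

/-- A set of pairwise intersecting edges, no two of which form a path with an end outside `B`, has
at most `max 1 |B|` members. -/
theorem card_intersecting_le [DecidableEq V] {R : Finset (Sym2 V)} {B : Finset V}
    (hd : ∀ e ∈ R, ¬ e.IsDiag)
    (hint : ∀ a b c d, s(a, b) ∈ R → s(c, d) ∈ R → ¬ [a, b, c, d].Nodup)
    (hB : ∀ a b c, s(a, b) ∈ R → s(b, c) ∈ R → a ≠ c → a ∈ B) : R.card ≤ max 1 B.card := by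
  by_contra! hlt
  rw [max_lt_iff] at hlt
  have hne : ∀ a b, s(a, b) ∈ R → a ≠ b := fun a b hab => by simpa using hd _ hab
  obtain ⟨e, he, e', he', hee⟩ := Finset.one_lt_card.1 hlt.1
  obtain ⟨z, x, x', rfl, rfl⟩ : ∃ z x x', e = s(z, x) ∧ e' = s(z, x') := by
    induction e with | _ a b
    induction e' with | _ c d
    have h1 := hint a b c d he he'
    have h2 := hne a b he
    have h3 := hne c d he'
    by_cases hac : a = c
    · exact ⟨a, b, d, rfl, by rw [hac]⟩
    by_cases had : a = d
    · exact ⟨a, b, c, rfl, by rw [had, Sym2.eq_swap]⟩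
    by_cases hbc : b = c
    · exact ⟨b, a, d, Sym2.eq_swap, by rw [hbc]⟩
    by_cases hbd : b = d
    · exact ⟨b, a, c, Sym2.eq_swap, by rw [hbd, Sym2.eq_swap]⟩
    simp at h1
    grind
  have hxx : x ≠ x' := fun hx => hee (by rw [hx])
  have hzx := hne _ _ he
  have hzx' := hne _ _ he'
  have hxB : x ∈ B := hB x z x' (by rwa [Sym2.eq_swap]) he' hxx
  have hxB' : x' ∈ B := hB x' z x (by rwa [Sym2.eq_swap]) he hxx.symm
  -- Intersecting edges form a star or a triangle. In a star with at least two edges all leaves lie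
  -- in B; in a triangle all three vertices do.
  by_cases hall : ∀ f ∈ R, z ∈ f
  · have hsub : R ⊆ B.image fun v => s(z, v) := by
      intro f hf
      obtain ⟨v, rfl⟩ := hall f hf
      refine Finset.mem_image.2 ⟨v, ?_, rfl⟩
      by_cases hvx : v = x
      · rwa [hvx]
      · exact hB v z x (by rwa [Sym2.eq_swap]) he hvx
    have := (Finset.card_le_card hsub).trans Finset.card_image_le
    omega
  · push Not at hall
    obtain ⟨f, hf, hzf⟩ := hall
    have hf' : f = s(x, x') := by
      induction f with | _ a b
      have h1 := hint a b z x hf he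
      have h2 := hint a b z x' hf he'
      have h3 := hne a b hf
      simp at hzf h1 h2 ⊢
      grind
    rw [hf'] at hf
    have hzB : z ∈ B := hB z x x' he hf hzx'
    have hsub : R ⊆ {s(z, x), s(z, x'), s(x, x')} := by
      intro g hg
      induction g with | _ a b
      have h1 := hint a b z x hg he
      have h2 := hint a b z x' hg he'
      have h4 := hint a b x x' hg hf
      have h3 := hne a b hg
      simp at h1 h2 h4 ⊢
      clear hd hint hB hne hg hlt hf he he' hf' hee
      by_cases hbz : b = z
      · grind
      by_cases hbx : b = x
      · grind
      by_cases hbx' : b = x' <;> by_cases haz : a = z <;> grind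
    have h1 := (Finset.card_le_card hsub).trans Finset.card_le_three
    have h2 : ({z, x, x'} : Finset V) ⊆ B := by
      intro v hv
      simp at hv
      rcases hv with rfl | rfl | rfl <;> assumption
    have h3 := Finset.card_le_card h2
    have h4 : ({z, x, x'} : Finset V).card = 3 := Finset.card_eq_three.2
      ⟨z, x, x', hzx, hzx', hxx, rfl⟩
    omega

variable {K : Type*} {C : Sym2 V → K} {U Y S : Finset V} {β : K} {k : ℕ} {t : Fin k → ℕ}
  {i₀ i₁ : Fin k}

/-- `R` consists of edges outside `U` with pairwise distinct fresh colors. -/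
structure IsFreshSet (C : Sym2 V → K) (U Y : Finset V) (β : K) (R : Finset (Sym2 V)) : Prop where
  not_isDiag : ∀ e ∈ R, ¬ e.IsDiag
  notMem : ∀ e ∈ R, ∀ v ∈ e, v ∉ U
  fresh : ∀ e ∈ R, IsFresh C U Y β (C e)
  inj : Set.InjOn C R

/-- A fresh edge and an edge of color `β` suffice for two paths of even order, one of which is a
single edge. -/
theorem IsCore.of_even_even_two (h : IsCore C U Y S β) (hU : halfSum t ≤ U.card + 2)
    (hS : k + halfSum t + 40 ≤ S.card) (hi : i₀ ≠ i₁) (ht₀ : t i₀ = 2) (ht₁ : 2 ≤ t i₁)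
    (he₁ : Even (t i₁)) {x z : V} (hxz : x ≠ z) (hx : x ∉ U) (hz : z ∉ U)
    (hf : IsFresh C U Y β (C s(x, z))) : HasRainbowPaths C t := by
  have hSY := Finset.card_le_card h.sub
  obtain ⟨a, ha, haA, -⟩ := h.exists_mem_avoiding h.sub [x, z] [] (by simp; omega)
  obtain ⟨b, hb, hbA, -⟩ := h.exists_mem_avoiding h.sub [x, z, a] [] (by simp; omega)
  have hab : a ≠ b := by rintro rfl; simp at hbA
  have hcab := h.mono a ha b hb hab
  have haU := h.notMem_hubs (h.sub ha)
  have hbU := h.notMem_hubs (h.sub hb)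
  obtain ⟨c₁, hc₁⟩ := he₁
  refine hasRainbowPaths_of_two_starts h.toRainbowBetween hU hi [x, z] [a, b] 0
    (t i₁ / 2 - 1) (by simp; omega) (by simp; omega) (by omega) (by simp) (by simp) ?_ ?_ ?_
    (Or.inl rfl) (Or.inr ?_) (by simp; omega)
  · simp at haA hbA ⊢
    grind
  · simp [hx, hz, haU, hbU]
  · simpa [hcab] using hf.1
  · simp [hcab, h.sub ha]
    exact fun u hu => ⟨hf.2 u hu a (h.sub ha), h.notHub u hu a (h.sub ha)⟩

variable {R : Finset (Sym2 V)}

theorem IsFreshSet.data (hR : IsFreshSet C U Y β R) {x z : V} (h : s(x, z) ∈ R) :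
    x ≠ z ∧ x ∉ U ∧ z ∉ U ∧ IsFresh C U Y β (C s(x, z)) :=
  ⟨by simpa using hR.not_isDiag _ h, hR.notMem _ h x (by simp), hR.notMem _ h z (by simp),
    hR.fresh _ h⟩

variable [Fintype V] [DecidableEq V]

/-- Edges avoiding both U and Y live on the remaining vertices, too few to carry R as a matching. -/
theorem IsFreshSet.exists_mem_of_forall_notMem (hR : IsFreshSet C U Y β R)
    (hno : ∀ x z, s(x, z) ∈ R → x ∉ Y) (hpos : 0 < R.card)
    (hle : ((Finset.univ \ U) \ Y).card ≤ R.card) :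
    ∃ x z x', s(x, z) ∈ R ∧ s(z, x') ∈ R ∧ [x, z, x'].Nodup := by
  refine exists_adjacent_edges (B := (Finset.univ \ U) \ Y) hR.not_isDiag ?_ hpos hle
  intro e he v hv
  have hvU := hR.notMem e he v hv
  obtain ⟨w, rfl⟩ := hv
  simp [hvU, hno v w he]

/-- With two paths of even order, at least `max 1 |B|` fresh colors suffice, where `B` is the set of
vertices outside `U` and `Y`. -/
theorem IsCore.of_even_even (h : IsCore C U Y S β) (hU : halfSum t ≤ U.card + 2)
    (hS : k + halfSum t + 40 ≤ S.card) (hi : i₀ ≠ i₁) (ht₀ : 2 ≤ t i₀) (ht₁ : 2 ≤ t i₁)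
    (he₀ : Even (t i₀)) (he₁ : Even (t i₁)) (hR : IsFreshSet C U Y β R) (hpos : 0 < R.card)
    (hle : ((Finset.univ \ U) \ Y).card ≤ R.card) : HasRainbowPaths C t := by
  by_contra hno
  have hYR : ∀ x z, s(x, z) ∈ R → x ∉ Y := fun x z hxz hx => by
    obtain ⟨hne, -, hz, hf⟩ := hR.data hxz
    exact hno (h.of_even_even_touching hU hS hi ht₀ ht₁ he₀ he₁ hx hz hne hf)
  obtain ⟨x, z, x', h1, h2, hnd⟩ := hR.exists_mem_of_forall_notMem hYR hpos hle
  obtain ⟨hne, hx, hz, hf⟩ := hR.data h1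
  obtain ⟨hne', -, hx', hf'⟩ := hR.data h2
  have hC : C s(x, z) ≠ C s(z, x') := fun heq => by
    have := hR.inj h1 h2 heq
    simp at this hnd
    grind
  by_cases h4 : t i₀ = 2
  · exact hno (h.of_even_even_two hU hS hi h4 ht₁ he₁ hne hx hz hf)
  · obtain ⟨c, hc⟩ := he₀
    exact hno (h.of_adjacent_fresh hU hS hi (by omega) ht₁ ⟨c, hc⟩ hnd hx hz hx' hf hf' hC)

/-- With one path of even order, more than `max 1 |B|` fresh colors suffice, where `B` is the set of
vertices outside `U` and `Y`. -/
theorem IsCore.of_even (h : IsCore C U Y S β) (hU : halfSum t ≤ U.card + 2)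
    (hS : k + halfSum t + 40 ≤ S.card) (hi : i₀ ≠ i₁) (ht₀ : 2 ≤ t i₀) (ht₁ : 2 ≤ t i₁)
    (he₀ : Even (t i₀)) (hR : IsFreshSet C U Y β R) (hpos : 1 < R.card)
    (hle : ((Finset.univ \ U) \ Y).card < R.card) : HasRainbowPaths C t := by
  by_contra hno
  have hCne : ∀ {e e'}, e ∈ R → e' ∈ R → e ≠ e' → C e ≠ C e' := fun he he' hne heq =>
    hne (hR.inj he he' heq)
  -- For t i₀ = 2 two disjoint fresh edges suffice, so R would be intersecting. For t i₀ ≥ 4 two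
  -- adjacent ones suffice, so R would be a matching; by counting it has an edge meeting Y, and any
  -- second edge is disjoint from it.
  by_cases h4 : t i₀ = 2
  · refine absurd (card_intersecting_le (B := (Finset.univ \ U) \ Y) hR.not_isDiag ?_ ?_)
      (by rw [not_le, max_lt_iff]; exact ⟨hpos, hle⟩)
    · intro a b c d hab hcd hnd
      obtain ⟨-, ha, hb, hf⟩ := hR.data hab
      obtain ⟨-, hc, hd, hf'⟩ := hR.data hcd
      refine hno (h.of_disjoint_fresh hU hS hi ht₁ he₀ hnd (Or.inl h4) ha hb hc hd hf hf'
        (hCne hab hcd ?_))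
      simp at hnd ⊢
      grind
    · intro a b c hab hbc hac
      obtain ⟨hne, ha, hb, hf⟩ := hR.data hab
      obtain ⟨hne', -, hc, hf'⟩ := hR.data hbc
      by_contra haB
      have haY : a ∈ Y := by simpa [ha] using haB
      refine hno (h.of_fresh_path hU hS hi ht₀ ht₁ he₀ haY hb hc ?_ hf hf' (hCne hab hbc ?_))
      · simp
        grind
      · simp
        grind
  · have h4' : 4 ≤ t i₀ := by
      obtain ⟨c, hc⟩ := he₀
      omega
    have hadj : ∀ x z x', s(x, z) ∈ R → s(z, x') ∈ R → ¬ [x, z, x'].Nodup := by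
      intro x z x' h1 h2 hnd
      obtain ⟨-, hx, hz, hf⟩ := hR.data h1
      obtain ⟨-, -, hx', hf'⟩ := hR.data h2
      refine hno (h.of_adjacent_fresh hU hS hi h4' ht₁ he₀ hnd hx hz hx' hf hf' (hCne h1 h2 ?_))
      simp at hnd ⊢
      grind
    obtain ⟨w, w', hw, hwY⟩ : ∃ w w', s(w, w') ∈ R ∧ w ∈ Y := by
      by_contra! hY
      obtain ⟨x, z, x', h1, h2, hnd⟩ := hR.exists_mem_of_forall_notMem hY (by omega) hle.le
      exact hadj x z x' h1 h2 hnd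
    obtain ⟨e, he, hew⟩ := Finset.exists_mem_ne hpos s(w, w')
    induction e with | _ a b
    obtain ⟨hne, ha, hb, hf⟩ := hR.data he
    obtain ⟨hne', hwU, hwU', hf'⟩ := hR.data hw
    have he' : s(b, a) ∈ R := by rwa [Sym2.eq_swap]
    have hw' : s(w', w) ∈ R := by rwa [Sym2.eq_swap]
    refine hno (h.of_disjoint_fresh hU hS hi ht₁ he₀ (x := a) (x' := b) (w := w) (w' := w') ?_
      (Or.inr ⟨h4', hwY⟩) ha hb hwU hwU' hf hf' (hCne he hw hew))
    have h1 := hadj a b w' he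
    have h2 := hadj a b w he
    have h3 := hadj b a w' he'
    have h5 := hadj b a w he'
    simp at h1 h2 h3 h5 hew ⊢
    grind

end Fresh

/-! ### From many colors to a core. -/

section Upper

universe u v

theorem degSum_univ {V : Type*} [Fintype V] (G : SimpleGraph V) :
    degSum G Finset.univ = 2 * G.edgeSet.ncard := by
  classical
  rw [Set.ncard_eq_toFinset_card', ← SimpleGraph.edgeFinset,
    ← SimpleGraph.sum_degrees_eq_twice_card_edges]
  unfold degSum degIn
  refine Finset.sum_congr rfl fun v _ => ?_
  rw [← SimpleGraph.card_neighborFinset_eq_degree, SimpleGraph.neighborFinset_eq_filter]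

/-- A rainbow spanning subgraph that contains an edge of every color. -/
theorem exists_representing_graph {V : Type*} {K : Type*} (C : Sym2 V → K) :
    ∃ G : SimpleGraph V, Set.InjOn C G.edgeSet ∧
      C '' G.edgeSet = C '' (⊤ : SimpleGraph V).edgeSet := by
  obtain ⟨T, hT, hbij⟩ := (Set.surjOn_image C (⊤ : SimpleGraph V).edgeSet).exists_bijOn_subset
  have hG : (SimpleGraph.fromEdgeSet T).edgeSet = T := by
    rw [SimpleGraph.edgeSet_fromEdgeSet, sdiff_eq_left, Set.disjoint_left]
    intro e he hd
    have := hT he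
    rw [SimpleGraph.edgeSet_top] at this
    exact this hd
  exact ⟨SimpleGraph.fromEdgeSet T, hG.symm ▸ hbij.injOn, hG.symm ▸ hbij.image_eq⟩

/-- A rainbow subgraph without long paths has few edges. -/
theorem degSum_le_of_not_hasRainbowPaths {V : Type*} [Fintype V] {K : Type*} {C : Sym2 V → K}
    {G : SimpleGraph V} (hG : Set.InjOn C G.edgeSet) {k : ℕ} {t : Fin k → ℕ}
    (hno : ¬ HasRainbowPaths C t) :
    degSum G Finset.univ ≤ (2 * (k * ∑ i, t i + 1)) * Fintype.card V := by
  have h := degSum_add_card_le (G := G) (f := fun _ => k * ∑ i, t i + 1) Finset.univ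
    (fun _ _ => by omega) (fun v _ ⟨L, hL, _, _, hlen⟩ =>
      hno (hasRainbowPaths_of_long hG hL (by omega)))
  simp only [Finset.sum_const, Finset.card_univ, smul_eq_mul] at h
  calc _ ≤ _ := (Nat.le_add_right _ _).trans h
    _ = _ := by ring

/-- The color β occurs on at most one edge between U and S, so dropping one vertex is enough. -/
theorem IsCore.exists_of_mono {V : Type*} {K : Type*} {C : Sym2 V → K} {U Y S : Finset V}
    (h : RainbowBetween C U Y) (hS : S ⊆ Y) {β : K}
    (hβ : ∀ x ∈ S, ∀ y ∈ S, x ≠ y → C s(x, y) = β) :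
    ∃ S' : Finset V, S.card ≤ S'.card + 1 ∧ IsCore C U S' S' β := by
  classical
  have h' : RainbowBetween C U S := ⟨h.disjoint.mono_right hS, fun u hu y hy u' hu' y' hy' =>
    h.inj u hu y (hS hy) u' hu' y' (hS hy')⟩
  have h1 := h'.card_meeting_le [β]
  have h2 := Finset.card_filter_add_card_filter_not (s := S) fun y => ∃ u ∈ U, C s(u, y) ∈ [β]
  have hsub := Finset.filter_subset (fun y => ¬ ∃ u ∈ U, C s(u, y) ∈ [β]) S
  refine ⟨S.filter fun y => ¬ ∃ u ∈ U, C s(u, y) ∈ [β], ?_,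
    ⟨⟨h'.disjoint.mono_right hsub, fun u hu y hy u' hu' y' hy' =>
      h'.inj u hu y (hsub hy) u' hu' y' (hsub hy')⟩, subset_rfl,
      fun x hx y hy => hβ x (hsub hx) y (hsub hy), fun u hu y hy => ?_⟩⟩
  · simp only [List.length_singleton] at h1
    omega
  · have := (Finset.mem_filter.1 hy).2
    push Not at this
    simpa using this u hu

/-- A coloring with many colors and without the required rainbow paths contains a core. -/
theorem exists_isCore {k : ℕ} (hk : 2 ≤ k) (t : Fin k → ℕ) (ht : ∀ i, 2 ≤ t i)
    (heven : ∃ i, Even (t i)) (M : ℕ) :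
    ∃ N : ℕ, ∀ (V : Type u) [Fintype V] [DecidableEq V] (K : Type v) (C : Sym2 V → K),
      N ≤ Fintype.card V → ¬ HasRainbowPaths C t →
      (halfSum t - 2) * (Fintype.card V - (halfSum t - 2)) ≤
        (C '' (⊤ : SimpleGraph V).edgeSet).ncard →
      ∃ (U S : Finset V) (β : K), U.card = halfSum t - 2 ∧ IsCore C U S S β ∧ M ≤ S.card := by
  obtain ⟨N₁, hN₁⟩ := exists_rainbow_path_or_monochromatic_clique.{u, v} (k * ∑ i, t i) (M + 1)
  set r := halfSum t - 2 with hr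
  -- Enough blocks for either outcome: N₁ for the Ramsey step, the other summand for the case of too
  -- few hubs.
  obtain ⟨N, hN⟩ := exists_hubBlocks.{u} r (2 * r * r)
    (N₁ + (k * ∑ i, t i + halfSum t + k + 4)) (2 * (k * ∑ i, t i + 1))
  refine ⟨N, fun V _ _ K C hcard hno hcol => ?_⟩
  obtain ⟨G, hG, himg⟩ := exists_representing_graph C
  have hdeg : 2 * r * Fintype.card V ≤ degSum G Finset.univ + 2 * r * r := by
    rw [degSum_univ, ← hG.ncard_image, himg]
    have h1 : Fintype.card V ≤ (Fintype.card V - r) + r := by omega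
    calc 2 * r * Fintype.card V ≤ 2 * r * ((Fintype.card V - r) + r) := Nat.mul_le_mul_left _ h1
      _ = 2 * (r * (Fintype.card V - r)) + 2 * r * r := by ring
      _ ≤ _ := by gcongr
  obtain ⟨U', B, hB⟩ := hN V G hcard hdeg (degSum_le_of_not_hasRainbowPaths hG hno)
  have hU' : r ≤ U'.card := by
    by_contra! hlt
    exact hno (hasRainbowPaths_of_few_hubs hG hk t ht heven (by omega) hlt hB)
  obtain ⟨U, hUU, hUcard⟩ := Finset.exists_subset_card_eq hU'
  -- With no deficit in hubs the blocks are single vertices.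
  have hlen : ∀ i, (B i).length = 1 := fun i => by
    rw [hB.length, Nat.sub_eq_zero_of_le hU']
    rfl
  choose w hw using fun i => List.length_eq_one_iff.1 (hlen i)
  have hwinj : Function.Injective w := by
    intro i j hij
    by_contra hne
    have := hB.disjoint hne
    simp only [hw, hij] at this
    simp at this
  have hwU : ∀ i, w i ∉ U' := fun i => fun h => hB.notMem i (w i) h (by simp [hw])
  have hadj : ∀ i, ∀ u ∈ U', s(u, w i) ∈ G.edgeSet := fun i u hu =>
    (hB.adj i u hu (w i) (by simp [hw])).symm
  have hcore : RainbowBetween C U (Finset.univ.map ⟨w, hwinj⟩) := by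
    refine ⟨?_, ?_⟩
    · rw [Finset.disjoint_left]
      intro u hu hu'
      obtain ⟨i, -, rfl⟩ := Finset.mem_map.1 hu'
      exact hwU i (hUU hu)
    · intro u hu y hy u' hu' y' hy' heq
      obtain ⟨i, -, rfl⟩ := Finset.mem_map.1 hy
      obtain ⟨j, -, rfl⟩ := Finset.mem_map.1 hy'
      have h1 := hG (hadj i u (hUU hu)) (hadj j u' (hUU hu')) heq
      rw [Sym2.eq_iff] at h1
      refine h1.resolve_right fun h2 => ?_
      exact hwU j (h2.1 ▸ hUU hu)
  rcases hN₁ C (Finset.univ.map ⟨w, hwinj⟩) (by simp) with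
    ⟨l, hl, hlong⟩ | ⟨S, hS, hScard, β, hβ⟩
  · exact absurd (hasRainbowPaths_of_rainbow_list hl.nodup hl.rainbow hlong) hno
  · obtain ⟨S', hS', hc⟩ := IsCore.exists_of_mono hcore hS hβ
    exact ⟨U, S', β, hUcard, hc, by omega⟩

end Upper

/-! ### Counting colors around a maximal core. -/

section Structure

universe u v

variable {V : Type*} [DecidableEq V]

/-- A vertex that cannot be added to the core has a superfluous edge to `U`. -/
theorem IsCore.exists_superfluous {K : Type*} {C : Sym2 V → K} {U Y S : Finset V} {β : K}
    (h : IsCore C U Y S β) {z : V} (hz : z ∉ U)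
    (hmax : ¬ IsCore C U (insert z Y) S β) :
    ∃ u ∈ U, C s(u, z) = β ∨ (∃ u' ∈ U, ∃ y ∈ Y, C s(u, z) = C s(u', y)) ∨
      ∃ u' ∈ U, u' ≠ u ∧ C s(u, z) = C s(u', z) := by
  by_contra! hno
  refine hmax ⟨⟨?_, ?_⟩, h.sub.trans (Finset.subset_insert _ _), h.mono, ?_⟩
  · rw [Finset.disjoint_insert_right]
    exact ⟨hz, h.disjoint⟩
  · intro u hu y hy u' hu' y' hy' heq
    rw [Finset.mem_insert] at hy hy'
    rcases hy with rfl | hy <;> rcases hy' with rfl | hy'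
    · refine ⟨?_, rfl⟩
      by_contra hne
      exact (hno u hu).2.2 u' hu' (Ne.symm hne) heq
    · exact absurd heq ((hno u hu).2.1 u' hu' y' hy')
    · exact absurd heq.symm ((hno u' hu').2.1 u hu y hy)
    · exact h.inj u hu y hy u' hu' y' hy' heq
  · intro u hu y hy
    rcases Finset.mem_insert.1 hy with rfl | hy
    · exact (hno u hu).1
    · exact h.notHub u hu y hy

variable [Fintype V]

/-- The edges of the complete graph that meet `U`. -/
def edgesMeeting (U : Finset V) : Finset (Sym2 V) :=
  Finset.univ.filter fun e => ¬ e.IsDiag ∧ ∃ u ∈ U, u ∈ e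

/-- The edges of the complete graph that avoid `U`. -/
def edgesAvoiding (U : Finset V) : Finset (Sym2 V) :=
  Finset.univ.filter fun e => ¬ e.IsDiag ∧ ∀ u ∈ U, u ∉ e

theorem mem_edgesMeeting {U : Finset V} {e : Sym2 V} :
    e ∈ edgesMeeting U ↔ ¬ e.IsDiag ∧ ∃ u ∈ U, u ∈ e := by
  simp [edgesMeeting]

theorem mem_edgesAvoiding {U : Finset V} {e : Sym2 V} :
    e ∈ edgesAvoiding U ↔ ¬ e.IsDiag ∧ ∀ u ∈ U, u ∉ e := by
  simp [edgesAvoiding]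

theorem coe_edgesMeeting_union_edgesAvoiding (U : Finset V) :
    ((edgesMeeting U ∪ edgesAvoiding U : Finset (Sym2 V)) : Set (Sym2 V)) =
      (⊤ : SimpleGraph V).edgeSet := by
  ext e
  rw [Finset.mem_coe, Finset.mem_union, mem_edgesMeeting, mem_edgesAvoiding,
    SimpleGraph.edgeSet_top, Set.mem_compl_iff, Sym2.mem_diagSet]
  by_cases h : ∃ u ∈ U, u ∈ e
  · simp [h]
  · push Not at h
    simp only [← and_or_left]
    tauto

theorem disjoint_edgesMeeting_edgesAvoiding (U : Finset V) :
    Disjoint (edgesMeeting U) (edgesAvoiding U) := by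
  rw [Finset.disjoint_left]
  intro e he he'
  obtain ⟨-, u, hu, hue⟩ := mem_edgesMeeting.1 he
  exact (mem_edgesAvoiding.1 he').2 u hu hue

theorem card_edgesAvoiding (U : Finset V) :
    (edgesAvoiding U).card = (Fintype.card V - U.card).choose 2 := by
  rw [← Finset.card_compl, ← Sym2.card_image_offDiag]
  congr 1
  ext e
  induction e with | _ a b
  simp only [mem_edgesAvoiding, Finset.mem_image, Finset.mem_offDiag, Finset.mem_compl, Prod.exists]
  constructor
  · rintro ⟨h1, h2⟩
    exact ⟨a, b, ⟨fun h => h2 a h (by simp), fun h => h2 b h (by simp), by simpa using h1⟩, rfl⟩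
  · rintro ⟨x, y, ⟨hx, hy, hxy⟩, h⟩
    rw [← h]
    refine ⟨by simpa using hxy, fun u hu huv => ?_⟩
    rcases Sym2.mem_iff.1 huv with rfl | rfl
    · exact hx hu
    · exact hy hu

theorem choose_two_add (r m : ℕ) : (r + m).choose 2 = r.choose 2 + r * m + m.choose 2 := by
  induction m with
  | zero => simp
  | succ m ih =>
    rw [← Nat.add_assoc, Nat.choose_succ_succ' _ 1, ih, Nat.choose_one_right,
      Nat.choose_succ_succ' m 1, Nat.choose_one_right]
    ring

theorem card_edgesMeeting (U : Finset V) :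
    (edgesMeeting U).card = U.card.choose 2 + U.card * (Fintype.card V - U.card) := by
  have h1 := Finset.card_union_of_disjoint (disjoint_edgesMeeting_edgesAvoiding U)
  have h2 : (edgesMeeting U ∪ edgesAvoiding U).card = (Fintype.card V).choose 2 := by
    have h3 : edgesMeeting (∅ : Finset V) = ∅ := by
      simp [edgesMeeting]
    rw [← Set.ncard_coe_finset, coe_edgesMeeting_union_edgesAvoiding,
      ← coe_edgesMeeting_union_edgesAvoiding ∅, Set.ncard_coe_finset, h3, Finset.empty_union,
      card_edgesAvoiding, Finset.card_empty, Nat.sub_zero]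
  have h3 := choose_two_add U.card (Fintype.card V - U.card)
  rw [Nat.add_sub_cancel' (Finset.card_le_univ U)] at h3
  rw [card_edgesAvoiding] at h1
  omega

variable {K : Type*} {C : Sym2 V → K} {U Y S : Finset V} {β : K} {k : ℕ} {t : Fin k → ℕ}

/-- The number of fresh colors is bounded. -/
theorem IsCore.card_fresh_lt (h : IsCore C U Y S β) (hU : halfSum t ≤ U.card + 2)
    (hS : k + halfSum t + 40 ≤ S.card) (hk : 2 ≤ k) (ht : ∀ i, 2 ≤ t i) (heven : ∃ i, Even (t i))
    (hno : ¬ HasRainbowPaths C t) {D : Finset K}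
    (hD : ∀ c ∈ D, IsFresh C U Y β c ∧ ∃ e ∈ edgesAvoiding U, C e = c) :
    D.card < epsilon t + max 1 ((Finset.univ \ U) \ Y).card := by
  classical
  choose hf g hg hC using hD
  set R : Finset (Sym2 V) := D.attach.image fun c => g c.1 c.2 with hR
  have hRcard : R.card = D.card := by
    rw [hR, Finset.card_image_of_injective, Finset.card_attach]
    intro c c' hcc
    have := congrArg C hcc
    simp only [hC] at this
    exact Subtype.ext this
  have hmem : ∀ e ∈ R, ∃ c, ∃ hc : c ∈ D, g c hc = e := by
    intro e he
    obtain ⟨c, -, hc⟩ := Finset.mem_image.1 he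
    exact ⟨c.1, c.2, hc⟩
  have hfresh : IsFreshSet C U Y β R := by
    refine ⟨fun e he => ?_, fun e he v hv hvU => ?_, fun e he => ?_, fun e he e' he' heq => ?_⟩
    · obtain ⟨c, hc, rfl⟩ := hmem e he
      exact (mem_edgesAvoiding.1 (hg c hc)).1
    · obtain ⟨c, hc, rfl⟩ := hmem e he
      exact (mem_edgesAvoiding.1 (hg c hc)).2 v hvU hv
    · obtain ⟨c, hc, rfl⟩ := hmem e he
      exact (hC c hc).symm ▸ hf c hc
    · obtain ⟨c, hc, rfl⟩ := hmem e he
      obtain ⟨c', hc', rfl⟩ := hmem e' he'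
      rw [hC, hC] at heq
      subst heq
      rfl
  rw [← hRcard]
  by_contra! hle
  unfold epsilon at hle
  split_ifs at hle with hε
  · obtain ⟨i₀, hi₀⟩ := heven
    have : Nontrivial (Fin k) := Fin.nontrivial_iff_two_le.2 hk
    obtain ⟨i₁, hi₁⟩ := exists_ne i₀
    exact hno (h.of_even hU hS hi₁.symm (ht _) (ht _) hi₀ hfresh (by omega) (by omega))
  · have hpos : 0 < (Finset.univ.filter fun i => Even (t i)).card := by
      obtain ⟨i, hi⟩ := heven
      exact Finset.card_pos.2 ⟨i, by simpa using hi⟩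
    have hone : 1 < (Finset.univ.filter fun i => Even (t i)).card := by omega
    obtain ⟨i₀, hi₀, i₁, hi₁, hne⟩ := Finset.one_lt_card.1 hone
    exact hno (h.of_even_even hU hS hne (ht _) (ht _) (by simpa using hi₀) (by simpa using hi₁)
      hfresh (by omega) (by omega))

/-- The colors of the edges that meet `U`, if the core cannot be enlarged. -/
theorem IsCore.card_colors_le [DecidableEq K] (h : IsCore C U Y S β)
    (hmax : ∀ z ∈ (Finset.univ \ U) \ Y, ¬ IsCore C U (insert z Y) S β) :
    (insert β ((edgesMeeting U).image C)).card + ((Finset.univ \ U) \ Y).card ≤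
      (edgesMeeting U).card + 1 := by
  set B := (Finset.univ \ U) \ Y with hB
  have hBU : ∀ z ∈ B, z ∉ U := fun z hz => by simp [hB] at hz; exact hz.1
  have hBY : ∀ z ∈ B, z ∉ Y := fun z hz => by simp [hB] at hz; exact hz.2
  have hex : ∀ z, ∃ u, z ∈ B → u ∈ U ∧ (C s(u, z) = β ∨
      (∃ u' ∈ U, ∃ y ∈ Y, C s(u, z) = C s(u', y)) ∨
      ∃ u' ∈ U, u' ≠ u ∧ C s(u, z) = C s(u', z)) := by
    intro z
    by_cases hz : z ∈ B
    · obtain ⟨u, hu, hc⟩ := h.exists_superfluous (hBU z hz) (hmax z hz)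
      exact ⟨u, fun _ => ⟨hu, hc⟩⟩
    · exact ⟨z, fun h => absurd h hz⟩
  choose f hf using hex
  -- One superfluous edge per vertex of B; its color is β or survives on an edge to Y or on another
  -- edge from the same vertex to U, neither of which belongs to X.
  set X := B.image fun z => s(f z, z) with hX
  have hXmem : ∀ u ∈ U, ∀ y, s(u, y) ∈ X → y ∈ B ∧ u = f y := by
    intro u hu y hy
    obtain ⟨z, hz, heq⟩ := Finset.mem_image.1 hy
    rw [Sym2.eq_iff] at heq
    rcases heq with ⟨h1, rfl⟩ | ⟨-, h2⟩
    · exact ⟨hz, h1.symm⟩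
    · exact absurd (h2 ▸ hu) (hBU z hz)
  have hmeet : ∀ u ∈ U, ∀ y, y ∉ U → s(u, y) ∈ edgesMeeting U := by
    intro u hu y hy
    refine mem_edgesMeeting.2 ⟨?_, u, hu, by simp⟩
    rw [Sym2.mk_isDiag_iff]
    rintro rfl
    exact hy hu
  have hXcard : X.card = B.card := by
    refine Finset.card_image_of_injOn fun z hz z' hz' heq => ?_
    rcases Sym2.eq_iff.1 heq with ⟨-, h2⟩ | ⟨h1, -⟩
    · exact h2
    · exact absurd (h1 ▸ (hf z hz).1) (hBU z' hz')
  have hXsub : X ⊆ edgesMeeting U := by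
    intro e he
    obtain ⟨z, hz, rfl⟩ := Finset.mem_image.1 he
    exact hmeet _ (hf z hz).1 z (hBU z hz)
  have hsub : insert β ((edgesMeeting U).image C) ⊆ insert β ((edgesMeeting U \ X).image C) := by
    refine Finset.insert_subset (Finset.mem_insert_self _ _) fun c hc => ?_
    obtain ⟨e, he, rfl⟩ := Finset.mem_image.1 hc
    by_cases heX : e ∈ X
    · obtain ⟨z, hz, rfl⟩ := Finset.mem_image.1 heX
      obtain ⟨hu, hβ | ⟨u', hu', y, hy, hc'⟩ | ⟨u', hu', hne, hc'⟩⟩ := hf z hz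
      · exact Finset.mem_insert.2 (Or.inl hβ)
      · refine Finset.mem_insert_of_mem (Finset.mem_image.2 ⟨s(u', y), ?_, hc'.symm⟩)
        exact Finset.mem_sdiff.2 ⟨hmeet u' hu' y (h.notMem_hubs hy),
          fun hx => hBY y (hXmem u' hu' y hx).1 hy⟩
      · refine Finset.mem_insert_of_mem (Finset.mem_image.2 ⟨s(u', z), ?_, hc'.symm⟩)
        exact Finset.mem_sdiff.2 ⟨hmeet u' hu' z (hBU z hz), fun hx => hne (hXmem u' hu' z hx).2⟩
    · exact Finset.mem_insert_of_mem (Finset.mem_image_of_mem _ (Finset.mem_sdiff.2 ⟨he, heX⟩))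
  have h1 := Finset.card_le_card hsub
  have h2 := Finset.card_insert_le β ((edgesMeeting U \ X).image C)
  have h3 := Finset.card_image_le (s := edgesMeeting U \ X) (f := C)
  have h4 := Finset.card_sdiff_add_card_eq_card hXsub
  omega

/-- A core that cannot be enlarged contains all vertices outside `U`. -/
theorem IsCore.eq_compl_of_maximal (h : IsCore C U Y S β) (hU : halfSum t ≤ U.card + 2)
    (hS : k + halfSum t + 40 ≤ S.card) (hk : 2 ≤ k) (ht : ∀ i, 2 ≤ t i) (heven : ∃ i, Even (t i))
    (hno : ¬ HasRainbowPaths C t)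
    (hmax : ∀ z ∈ (Finset.univ \ U) \ Y, ¬ IsCore C U (insert z Y) S β)
    (hcol : (edgesMeeting U).card + 1 + epsilon t ≤ (C '' (⊤ : SimpleGraph V).edgeSet).ncard) :
    Y = Finset.univ \ U ∧ ∃ D : Finset K, D.card = epsilon t ∧
      ∀ c ∈ D, IsFresh C U Y β c ∧ ∃ e ∈ edgesAvoiding U, C e = c := by
  classical
  set D := ((edgesAvoiding U).image C).filter fun c => IsFresh C U Y β c with hD
  have hDmem : ∀ c ∈ D, IsFresh C U Y β c ∧ ∃ e ∈ edgesAvoiding U, C e = c := by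
    intro c hc
    obtain ⟨hc, hf⟩ := Finset.mem_filter.1 hc
    exact ⟨hf, Finset.mem_image.1 hc⟩
  have h1 := h.card_fresh_lt hU hS hk ht heven hno hDmem
  have h2 := h.card_colors_le hmax
  have hsub : (edgesMeeting U ∪ edgesAvoiding U).image C ⊆
      insert β ((edgesMeeting U).image C) ∪ D := by
    intro c hc
    obtain ⟨e, he, rfl⟩ := Finset.mem_image.1 hc
    rcases Finset.mem_union.1 he with he | he
    · exact Finset.mem_union_left _ (Finset.mem_insert_of_mem (Finset.mem_image_of_mem _ he))
    · by_cases hf : IsFresh C U Y β (C e)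
      · exact Finset.mem_union_right _ (Finset.mem_filter.2 ⟨Finset.mem_image_of_mem _ he, hf⟩)
      · refine Finset.mem_union_left _ ?_
        unfold IsFresh at hf
        push Not at hf
        by_cases hβ : C e = β
        · exact Finset.mem_insert.2 (Or.inl hβ)
        · obtain ⟨u, hu, y, hy, hc⟩ := hf hβ
          refine Finset.mem_insert_of_mem (Finset.mem_image.2 ⟨s(u, y), ?_, hc⟩)
          refine mem_edgesMeeting.2 ⟨?_, u, hu, by simp⟩
          rw [Sym2.mk_isDiag_iff]
          rintro rfl
          exact h.notMem_hubs hy hu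
  have h3 := (Finset.card_le_card hsub).trans (Finset.card_union_le _ _)
  rw [← coe_edgesMeeting_union_edgesAvoiding U, ← Finset.coe_image, Set.ncard_coe_finset] at hcol
  -- There are at least |B| + ε fresh colors by `h2` and `hcol`, but fewer than ε + max 1 |B|; hence
  -- |B| < max 1 |B|.
  have h4 : ((Finset.univ \ U) \ Y).card = 0 := by omega
  refine ⟨?_, D, by omega, hDmem⟩
  rw [Finset.card_eq_zero, Finset.sdiff_eq_empty_iff_subset] at h4
  refine (Finset.Subset.antisymm ?_ h4)
  intro y hy
  simpa using h.notMem_hubs hy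

/-- The colors between `U` and the other vertices do not occur outside `U`. -/
theorem IsCore.color_ne (h : IsCore C U (Finset.univ \ U) S β) (hU : halfSum t ≤ U.card + 2)
    (hS : k + halfSum t + 41 ≤ S.card) (hk : 2 ≤ k) (ht : ∀ i, 2 ≤ t i) (heven : ∃ i, Even (t i))
    (hno : ¬ HasRainbowPaths C t) {D : Finset K} (hDcard : D.card = epsilon t)
    (hD : ∀ c ∈ D, IsFresh C U (Finset.univ \ U) β c ∧ ∃ e ∈ edgesAvoiding U, C e = c)
    {u y₀ : V} (hu : u ∈ U) (hy₀ : y₀ ∉ U) {e : Sym2 V} (he : e ∈ edgesAvoiding U) :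
    C e ≠ C s(u, y₀) := by
  classical
  intro heq
  have hy₀' : y₀ ∈ Finset.univ \ U := by simpa using hy₀
  -- Dropping y₀ from the core makes the repeated color fresh. Then |B| = 1, while there are ε + 1
  -- fresh colors, one too many.
  have hY : (Finset.univ \ U).erase y₀ ⊆ Finset.univ \ U := Finset.erase_subset _ _
  have h' : IsCore C U ((Finset.univ \ U).erase y₀) (S.erase y₀) β :=
    ⟨⟨h.disjoint.mono_right hY, fun u hu y hy u' hu' y' hy' =>
      h.inj u hu y (hY hy) u' hu' y' (hY hy')⟩, Finset.erase_subset_erase _ h.sub,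
      fun x hx y hy => h.mono x (Finset.mem_of_mem_erase hx) y (Finset.mem_of_mem_erase hy),
      fun u hu y hy => h.notHub u hu y (hY hy)⟩
  have hS' := Finset.pred_card_le_card_erase (s := S) (a := y₀)
  have hcD : C s(u, y₀) ∉ D := fun hc => (hD _ hc).1.2 u hu y₀ hy₀' rfl
  have h1 := h'.card_fresh_lt hU (by omega) hk ht heven hno (D := insert (C s(u, y₀)) D) (by
    intro c hc
    rcases Finset.mem_insert.1 hc with rfl | hc
    · refine ⟨⟨h.notHub u hu y₀ hy₀', fun u' hu' y hy heq' => ?_⟩, e, he, heq⟩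
      exact (Finset.mem_erase.1 hy).1 (h.inj u' hu' y (hY hy) u hu y₀ hy₀' heq').2
    · exact ⟨⟨(hD c hc).1.1, fun u' hu' y hy => (hD c hc).1.2 u' hu' y (hY hy)⟩, (hD c hc).2⟩)
  rw [Finset.card_insert_of_notMem hcD, Finset.sdiff_erase hy₀'] at h1
  simp at h1
  omega

/-- The structure of a coloring with a core and the maximal number of colors. -/
theorem IsCore.color_structure (h : IsCore C U S S β) (hU : halfSum t ≤ U.card + 2)
    (hS : k + halfSum t + 41 ≤ S.card) (hk : 2 ≤ k) (ht : ∀ i, 2 ≤ t i) (heven : ∃ i, Even (t i))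
    (hno : ¬ HasRainbowPaths C t)
    (hcol : (edgesMeeting U).card + 1 + epsilon t ≤ (C '' (⊤ : SimpleGraph V).edgeSet).ncard) :
    (C '' (⊤ : SimpleGraph V).edgeSet).ncard = (edgesMeeting U).card + 1 + epsilon t ∧
      Set.InjOn C (edgesMeeting U) ∧ (C '' edgesAvoiding U).ncard = 1 + epsilon t ∧
      Disjoint (C '' edgesMeeting U) (C '' edgesAvoiding U) := by
  classical
  obtain ⟨Y, hY, hYmax⟩ := Finset.exists_max_image
    (Finset.univ.filter fun Y => IsCore C U Y S β) Finset.card ⟨S, by simpa using h⟩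
  have hY : IsCore C U Y S β := by simpa using hY
  obtain ⟨rfl, D, hDcard, hD⟩ := hY.eq_compl_of_maximal hU (by omega) hk ht heven hno
    (fun z hz hc => by
      have h1 := hYmax _ (Finset.mem_filter.2 ⟨Finset.mem_univ _, hc⟩)
      rw [Finset.card_insert_of_notMem (Finset.mem_sdiff.1 hz).2] at h1
      omega) hcol
  have hne := fun u y₀ (hu : u ∈ U) (hy₀ : y₀ ∉ U) e (he : e ∈ edgesAvoiding U) =>
    hY.color_ne hU hS hk ht heven hno hDcard hD hu hy₀ he
  -- By `hne` every color outside U other than β is fresh, so at most 1 + ε colors occur there. The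
  -- total then forces equality in all estimates.
  have h1 := hY.card_fresh_lt hU (by omega) hk ht heven hno
    (D := ((edgesAvoiding U).image C).erase β) (by
    intro c hc
    obtain ⟨hcβ, hc⟩ := Finset.mem_erase.1 hc
    obtain ⟨e, he, rfl⟩ := Finset.mem_image.1 hc
    refine ⟨⟨hcβ, fun u hu y hy => ?_⟩, e, he, rfl⟩
    exact (hne u y hu (hY.notMem_hubs hy) e he).symm)
  have h2 := Finset.pred_card_le_card_erase (s := (edgesAvoiding U).image C) (a := β)
  simp only [sdiff_self, Finset.bot_eq_empty, Finset.card_empty] at h1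
  have h3 := Finset.card_image_le (s := edgesMeeting U) (f := C)
  have h4 := Finset.card_union_le ((edgesMeeting U).image C) ((edgesAvoiding U).image C)
  rw [← coe_edgesMeeting_union_edgesAvoiding U, ← Finset.coe_image, Set.ncard_coe_finset,
    Finset.image_union] at hcol ⊢
  refine ⟨by omega, Finset.card_image_iff.1 (by omega), ?_, ?_⟩
  · rw [← Finset.coe_image, Set.ncard_coe_finset]
    omega
  · rw [← Finset.coe_image, ← Finset.coe_image, Finset.disjoint_coe,
      ← Finset.card_union_eq_card_add_card]
    omega

/-- The upper bound, together with the structure of the colorings that attain it. -/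
theorem exists_hub_structure {k : ℕ} (hk : 2 ≤ k) (t : Fin k → ℕ) (ht : ∀ i, 2 ≤ t i)
    (heven : ∃ i, Even (t i)) :
    ∃ N : ℕ, ∀ (V : Type u) [Fintype V] [DecidableEq V] (K : Type v) (C : Sym2 V → K),
      N ≤ Fintype.card V → ¬ HasRainbowPaths C t →
      (halfSum t - 2).choose 2 + (halfSum t - 2) * (Fintype.card V - (halfSum t - 2)) + 1 +
        epsilon t ≤ (C '' (⊤ : SimpleGraph V).edgeSet).ncard →
      (C '' (⊤ : SimpleGraph V).edgeSet).ncard = (halfSum t - 2).choose 2 +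
        (halfSum t - 2) * (Fintype.card V - (halfSum t - 2)) + 1 + epsilon t ∧
      ∃ U : Finset V, U.card = halfSum t - 2 ∧ Set.InjOn C (edgesMeeting U) ∧
        (C '' edgesAvoiding U).ncard = 1 + epsilon t ∧
        Disjoint (C '' edgesMeeting U) (C '' edgesAvoiding U) := by
  obtain ⟨N, hN⟩ := exists_isCore.{u, v} hk t ht heven (k + halfSum t + 41)
  refine ⟨N, fun V _ _ K C hcard hno hcol => ?_⟩
  obtain ⟨U, S, β, hUcard, hcore, hS⟩ := hN V K C hcard hno (by omega)
  have hm := card_edgesMeeting U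
  rw [hUcard] at hm
  rw [← hm] at hcol ⊢
  obtain ⟨h1, h2⟩ := hcore.color_structure (by omega) hS hk ht heven hno hcol
  exact ⟨h1, U, hUcard, h2⟩

end Structure

/-! ### Colorings of the family contain no rainbow copy. -/

section LowerBound

/-- The edges of a rainbow copy are few, apart from those that meet `U`. -/
theorem card_le_of_rainbow_copy {V S W : Type*} [Finite V] [DecidableEq V] {c : Coloring V S}
    {F : SimpleGraph W}
    (f : Copy F (⊤ : SimpleGraph V))
    (hf : Function.Injective fun e : F.edgeSet => c (f.mapEdgeSet e)) (U : Finset V)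
    {ι : Type*} [Fintype ι] (p q : ι → W) (hadj : ∀ i, F.Adj (p i) (q i))
    (hinj : Function.Injective fun i => s(p i, q i)) :
    Fintype.card ι ≤ (Finset.univ.filter fun i => f (p i) ∈ U).card +
      (Finset.univ.filter fun i => f (q i) ∈ U).card + (c '' (incidentEdges U)ᶜ).ncard := by
  classical
  set R := Finset.univ.filter fun i => f (p i) ∉ U ∧ f (q i) ∉ U with hR
  have h1 : R.card ≤ (c '' (incidentEdges U)ᶜ).ncard := by
    rw [← Set.ncard_coe_finset]
    refine Set.ncard_le_ncard_of_injOn (fun i => c (f.mapEdgeSet ⟨s(p i, q i), hadj i⟩)) ?_ ?_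
      (Set.toFinite _)
    · intro i hi
      obtain ⟨-, hp, hq⟩ := Finset.mem_filter.1 hi
      refine Set.mem_image_of_mem _ ?_
      rintro ⟨u, hu, hue⟩
      have hue' : u ∈ s(f (p i), f (q i)) := hue
      rcases Sym2.mem_iff.1 hue' with rfl | rfl
      · exact hp hu
      · exact hq hu
    · intro i _ j _ hij
      exact hinj (congrArg Subtype.val (hf hij))
  have h2 : (Finset.univ : Finset ι) ⊆ (Finset.univ.filter fun i => f (p i) ∈ U) ∪
      (Finset.univ.filter fun i => f (q i) ∈ U) ∪ R := by
    intro i _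
    simp only [hR, Finset.mem_union, Finset.mem_filter, Finset.mem_univ, true_and]
    tauto
  calc Fintype.card ι = (Finset.univ : Finset ι).card := rfl
    _ ≤ _ := Finset.card_le_card h2
    _ ≤ _ := (Finset.card_union_le _ _).trans (add_le_add (Finset.card_union_le _ _) h1)

theorem card_filter_mem_le {ι W : Type*} [Fintype ι] [DecidableEq W] {p : ι → W}
    (hp : Function.Injective p) (U : Finset W) :
    (Finset.univ.filter fun i => p i ∈ U).card ≤ U.card :=
  Finset.card_le_card_of_injOn p (fun _ hi => (Finset.mem_filter.1 hi).2) hp.injOn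

theorem card_filter_mem_add_le {ι W : Type*} [Fintype ι] [DecidableEq W] {p q : ι → W}
    (hpq : Function.Injective (Sum.elim p q)) (U : Finset W) :
    (Finset.univ.filter fun i => p i ∈ U).card + (Finset.univ.filter fun i => q i ∈ U).card ≤
      U.card := by
  have h := card_filter_mem_le hpq U
  rw [Finset.card_filter, Fintype.sum_sum_type] at h
  rw [Finset.card_filter, Finset.card_filter]
  exact h

variable {k : ℕ} {t : Fin k → ℕ}

/-- Componentwise, t - 1 is 2⌊t / 2⌋, minus one if t is even. With exactly one even order, F thus
has 2s - 1 edges. -/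
theorem sum_sub_one_add_card_even (ht : ∀ i, 2 ≤ t i) :
    ∑ i, (t i - 1) + (Finset.univ.filter fun i => Even (t i)).card = 2 * halfSum t := by
  unfold halfSum
  rw [Finset.card_filter, ← Finset.sum_add_distrib, Finset.mul_sum]
  refine Finset.sum_congr rfl fun i _ => ?_
  have := ht i
  split_ifs with h
  · obtain ⟨a, ha⟩ := h
    omega
  · obtain ⟨a, ha⟩ := Nat.not_even_iff_odd.1 h
    omega

theorem two_le_halfSum (hk : 2 ≤ k) (ht : ∀ i, 2 ≤ t i) : 2 ≤ halfSum t := by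
  calc 2 ≤ ∑ i : Fin k, 1 := by simpa using hk
    _ ≤ _ := Finset.sum_le_sum fun i _ => by have := ht i; omega

/-- The colorings in the family have no rainbow copy of the linear forest. -/
theorem not_hasRainbowCopy {V S : Type*} [Finite V] {c : Coloring V S} (hk : 2 ≤ k)
    (ht : ∀ i, 2 ≤ t i) {U : Finset V} (hU : U.card = halfSum t - 2)
    (hc : (c '' (incidentEdges U)ᶜ).ncard ≤ 1 + epsilon t) :
    ¬ HasRainbowCopy c (linearForest t) := by
  classical
  rintro ⟨f, hf⟩
  have hs := two_le_halfSum hk ht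
  unfold epsilon at hc
  split_ifs at hc with hε
  -- All edges of F are counted: each hub is the first end of at most one of them and the second end
  -- of at most one.
  · have hlt : ∀ x : Σ i, Fin (t i - 1), x.2.val + 1 < t x.1 := fun x => by
      have := x.2.isLt
      omega
    let p : (Σ i, Fin (t i - 1)) → Σ i, Fin (t i) := fun x =>
      ⟨x.1, ⟨x.2, (Nat.lt_succ_self _).trans (hlt x)⟩⟩
    let q : (Σ i, Fin (t i - 1)) → Σ i, Fin (t i) := fun x => ⟨x.1, ⟨x.2 + 1, hlt x⟩⟩
    have hp : Function.Injective p := by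
      rintro ⟨i, a⟩ ⟨j, b⟩ h
      simp only [p, Sigma.mk.injEq] at h
      obtain ⟨rfl, h⟩ := h
      simp only [heq_eq_eq, Fin.mk.injEq] at h
      rw [Fin.ext h]
    have hq : Function.Injective q := by
      rintro ⟨i, a⟩ ⟨j, b⟩ h
      simp only [q, Sigma.mk.injEq] at h
      obtain ⟨rfl, h⟩ := h
      simp only [heq_eq_eq, Fin.mk.injEq, Nat.add_right_cancel_iff] at h
      rw [Fin.ext h]
    have hpq : Function.Injective fun x => s(p x, q x) := by
      rintro ⟨i, a⟩ ⟨j, b⟩ h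
      rcases Sym2.eq_iff.1 h with ⟨h, -⟩ | ⟨h1, h2⟩
      · exact hp h
      · simp only [p, q, Sigma.mk.injEq] at h1 h2
        obtain ⟨rfl, h1⟩ := h1
        simp only [heq_eq_eq, Fin.mk.injEq, true_and] at h1 h2
        omega
    have h1 := card_le_of_rainbow_copy f hf U p q (fun x => (linearForest_adj _ _ _ _).2
      ⟨rfl, Or.inl rfl⟩) hpq
    have h2 := card_filter_mem_le (p := fun x => f (p x)) (f.injective.comp hp) U
    have h3 := card_filter_mem_le (p := fun x => f (q x)) (f.injective.comp hq) U
    have h4 := sum_sub_one_add_card_even ht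
    rw [Fintype.card_sigma] at h1
    simp only [Fintype.card_fin] at h1
    omega
  -- Only the matching of the pairs 2j, 2j + 1 is counted; each hub meets at most one of its s
  -- edges.
  · have hlt : ∀ x : Σ i, Fin (t i / 2), 2 * x.2.val + 1 < t x.1 := fun x => by
      have := x.2.isLt
      omega
    let p : (Σ i, Fin (t i / 2)) → Σ i, Fin (t i) := fun x =>
      ⟨x.1, ⟨2 * x.2, (Nat.lt_succ_self _).trans (hlt x)⟩⟩
    let q : (Σ i, Fin (t i / 2)) → Σ i, Fin (t i) := fun x => ⟨x.1, ⟨2 * x.2 + 1, hlt x⟩⟩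
    have hpq : Function.Injective (Sum.elim p q) := by
      rintro (⟨i, a⟩ | ⟨i, a⟩) (⟨j, b⟩ | ⟨j, b⟩) h <;>
        simp only [p, q, Sum.elim_inl, Sum.elim_inr, Sigma.mk.injEq] at h <;>
        obtain ⟨rfl, h⟩ := h <;>
        simp only [heq_eq_eq, Fin.mk.injEq] at h
      · rw [Fin.ext (show a.val = b.val by omega)]
      · omega
      · omega
      · rw [Fin.ext (show a.val = b.val by omega)]
    have hpq' : Function.Injective fun x => s(p x, q x) := by
      intro x y h
      rcases Sym2.eq_iff.1 h with ⟨h, -⟩ | ⟨h1, -⟩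
      · exact Sum.inl_injective (hpq (a₁ := Sum.inl x) (a₂ := Sum.inl y) h)
      · exact absurd (hpq (a₁ := Sum.inl x) (a₂ := Sum.inr y) h1) (by simp)
    have h1 := card_le_of_rainbow_copy f hf U p q (fun x => (linearForest_adj _ _ _ _).2
      ⟨rfl, Or.inl rfl⟩) hpq'
    have h2 := card_filter_mem_add_le (p := fun x => f (p x)) (q := fun x => f (q x))
      (by
        have := f.injective.comp hpq
        rwa [Sum.comp_elim] at this) U
    rw [Fintype.card_sigma] at h1
    simp only [Fintype.card_fin] at h1
    unfold halfSum at hs hU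
    omega

end LowerBound

/-! ### Between edge-colorings and functions on unordered pairs. -/

section Transfer

variable {V S : Type*}

open Classical in
/-- An edge-coloring as a function on unordered pairs. -/
noncomputable def Coloring.extend (c : Coloring V S) (e : Sym2 V) : Option S :=
  if h : e ∈ (⊤ : SimpleGraph V).edgeSet then some (c ⟨e, h⟩) else none

theorem Coloring.extend_coe (c : Coloring V S) (e : (⊤ : SimpleGraph V).edgeSet) :
    c.extend e = some (c e) := by
  simp only [Coloring.extend, e.2, dite_true]

theorem Coloring.image_extend (c : Coloring V S) (A : Set (⊤ : SimpleGraph V).edgeSet) :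
    c.extend '' (Subtype.val '' A) = some '' (c '' A) := by
  rw [Set.image_image, Set.image_image]
  exact Set.image_congr fun e _ => c.extend_coe e

theorem Coloring.ncard_image_extend (c : Coloring V S) (A : Set (⊤ : SimpleGraph V).edgeSet) :
    (c.extend '' (Subtype.val '' A)).ncard = (c '' A).ncard := by
  rw [c.image_extend, Set.ncard_image_of_injective _ (Option.some_injective S)]

theorem Coloring.ncard_image_extend_edgeSet (c : Coloring V S) :
    (c.extend '' (⊤ : SimpleGraph V).edgeSet).ncard = numColors c := by
  rw [numColors, ← Set.image_univ, ← c.ncard_image_extend, Set.image_univ, Subtype.range_coe]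

/-- Initial segments of the lists serve as the components, and all their edges lie in one rainbow
graph. -/
theorem HasRainbowPaths.hasRainbowCopy {c : Coloring V S} {k : ℕ} {t : Fin k → ℕ}
    (h : HasRainbowPaths c.extend t) : HasRainbowCopy c (linearForest t) := by
  obtain ⟨G, hG, L, hlen, hL, hd⟩ := h
  let φ : (Σ i, Fin (t i)) → V := fun x => (L x.1)[x.2.val]'(x.2.isLt.trans_le (hlen x.1))
  have hφ : Function.Injective φ := by
    rintro ⟨i, a⟩ ⟨j, b⟩ hab
    by_cases hij : i = j
    · subst hij
      have hval : a.val = b.val := (List.Nodup.getElem_inj_iff (hL i).1).1 hab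
      rw [Fin.ext hval]
    · have hmem : φ ⟨i, a⟩ ∈ L j := by
        rw [hab]
        exact List.getElem_mem _
      exact absurd hmem (hd hij (List.getElem_mem _))
  have hadj : ∀ x y, (linearForest t).Adj x y → G.Adj (φ x) (φ y) := by
    rintro ⟨i, a⟩ ⟨j, b⟩ hxy
    obtain ⟨rfl, hab⟩ := (linearForest_adj _ _ _ _).1 hxy
    have hchain := List.isChain_iff_getElem.1 (hL i).2
    have ha := a.isLt.trans_le (hlen i)
    have hb := b.isLt.trans_le (hlen i)
    rcases hab with hab | hab
    · have := hchain a.val (by omega)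
      simpa only [φ, hab] using this
    · have := (hchain b.val (by omega)).symm
      simpa only [φ, hab] using this
  let f : Copy (linearForest t) (⊤ : SimpleGraph V) :=
    ⟨⟨φ, fun {x y} hxy => (hadj x y hxy).ne⟩, hφ⟩
  refine ⟨f, fun e e' hee => ?_⟩
  have hmem : ∀ e : (linearForest t).edgeSet, (f.mapEdgeSet e : Sym2 V) ∈ G.edgeSet := by
    rintro ⟨e, he⟩
    induction e with | _ x y
    exact hadj x y he
  have h1 : c.extend (f.mapEdgeSet e) = c.extend (f.mapEdgeSet e') := by
    rw [c.extend_coe, c.extend_coe]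
    exact congrArg some hee
  have h2 := hG (hmem e) (hmem e') h1
  exact f.mapEdgeSet.injective (Subtype.ext h2)

variable [Fintype V] [DecidableEq V]

theorem coe_edgesMeeting (U : Finset V) :
    (edgesMeeting U : Set (Sym2 V)) = Subtype.val '' incidentEdges U := by
  ext e
  simp only [Finset.mem_coe, mem_edgesMeeting, incidentEdges, Set.mem_image, Set.mem_ofPred_eq,
    Subtype.exists, exists_and_right, exists_eq_right, SimpleGraph.edgeSet_top, Set.mem_compl_iff,
    Sym2.mem_diagSet, exists_prop]

theorem coe_edgesAvoiding (U : Finset V) :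
    (edgesAvoiding U : Set (Sym2 V)) = Subtype.val '' (incidentEdges U)ᶜ := by
  ext e
  simp only [Finset.mem_coe, mem_edgesAvoiding, incidentEdges, Set.mem_image, Set.mem_ofPred_eq,
    Subtype.exists, exists_and_right, exists_eq_right, SimpleGraph.edgeSet_top, Set.mem_compl_iff,
    Sym2.mem_diagSet, exists_prop, not_exists, not_and]

end Transfer

/-! ### The extremal coloring and the upper bound for K_n. -/

section Extremal

theorem epsilon_le_one {k : ℕ} (t : Fin k → ℕ) : epsilon t ≤ 1 := by
  unfold epsilon
  split_ifs <;> omega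

theorem ncard_incidentEdges {V : Type*} [Fintype V] [DecidableEq V] (U : Finset V) :
    (incidentEdges U).ncard = U.card.choose 2 + U.card * (Fintype.card V - U.card) := by
  rw [← card_edgesMeeting, ← Set.ncard_coe_finset, coe_edgesMeeting,
    Set.ncard_image_of_injective _ Subtype.val_injective]

/-- All edges that meet `U` get their own color, the other edges get `1 + ε` colors. -/
theorem exists_coloring {V : Type*} [Fintype V] [DecidableEq V] (U : Finset V)
    (hU : U.card + 3 ≤ Fintype.card V) {ε : ℕ} (hε : ε ≤ 1) :
    ∃ c : Coloring V ℕ, (c '' (incidentEdges U)ᶜ).ncard ≤ 1 + ε ∧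
      U.card.choose 2 + U.card * (Fintype.card V - U.card) + 1 + ε ≤ numColors c := by
  classical
  have hout : 2 < (Finset.univ \ U).card := by
    rw [Finset.card_univ_sdiff]
    omega
  -- Three vertices outside U give two distinct edges there, so that both colors 0 and ε occur even
  -- if ε = 1.
  obtain ⟨a, ha, b, hb, d, hd, hab, had, hbd⟩ := Finset.two_lt_card.1 hout
  simp only [Finset.mem_sdiff, Finset.mem_univ, true_and] at ha hb hd
  let e₀ : (⊤ : SimpleGraph V).edgeSet := ⟨s(a, b), hab⟩
  let e₁ : (⊤ : SimpleGraph V).edgeSet := ⟨s(a, d), had⟩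
  have hne : e₁ ≠ e₀ := by
    intro h
    have := congrArg Subtype.val h
    simp only [e₀, e₁, Sym2.eq_iff] at this
    grind
  have he₀ : e₀ ∉ incidentEdges U := by
    rintro ⟨u, hu, hue⟩
    rcases Sym2.mem_iff.1 hue with rfl | rfl
    · exact ha hu
    · exact hb hu
  have he₁ : e₁ ∉ incidentEdges U := by
    rintro ⟨u, hu, hue⟩
    rcases Sym2.mem_iff.1 hue with rfl | rfl
    · exact ha hu
    · exact hd hu
  let ψ := Fintype.equivFin (⊤ : SimpleGraph V).edgeSet
  let c : Coloring V ℕ := fun e =>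
    if e ∈ incidentEdges U then 2 + (ψ e : ℕ) else if e = e₀ then ε else 0
  have hcin : ∀ e ∈ incidentEdges U, c e = 2 + (ψ e : ℕ) := fun e he => if_pos he
  have hc₀ : c e₀ = ε := by simp [c, he₀]
  have hc₁ : c e₁ = 0 := by simp [c, he₁, hne]
  have hinj : Set.InjOn c (incidentEdges U) := by
    intro e he e' he' h
    rw [hcin e he, hcin e' he'] at h
    exact ψ.injective (Fin.ext (by omega))
  refine ⟨c, ?_, ?_⟩
  · have hsub : c '' (incidentEdges U)ᶜ ⊆ Set.Icc 0 ε := by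
      rintro _ ⟨e, he, rfl⟩
      have he' : e ∉ incidentEdges U := he
      simp only [c, he', if_false, Set.mem_Icc]
      split_ifs <;> omega
    have h1 := Set.ncard_le_ncard hsub (Set.toFinite _)
    rw [← Finset.coe_Icc, Set.ncard_coe_finset, Nat.card_Icc] at h1
    omega
  · have hsub : c '' incidentEdges U ∪ Set.Icc 0 ε ⊆ Set.range c := by
      refine Set.union_subset (Set.image_subset_range _ _) fun x hx => ?_
      rw [Set.mem_Icc] at hx
      by_cases h0 : x = 0
      · exact ⟨e₁, by rw [hc₁, h0]⟩
      · exact ⟨e₀, by rw [hc₀]; omega⟩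
    have hdisj : Disjoint (c '' incidentEdges U) (Set.Icc 0 ε) := by
      rw [Set.disjoint_left]
      rintro _ ⟨e, he, rfl⟩ hx
      rw [hcin e he, Set.mem_Icc] at hx
      omega
    have h1 := Set.ncard_le_ncard hsub (Set.toFinite _)
    rw [Set.ncard_union_eq hdisj (Set.toFinite _) (Set.toFinite _), hinj.ncard_image,
      ncard_incidentEdges, ← Finset.coe_Icc, Set.ncard_coe_finset, Nat.card_Icc] at h1
    unfold numColors
    omega

/-- The upper bound for edge-colorings of `K_n`, with the structure of the extremal ones. -/
theorem exists_forall_memFamily.{v} {k : ℕ} (hk : 2 ≤ k) (t : Fin k → ℕ) (ht : ∀ i, 2 ≤ t i)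
    (heven : ∃ i, Even (t i)) :
    ∃ N : ℕ, ∀ n, N ≤ n → ∀ (S : Type v) (c : Coloring (Fin n) S),
      ¬ HasRainbowCopy c (linearForest t) →
      (halfSum t - 2).choose 2 + (halfSum t - 2) * (n - (halfSum t - 2)) + 1 + epsilon t ≤
        numColors c →
      numColors c =
        (halfSum t - 2).choose 2 + (halfSum t - 2) * (n - (halfSum t - 2)) + 1 + epsilon t ∧
      MemFamily t c := by
  obtain ⟨N, hN⟩ := exists_hub_structure.{0, v} hk t ht heven
  refine ⟨N, fun n hn S c hno hcol => ?_⟩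
  have h := hN (Fin n) (Option S) c.extend (by simpa using hn) (fun h => hno h.hasRainbowCopy)
  rw [c.ncard_image_extend_edgeSet, Fintype.card_fin] at h
  obtain ⟨h1, U, hU, hinj, hcard, hdisj⟩ := h hcol
  refine ⟨h1, U, hU, fun e he e' he' hee => ?_, ?_, ?_⟩
  · rw [coe_edgesMeeting] at hinj
    refine Subtype.ext (hinj (Set.mem_image_of_mem _ he) (Set.mem_image_of_mem _ he') ?_)
    rw [c.extend_coe, c.extend_coe, hee]
  · rwa [coe_edgesAvoiding, c.ncard_image_extend] at hcard
  · rw [coe_edgesAvoiding, coe_edgesMeeting, c.image_extend, c.image_extend] at hdisj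
    exact (Set.disjoint_image_iff (Option.some_injective S)).1 hdisj

end Extremal

end AntiRamsey

theorem theorem1p7 {k : ℕ} (hk : 2 ≤ k) (t : Fin k → ℕ) (ht : ∀ i, 2 ≤ t i)
    (heven : ∃ i, Even (t i)) :
    ∃ N : ℕ, ∀ n : ℕ, N ≤ n →
      AntiRamsey.antiRamseyNumber n (AntiRamsey.linearForest t) =
          (AntiRamsey.halfSum t - 2).choose 2
            + (AntiRamsey.halfSum t - 2) * (n - AntiRamsey.halfSum t + 2)
            + 1 + AntiRamsey.epsilon t ∧
        ∀ (S : Type*) (c : AntiRamsey.Coloring (Fin n) S),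
          AntiRamsey.IsExtremal (AntiRamsey.linearForest t) c → AntiRamsey.MemFamily t c := by
  -- Two instances: colors in ℕ determine the anti-Ramsey number, while the structure is claimed for
  -- colors in any universe.
  obtain ⟨N₀, hN₀⟩ := AntiRamsey.exists_forall_memFamily.{0} hk t ht heven
  obtain ⟨N₁, hN₁⟩ := AntiRamsey.exists_forall_memFamily hk t ht heven
  -- The bound s + 1 ≤ n leaves three vertices outside U and keeps the truncated subtraction n - s
  -- exact.
  refine ⟨max (max N₀ N₁) (AntiRamsey.halfSum t + 1), fun n hn => ?_⟩
  simp only [max_le_iff] at hn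
  obtain ⟨⟨hn₀, hn₁⟩, hns⟩ := hn
  have hs := AntiRamsey.two_le_halfSum hk ht
  have hsub : n - AntiRamsey.halfSum t + 2 = n - (AntiRamsey.halfSum t - 2) := by omega
  obtain ⟨U, -, hU⟩ := Finset.exists_subset_card_eq
    (show AntiRamsey.halfSum t - 2 ≤ (Finset.univ : Finset (Fin n)).card by simp; omega)
  obtain ⟨c₀, hc₀, hcol₀⟩ := AntiRamsey.exists_coloring U (by simp; omega)
    (AntiRamsey.epsilon_le_one t)
  rw [hU, Fintype.card_fin] at hcol₀
  have hno₀ := AntiRamsey.not_hasRainbowCopy hk ht hU hc₀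
  obtain ⟨⟨c₁, hno₁, hc₁⟩, hmax⟩ := AntiRamsey.isGreatest_antiRamseyNumber ⟨_, c₀, hno₀, rfl⟩
  have hle := hcol₀.trans (hmax ⟨c₀, hno₀, rfl⟩)
  have hAR := (hN₀ n hn₀ ℕ c₁ hno₁ (hle.trans_eq hc₁.symm)).1
  rw [hc₁, ← hsub] at hAR
  refine ⟨hAR, fun S c hc => (hN₁ n hn₁ S c hc.1 ?_).2⟩
  rw [hc.2, hAR, hsub]
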